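/- Let $d \ge 1$ be an integer, let $p \ge 1$ and $\gamma \ge 1$ be real, and let $\Omega = [0,1]^d$ with the Euclidean distance. For Borel probability measures on $\Omega$ let $W_p(\mu,\nu) = \inf_\pi \big(\int \|x-y\|^p \, \mathrm{d}\pi(x,y)\big)^{1/p}$, the infimum being over all couplings $\pi$ of $\mu$ and $\nu$. An estimator is a family $(\tilde\mu_n)_{n \ge 1}$, where $\tilde\mu_n$ is a (measurable) map that assigns to each sample of $n$ points of $\Omega$ a Borel probability measure on $\Omega$. Algorithms are programs for a real random access machine (unit-cost arithmetic, $\exp$, $\log$ and comparisons on real numbers; natural-number memory with unit-cost $+,-,\times$, comparisons and indirect addressing). The input is the sample size $n$ and a sample $X_1,\dots,X_n$. The program may also call two procedures, one returning a fresh independent draw from $\tilde\mu_n$ (given the sample) and one returning a fresh independent draw from $\nu$. "One can efficiently sample" means that a call takes time $\kappa(n) = O(n)$, and this time is charged to the program. Then there is a program, depending only on $d, p, \gamma$, with output $\tilde W_{p,n}$, such that: 1. (Running time.) For every $\kappa$ with $\kappa(n) = O(n)$ there is a function $T$ with $T(n) = O\big(n^{\gamma(2+2p/d)} \log n\big)$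 as $n \to \infty$ such that, for every $n \ge 1$, every sample of size $n$ and all outcomes of the draws, the program halts within $T(n)$ steps. Its output is a measurable function of the sample and the draws. 2. (Accuracy.) For every $\gamma^* \ge \gamma$ and every $C_0$ there is a constant $C$ such that the following holds. Let $\mathcal{S}$ be any class of Borel probability measures on $\Omega$ and $(\tilde\mu_n)$ any estimator such that $$\mathbb{E}\, W_p(\tilde\mu_n, \mu) \le C_0\, n^{-\gamma^*/d} \qquad \text{for all } \mu \in \mathcal{S},\ n \ge 1,$$ where $\tilde\mu_n$ is computed from $n$ independent points with law $\mu$. Then for every Borel probability measure $\nu$ on $\Omega$, every $\mu \in \mathcal{S}$ and every $n \ge 1$, given $n$ independent points with law $\mu$, $$\mathbb{E}\, \big|\tilde W_{p,n} - W_p(\nu,\mu)\big| \le C\, n^{-\gamma/d}.$$ -/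

import Mathlib

open MeasureTheory ProbabilityTheory Filter
open scoped ENNReal

noncomputable section

namespace WassersteinTradeoff

/-- The unit cube `[0,1]^d`, with the Euclidean distance and its Borel sigma-algebra. -/
abbrev Cube (d : ℕ) : Type :=
  {x : EuclideanSpace ℝ (Fin d) // ∀ i, x i ∈ Set.Icc (0 : ℝ) 1}

/-- The couplings of `μ` and `ν`: measures on the product with marginals `μ` and `ν`. -/
def couplings {E : Type*} [MeasurableSpace E] (μ ν : Measure E) : Set (Measure (E × E)) :=
  {π | π.map Prod.fst = μ ∧ π.map Prod.snd = ν}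

/-- The Wasserstein distance `W_p(μ, ν) = (inf_π ∫ dist(x, y)^p dπ(x, y))^(1/p)`. -/
def wasserstein {E : Type*} [MeasurableSpace E] [PseudoEMetricSpace E]
    (p : ℝ) (μ ν : Measure E) : ℝ≥0∞ :=
  (⨅ π ∈ couplings μ ν, ∫⁻ z, edist z.1 z.2 ^ p ∂π) ^ (1 / p)

/-! ### The machine model

A real random access machine: a memory of natural numbers, which also serve as addresses, and a
memory of real numbers, with unit cost arithmetic, `exp`, `log`, comparisons and indirect
addressing.  The only other things it can access are the sample size, the sample, and two
procedures that return fresh random points of the cube. -/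

/-- What a run of the machine has access to: the sample of size `n`, the successive answers
of the procedure that draws from the estimator, and those of the procedure that draws from
the reference measure. -/
structure Env (d n : ℕ) where
  sample : Fin n → Cube d
  estDraw : ℕ → Cube d
  refDraw : ℕ → Cube d

/-- A memory state, with the numbers of draws made so far from the two procedures. -/
structure State where
  nat : ℕ → ℕ
  real : ℕ → ℝ
  estUsed : ℕ
  refUsed : ℕ

/-- The state at the start of a run: everything is zero. -/
def State.zero : State := ⟨fun _ => 0, fun _ => 0, 0, 0⟩

/-- `s.setNat a k` writes the natural number `k` into cell `a`. -/
def State.setNat (s : State) (a k : ℕ) : State := { s with nat := Function.update s.nat a k }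

/-- `s.setReal a x` writes the real number `x` into cell `a`. -/
def State.setReal (s : State) (a : ℕ) (x : ℝ) : State :=
  { s with real := Function.update s.real a x }

/-- `s.setPoint a x` writes the `d` coordinates of `x` into the cells `a, …, a + d - 1`. -/
def State.setPoint {d : ℕ} (s : State) (a : ℕ) (x : Cube d) : State :=
  { s with real := fun k =>
      if h : a ≤ k ∧ k - a < d then x.1 ⟨k - a, h.2⟩ else s.real k }

/-- Instructions.  `N[a]` and `R[a]` are the cells with address `a` of the two memories. -/
inductive Instr
  /-- `N[a] := k` -/
  | natConst (a k : ℕ)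
  /-- `N[a] := n`, the sample size -/
  | natSize (a : ℕ)
  /-- `N[a] := N[b] + N[c]` -/
  | natAdd (a b c : ℕ)
  /-- `N[a] := N[b] - N[c]`, truncated at zero -/
  | natSub (a b c : ℕ)
  /-- `N[a] := N[b] * N[c]` -/
  | natMul (a b c : ℕ)
  /-- `N[a] := N[N[b]]` -/
  | natLoad (a b : ℕ)
  /-- `N[N[a]] := N[b]` -/
  | natStore (a b : ℕ)
  /-- `R[a] := x` -/
  | realConst (a : ℕ) (x : ℝ)
  /-- `R[a] := N[b]` -/
  | realOfNat (a b : ℕ)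
  /-- `R[a] := R[b] + R[c]` -/
  | realAdd (a b c : ℕ)
  /-- `R[a] := R[b] - R[c]` -/
  | realSub (a b c : ℕ)
  /-- `R[a] := R[b] * R[c]` -/
  | realMul (a b c : ℕ)
  /-- `R[a] := R[b] / R[c]` -/
  | realDiv (a b c : ℕ)
  /-- `R[a] := exp R[b]` -/
  | realExp (a b : ℕ)
  /-- `R[a] := log R[b]` -/
  | realLog (a b : ℕ)
  /-- `R[a] := R[N[b]]` -/
  | realLoad (a b : ℕ)
  /-- `R[N[a]] := R[b]` -/
  | realStore (a b : ℕ)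
  /-- `R[a] :=` coordinate `N[c]` of the sample point `N[b]` (zero if there is none) -/
  | readSample (a b c : ℕ)
  /-- draw a point from the estimator, and write it into `R[a], …, R[a + d - 1]` -/
  | drawEst (a : ℕ)
  /-- draw a point from the reference measure, and write it into `R[a], …, R[a + d - 1]` -/
  | drawRef (a : ℕ)

/-- The effect of an instruction. -/
def Instr.run {d n : ℕ} (e : Env d n) (s : State) : Instr → State
  | .natConst a k => s.setNat a k
  | .natSize a => s.setNat a n
  | .natAdd a b c => s.setNat a (s.nat b + s.nat c)
  | .natSub a b c => s.setNat a (s.nat b - s.nat c)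
  | .natMul a b c => s.setNat a (s.nat b * s.nat c)
  | .natLoad a b => s.setNat a (s.nat (s.nat b))
  | .natStore a b => s.setNat (s.nat a) (s.nat b)
  | .realConst a x => s.setReal a x
  | .realOfNat a b => s.setReal a (s.nat b)
  | .realAdd a b c => s.setReal a (s.real b + s.real c)
  | .realSub a b c => s.setReal a (s.real b - s.real c)
  | .realMul a b c => s.setReal a (s.real b * s.real c)
  | .realDiv a b c => s.setReal a (s.real b / s.real c)
  | .realExp a b => s.setReal a (Real.exp (s.real b))
  | .realLog a b => s.setReal a (Real.log (s.real b))
  | .realLoad a b => s.setReal a (s.real (s.nat b))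
  | .realStore a b => s.setReal (s.nat a) (s.real b)
  | .readSample a b c => s.setReal a
      (if h : s.nat b < n ∧ s.nat c < d
        then (e.sample ⟨s.nat b, h.1⟩).1 ⟨s.nat c, h.2⟩ else 0)
  | .drawEst a => { s.setPoint a (e.estDraw s.estUsed) with estUsed := s.estUsed + 1 }
  | .drawRef a => { s.setPoint a (e.refDraw s.refUsed) with refUsed := s.refUsed + 1 }

/-- The cost of an instruction, if the procedures that draw a point take time `κ`. -/
def Instr.cost (κ : ℕ) : Instr → ℕ
  | .drawEst _ => κ + 1
  | .drawRef _ => κ + 1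
  | _ => 1

/-- Tests: comparisons of two cells. -/
inductive Test
  /-- `N[a] < N[b]` -/
  | natLt (a b : ℕ)
  /-- `R[a] < R[b]` -/
  | realLt (a b : ℕ)

/-- The condition that a test checks. -/
def Test.Holds (s : State) : Test → Prop
  | .natLt a b => s.nat a < s.nat b
  | .realLt a b => s.real a < s.real b

/-- Programs. -/
inductive Prog
  | skip
  | instr (i : Instr)
  | seq (P Q : Prog)
  | cond (b : Test) (P Q : Prog)
  | loop (b : Test) (P : Prog)

/-- `Exec e κ P s s' t`: started in state `s`, the program `P` halts in state `s'` after exactly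
`t` steps.  Instructions are charged their cost, each evaluation of a test one step. -/
inductive Exec {d n : ℕ} (e : Env d n) (κ : ℕ) : Prog → State → State → ℕ → Prop
  | skip (s : State) : Exec e κ .skip s s 0
  | instr (i : Instr) (s : State) : Exec e κ (.instr i) s (i.run e s) (i.cost κ)
  | seq {P Q : Prog} {s₁ s₂ s₃ : State} {t₁ t₂ : ℕ} :
      Exec e κ P s₁ s₂ t₁ → Exec e κ Q s₂ s₃ t₂ → Exec e κ (.seq P Q) s₁ s₃ (t₁ + t₂)
  | condTrue {b : Test} {P Q : Prog} {s₁ s₂ : State} {t : ℕ} :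
      b.Holds s₁ → Exec e κ P s₁ s₂ t → Exec e κ (.cond b P Q) s₁ s₂ (t + 1)
  | condFalse {b : Test} {P Q : Prog} {s₁ s₂ : State} {t : ℕ} :
      ¬ b.Holds s₁ → Exec e κ Q s₁ s₂ t → Exec e κ (.cond b P Q) s₁ s₂ (t + 1)
  | loopTrue {b : Test} {P : Prog} {s₁ s₂ s₃ : State} {t₁ t₂ : ℕ} :
      b.Holds s₁ → Exec e κ P s₁ s₂ t₁ → Exec e κ (.loop b P) s₂ s₃ t₂ →
      Exec e κ (.loop b P) s₁ s₃ (t₁ + t₂ + 1)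
  | loopFalse {b : Test} {P : Prog} {s : State} :
      ¬ b.Holds s → Exec e κ (.loop b P) s s 1

/-- Started with empty memory, `P` halts after at most `T` steps with `out` in `R[0]`. -/
def Computes {d n : ℕ} (P : Prog) (e : Env d n) (κ : ℕ) (out : ℝ) (T : ℕ) : Prop :=
  ∃ (s : State) (t : ℕ), Exec e κ P State.zero s t ∧ s.real 0 = out ∧ t ≤ T

/-- The expected value of a nonnegative function `F` of
* a sample of `n` independent points with law `μ`,
* a sequence of points which, given the sample `x`, are independent with law `est x`,
* a sequence of independent points with law `ν`, independent of everything else. -/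
def expect {d n : ℕ} (μ ν : Measure (Cube d)) [IsProbabilityMeasure μ] [IsProbabilityMeasure ν]
    (est : Kernel (Fin n → Cube d) (Cube d)) [IsMarkovKernel est] (F : Env d n → ℝ≥0∞) : ℝ≥0∞ :=
  ∫⁻ x, ∫⁻ z, ∫⁻ y, F ⟨x, z, y⟩
    ∂(Measure.infinitePi fun _ : ℕ => ν)
    ∂(Measure.infinitePi fun _ : ℕ => est x)
    ∂(Measure.pi fun _ : Fin n => μ)

end WassersteinTradeoff

end

set_option linter.constructorNameAsVariable false

noncomputable section

namespace WassersteinTradeoff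

/-! The program is a plug-in estimator. It approximates `W_p(ν, μ̃)`, where `μ̃` is the given
estimator; by the triangle inequality this differs from `W_p(ν, μ)` by at most `W_p(μ̃, μ)`, whose
mean is controlled by hypothesis. Of the sample itself only the size is used; everything else comes
from the two kinds of draws.

Discretization. Let `m = ⌈n^(γ/d)⌉` and `L = ⌈n^(γp/d)⌉`, cut the cube into `M = m^d` cells, and
draw `N = M L²` points from each of the two measures. Replacing points by vertices of their cells
changes distances by `O(1/m)`. The total error of the empirical cell frequencies has mean at most
`√(M/N) = 1/L` (`lintegral_deviation_le`). Rounding the counts to multiples of `L` and the costs to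
multiples of `1/L` adds `O(1/L)`. Hence the optimal cost is found up to `O(1/L)`, and its `p`-th
root up to `O(1/m + L^(-1/p))`, which is `O(n^(-γ/d))` (`abs_sub_wasserstein_le`,
`rpow_le_rpow_mul_one_add_div`).

Optimization. The rounded problem has about `M L` units and integer costs at most `D L`. An auction
solves it up to an error of 1 per unit. A supplier with a unit left picks the consumer that
minimizes cost plus price; it takes a unit that was not bought at the current price or, if there is
none, the price rises by 1. Total demand strictly exceeds total supply, so some unit is never
bought, and its consumer still has price 0. This caps all prices at `D L + 1` (`AuctionInv.raise`).
A potential that grows by exactly 1 per step therefore bounds the number of steps by `O(L · M L)`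
(`AuctionInv.pot_lt`). A step scans `O(M)` entries, so the auction takes time `O((M L)²) = O(n^(γ(2
+ 2p/d)))`. Drawing costs `N κ(n)`, which is no larger because `κ(n) = O(n)` and `n ≤ n^γ ≤ M`. The
logarithm is not needed.

Certificate. The final prices show that the plan is almost optimal (`PlanCertificate`). Weak duality
(`cost_le_of_dual`) bounds its cost from above by that of any true plan, and a repair of the
marginals (`exists_isPlan`) turns it into a true plan (`PlanCertificate.estimate`). Plans between
cells and couplings of the measures correspond to each other.

Machine. The program is written in a structured language with a total semantics and an exact count
of steps, and compiled (`Code.exec_compile`). Measurability of the output follows by induction on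
the program (`Code.measurable_den`). -/

/-! ### A structured language for the machine

Named registers, two-dimensional arrays and counted loops, with a total semantics. -/

/-- The registers that hold natural numbers. -/
inductive Reg
  | m | L | M | M' | U | N | steps | dim | one | zero
  | i | j | k | l | s | t | c | idx | pw | src | best | bestVal | own | tot
  deriving DecidableEq

/-- The number of a register. -/
def Reg.num : Reg → ℕ
  | m => 0 | L => 1 | M => 2 | M' => 3 | U => 4 | N => 5 | steps => 6 | dim => 7 | one => 8
  | zero => 9 | i => 10 | j => 11 | k => 12 | l => 13 | s => 14 | t => 15 | c => 16
  | idx => 17 | pw => 18 | src => 19 | best => 20 | bestVal => 21 | own => 22 | tot => 23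

/-- The arrays. -/
inductive Arr
  | A | B | S | Q | G | H | cost | digit
  deriving DecidableEq

/-- The number of an array. -/
def Arr.num : Arr → ℕ
  | A => 0 | B => 1 | S => 2 | Q => 3 | G => 4 | H => 5 | cost => 6 | digit => 7

theorem Reg.num_injective : Function.Injective Reg.num := by
  have : Function.LeftInverse (fun a : ℕ => match a with
    | 0 => Reg.m | 1 => .L | 2 => .M | 3 => .M' | 4 => .U | 5 => .N | 6 => .steps | 7 => .dim
    | 8 => .one | 9 => .zero | 10 => .i | 11 => .j | 12 => .k | 13 => .l | 14 => .s | 15 => .t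
    | 16 => .c | 17 => .idx | 18 => .pw | 19 => .src | 20 => .best | 21 => .bestVal
    | 22 => .own | _ => .tot) Reg.num := by
    intro r; cases r <;> rfl
  exact this.injective

theorem Arr.num_injective : Function.Injective Arr.num := by
  have : Function.LeftInverse (fun a : ℕ => match a with
    | 0 => Arr.A | 1 => .B | 2 => .S | 3 => .Q | 4 => .G | 5 => .H | 6 => .cost | _ => .digit)
    Arr.num := by
    intro r; cases r <;> rfl
  exact this.injective

theorem Reg.num_lt (r : Reg) : r.num < 28 := by cases r <;> decide

theorem Arr.num_lt (a : Arr) : a.num < 8 := by cases a <;> decide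

/-- The address of a register. -/
def Reg.addr (r : Reg) : ℕ := 4 + r.num

/-- The address of an array entry. -/
def Arr.addr (A : Arr) (i j : ℕ) : ℕ := ((i + j) * (i + j) + i) * 8 + (32 + A.num)

theorem Reg.addr_inj {r r' : Reg} : r.addr = r'.addr ↔ r = r' := by
  unfold Reg.addr
  rw [Nat.add_left_cancel_iff]
  exact Reg.num_injective.eq_iff

/-- With `s = i + j` the code `s² + i` lies in `[s², s² + s]`, below `(s + 1)²`. So it determines
`s`, then `i`, then `j`. -/
theorem sq_add_left_injective {i j i' j' : ℕ}
    (h : (i + j) * (i + j) + i = (i' + j') * (i' + j') + i') : i = i' ∧ j = j' := by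
  have key : i + j = i' + j' := by
    rcases lt_trichotomy (i + j) (i' + j') with hlt | heq | hlt
    · nlinarith
    · exact heq
    · nlinarith
  rw [key] at h
  omega

theorem Arr.addr_inj {A A' : Arr} {i j i' j' : ℕ} :
    A.addr i j = A'.addr i' j' ↔ A = A' ∧ i = i' ∧ j = j' := by
  constructor
  · intro h
    have hA := A.num_lt
    have hA' := A'.num_lt
    unfold Arr.addr at h
    have h1 : A.num = A'.num := by omega
    have h2 : (i + j) * (i + j) + i = (i' + j') * (i' + j') + i' := by omega
    exact ⟨Arr.num_injective h1, sq_add_left_injective h2⟩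
  · rintro ⟨rfl, rfl, rfl⟩; rfl

/-- Registers live in the cells from 4 to 31 and arrays from 32 on. The cells below 4 stay free as
scratch space. -/
theorem Reg.addr_ne_addr (r : Reg) (A : Arr) (i j : ℕ) : r.addr ≠ A.addr i j := by
  have := r.num_lt
  unfold Reg.addr Arr.addr
  omega

theorem Reg.four_le_addr (r : Reg) : 4 ≤ r.addr := Nat.le_add_right _ _

theorem Arr.four_le_addr (A : Arr) (i j : ℕ) : 4 ≤ A.addr i j := by
  unfold Arr.addr; omega

/-- A memory state of the structured language; `pt` is the point drawn last. -/
structure Mem where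
  reg : Reg → ℕ
  arr : Arr → ℕ → ℕ → ℕ
  x : ℝ
  y : ℝ
  pt : ℕ → ℝ
  estUsed : ℕ
  refUsed : ℕ

/-- The initial state. -/
def Mem.zero : Mem := ⟨fun _ => 0, fun _ _ _ => 0, 0, 0, fun _ => 0, 0, 0⟩

/-- Writing a register. -/
def Mem.set (v : Mem) (r : Reg) (a : ℕ) : Mem := { v with reg := Function.update v.reg r a }

/-- Writing an array entry. -/
def Mem.setArr (v : Mem) (A : Arr) (i j a : ℕ) : Mem :=
  { v with arr := fun A' i' j' => if A' = A ∧ i' = i ∧ j' = j then a else v.arr A' i' j' }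

/-- Writing the drawn point. -/
def Mem.setPt {d : ℕ} (v : Mem) (p : Cube d) : Mem :=
  { v with pt := fun l => if h : l < d then p.1 ⟨l, h⟩ else v.pt l }

/-- Basic operations. -/
inductive Op
  | const (a : Reg) (k : ℕ)
  | size (a : Reg)
  | copy (a b : Reg)
  | add (a b c : Reg)
  | sub (a b c : Reg)
  | mul (a b c : Reg)
  | load (a : Reg) (A : Arr) (i j : Reg)
  | store (A : Arr) (i j a : Reg)
  | xOfNat (a : Reg)
  | yOfNat (a : Reg)
  | xConst (r : ℝ)
  | yConst (r : ℝ)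
  | xMul
  | xDiv
  | xExp
  | xLog
  | xCoord (l : Reg)
  | drawEst
  | drawRef

/-- The effect of a basic operation. -/
def Op.den {d n : ℕ} (e : Env d n) : Op → Mem → Mem
  | .const a k, v => v.set a k
  | .size a, v => v.set a n
  | .copy a b, v => v.set a (v.reg b)
  | .add a b c, v => v.set a (v.reg b + v.reg c)
  | .sub a b c, v => v.set a (v.reg b - v.reg c)
  | .mul a b c, v => v.set a (v.reg b * v.reg c)
  | .load a A i j, v => v.set a (v.arr A (v.reg i) (v.reg j))
  | .store A i j a, v => v.setArr A (v.reg i) (v.reg j) (v.reg a)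
  | .xOfNat a, v => { v with x := v.reg a }
  | .yOfNat a, v => { v with y := v.reg a }
  | .xConst r, v => { v with x := r }
  | .yConst r, v => { v with y := r }
  | .xMul, v => { v with x := v.x * v.y }
  | .xDiv, v => { v with x := v.x / v.y }
  | .xExp, v => { v with x := Real.exp v.x }
  | .xLog, v => { v with x := Real.log v.x }
  | .xCoord l, v => { v with x := v.pt (v.reg l) }
  | .drawEst, v => { v.setPt (e.estDraw v.estUsed) with estUsed := v.estUsed + 1 }
  | .drawRef, v => { v.setPt (e.refDraw v.refUsed) with refUsed := v.refUsed + 1 }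

/-- Instructions that compute the address of an array entry in cell `0`. -/
def addrInstrs (A : Arr) (i j : Reg) : List Instr :=
  [.natAdd 0 i.addr j.addr, .natMul 0 0 0, .natAdd 0 0 i.addr, .natConst 1 8, .natMul 0 0 1,
    .natConst 1 (32 + A.num), .natAdd 0 0 1]

/-- The instructions for a basic operation. -/
def Op.instrs : Op → List Instr
  | .const a k => [.natConst a.addr k]
  | .size a => [.natSize a.addr]
  | .copy a b => [.natConst 0 0, .natAdd a.addr b.addr 0]
  | .add a b c => [.natAdd a.addr b.addr c.addr]
  | .sub a b c => [.natSub a.addr b.addr c.addr]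
  | .mul a b c => [.natMul a.addr b.addr c.addr]
  | .load a A i j => addrInstrs A i j ++ [.natLoad a.addr 0]
  | .store A i j a => addrInstrs A i j ++ [.natStore 0 a.addr]
  | .xOfNat a => [.realOfNat 0 a.addr]
  | .yOfNat a => [.realOfNat 1 a.addr]
  | .xConst r => [.realConst 0 r]
  | .yConst r => [.realConst 1 r]
  | .xMul => [.realMul 0 0 1]
  | .xDiv => [.realDiv 0 0 1]
  | .xExp => [.realExp 0 0]
  | .xLog => [.realLog 0 0]
  | .xCoord l => [.natConst 0 3, .natAdd 0 0 l.addr, .realLoad 0 0]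
  | .drawEst => [.drawEst 3]
  | .drawRef => [.drawRef 3]

/-- The registers that a basic operation writes. -/
def Op.writes : Op → List Reg
  | .const a _ | .size a | .copy a _ | .add a _ _ | .sub a _ _ | .mul a _ _ | .load a _ _ _ => [a]
  | _ => []

/-- The arrays that a basic operation writes. -/
def Op.arrWrites : Op → List Arr
  | .store A _ _ _ => [A]
  | _ => []

/-- Programs of the structured language. `ceil a` sets `a := ⌈x⌉₊`, and `forLt c b P` runs `P`
with `c = 0, 1, …, b - 1`. -/
inductive Code
  | op (o : Op)
  | ceil (a : Reg)
  | seq (P Q : Code)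
  | cond (a b : Reg) (P Q : Code)
  | forLt (c b : Reg) (P : Code)

/-- The state of a counted loop with body `f` and counter `c` after `k` iterations. -/
def iterFor (f : Mem → Mem) (c : Reg) : ℕ → Mem → Mem
  | 0, v => v.set c 0
  | k + 1, v => (f (iterFor f c k v)).set c (k + 1)

/-- The effect of a program. -/
def Code.den {d n : ℕ} (e : Env d n) : Code → Mem → Mem
  | .op o, v => o.den e v
  | .ceil a, v => v.set a ⌈v.x⌉₊
  | .seq P Q, v => Q.den e (P.den e v)
  | .cond a b P Q, v => if v.reg a < v.reg b then P.den e v else Q.den e v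
  | .forLt c b P, v => iterFor (P.den e) c (v.reg b) v

/-- The number of steps of a basic operation. -/
def Op.time (κ : ℕ) (o : Op) : ℕ := (o.instrs.map (Instr.cost κ)).sum

/-- The running time of a program. -/
def Code.time {d n : ℕ} (e : Env d n) (κ : ℕ) : Code → Mem → ℕ
  | .op o, _ => o.time κ
  | .ceil _, v => 3 + ⌈v.x⌉₊ * 4
  | .seq P Q, v => P.time e κ v + Q.time e κ (P.den e v)
  | .cond a b P Q, v => (if v.reg a < v.reg b then P.time e κ v else Q.time e κ v) + 1
  | .forLt c b P, v =>
      2 + ∑ k ∈ Finset.range (v.reg b), (P.time e κ (iterFor (P.den e) c k v) + 3)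

/-- The registers that a program writes. -/
def Code.writes : Code → List Reg
  | .op o => o.writes
  | .ceil a => [a]
  | .seq P Q => P.writes ++ Q.writes
  | .cond _ _ P Q => P.writes ++ Q.writes
  | .forLt c _ P => c :: P.writes

/-- The arrays that a program writes. -/
def Code.arrWrites : Code → List Arr
  | .op o => o.arrWrites
  | .ceil _ => []
  | .seq P Q => P.arrWrites ++ Q.arrWrites
  | .cond _ _ P Q => P.arrWrites ++ Q.arrWrites
  | .forLt _ _ P => P.arrWrites

/-- The counters and the bounds of loops are not written in the loops. -/
def Code.WF : Code → Prop
  | .op _ => True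
  | .ceil _ => True
  | .seq P Q => P.WF ∧ Q.WF
  | .cond _ _ P Q => P.WF ∧ Q.WF
  | .forLt c b P => c ≠ b ∧ c ∉ P.writes ∧ b ∉ P.writes ∧ P.WF

/-- A sequence of instructions as a program. -/
def Prog.ofList : List Instr → Prog
  | [] => .skip
  | i :: l => .seq (.instr i) (Prog.ofList l)

/-- The machine program of a structured program. -/
def Code.compile : Code → Prog
  | .op o => .ofList o.instrs
  | .ceil a => .seq (.ofList [.natConst a.addr 0, .realOfNat 2 a.addr])
      (.loop (.realLt 2 0)
        (.ofList [.natConst 0 1, .natAdd a.addr a.addr 0, .realOfNat 2 a.addr]))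
  | .seq P Q => .seq P.compile Q.compile
  | .cond a b P Q => .cond (.natLt a.addr b.addr) P.compile Q.compile
  | .forLt c b P => .seq (.instr (.natConst c.addr 0))
      (.loop (.natLt c.addr b.addr)
        (.seq P.compile (.ofList [.natConst 0 1, .natAdd c.addr c.addr 0])))

/-! ### Frames -/

section Frames

variable {d n : ℕ} (e : Env d n)

@[simp] theorem Mem.set_reg_self (v : Mem) (r : Reg) (a : ℕ) : (v.set r a).reg r = a := by
  simp [Mem.set]

theorem Mem.set_reg_of_ne (v : Mem) {r r' : Reg} (a : ℕ) (h : r' ≠ r) :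
    (v.set r a).reg r' = v.reg r' := by
  simp [Mem.set, h]

theorem Mem.set_reg (v : Mem) (r r' : Reg) (a : ℕ) :
    (v.set r a).reg r' = if r' = r then a else v.reg r' := by
  simp [Mem.set, Function.update_apply]

@[simp] theorem Mem.set_arr (v : Mem) (r : Reg) (a : ℕ) : (v.set r a).arr = v.arr := rfl
@[simp] theorem Mem.set_x (v : Mem) (r : Reg) (a : ℕ) : (v.set r a).x = v.x := rfl
@[simp] theorem Mem.set_y (v : Mem) (r : Reg) (a : ℕ) : (v.set r a).y = v.y := rfl
@[simp] theorem Mem.set_pt (v : Mem) (r : Reg) (a : ℕ) : (v.set r a).pt = v.pt := rfl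
@[simp] theorem Mem.set_estUsed (v : Mem) (r : Reg) (a : ℕ) :
    (v.set r a).estUsed = v.estUsed := rfl
@[simp] theorem Mem.set_refUsed (v : Mem) (r : Reg) (a : ℕ) :
    (v.set r a).refUsed = v.refUsed := rfl
@[simp] theorem Mem.setArr_reg (v : Mem) (A : Arr) (i j a : ℕ) :
    (v.setArr A i j a).reg = v.reg := rfl
theorem Mem.setArr_arr (v : Mem) (A A' : Arr) (i j a i' j' : ℕ) :
    (v.setArr A i j a).arr A' i' j' = if A' = A ∧ i' = i ∧ j' = j then a else v.arr A' i' j' :=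
  rfl

/-- The states `v` and `w` agree except for the registers in `R` and the arrays in `As`. -/
structure Frame (R : List Reg) (As : List Arr) (v w : Mem) : Prop where
  reg : ∀ r, r ∉ R → w.reg r = v.reg r
  arr : ∀ A, A ∉ As → w.arr A = v.arr A

theorem Frame.trans {R As} {u v w : Mem} (h : Frame R As u v) (h' : Frame R As v w) :
    Frame R As u w :=
  ⟨fun r hr => (h'.reg r hr).trans (h.reg r hr), fun A hA => (h'.arr A hA).trans (h.arr A hA)⟩

theorem Frame.mono {R R' As As'} {v w : Mem} (h : Frame R As v w) (hR : R ⊆ R')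
    (hA : As ⊆ As') : Frame R' As' v w :=
  ⟨fun r hr => h.reg r fun h => hr (hR h), fun A ha => h.arr A fun h => ha (hA h)⟩

theorem Op.frame (o : Op) (v : Mem) : Frame o.writes o.arrWrites v (o.den e v) := by
  constructor
  · intro r hr
    cases o <;> simp_all [Op.writes, Op.den, Mem.set_reg, Mem.setPt]
  · intro A hA
    cases o <;> simp_all [Op.arrWrites, Op.den, Mem.setPt]
    funext i j
    simp [Mem.setArr_arr, hA]

theorem frame_set {R As} (v : Mem) {c : Reg} (a : ℕ) (hc : c ∈ R) : Frame R As v (v.set c a) :=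
  ⟨fun _ hr => v.set_reg_of_ne a fun h => hr (h ▸ hc), fun _ _ => rfl⟩

theorem iterFor_frame {f : Mem → Mem} {c : Reg} {R As} (hc : c ∈ R)
    (hf : ∀ v, Frame R As v (f v)) (k : ℕ) (v : Mem) : Frame R As v (iterFor f c k v) := by
  induction k with
  | zero => exact frame_set v 0 hc
  | succ k ih => exact (ih.trans (hf _)).trans (frame_set _ _ hc)

theorem Code.frame (P : Code) (v : Mem) : Frame P.writes P.arrWrites v (P.den e v) := by
  induction P generalizing v with
  | op o => exact o.frame e v
  | ceil a => exact frame_set v _ (by simp [Code.writes])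
  | seq P Q ihP ihQ =>
    exact ((ihP v).mono (by simp [Code.writes]) (by simp [Code.arrWrites])).trans
      ((ihQ _).mono (by simp [Code.writes]) (by simp [Code.arrWrites]))
  | cond a b P Q ihP ihQ =>
    simp only [Code.den]
    split
    · exact (ihP v).mono (by simp [Code.writes]) (by simp [Code.arrWrites])
    · exact (ihQ v).mono (by simp [Code.writes]) (by simp [Code.arrWrites])
  | forLt c b P ih =>
    exact iterFor_frame (by simp [Code.writes])
      (fun v => (ih v).mono (by simp [Code.writes]) (by simp [Code.arrWrites])) _ _

@[simp] theorem iterFor_reg_self (f : Mem → Mem) (c : Reg) (k : ℕ) (v : Mem) :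
    (iterFor f c k v).reg c = k := by
  cases k <;> simp [iterFor]

/-- Proof rule for counted loops. -/
theorem Code.forLt_rule {κ : ℕ} {c b : Reg} {P : Code} {v : Mem} (I : ℕ → Mem → Prop) (τ : ℕ)
    (h0 : I 0 (v.set c 0))
    (hs : ∀ k < v.reg b, ∀ w, Frame (c :: P.writes) P.arrWrites v w → w.reg c = k → I k w →
      I (k + 1) ((P.den e w).set c (k + 1)) ∧ P.time e κ w ≤ τ) :
    I (v.reg b) ((Code.forLt c b P).den e v) ∧
      (Code.forLt c b P).time e κ v ≤ 2 + v.reg b * (τ + 3) := by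
  -- Frames are taken relative to the state before the loop, so what the body never writes has its
  -- initial value in every iteration.
  have hfr : ∀ k, Frame (c :: P.writes) P.arrWrites v (iterFor (P.den e) c k v) := fun k =>
    iterFor_frame (by simp) (fun v => (P.frame e v).mono (by simp) (by simp)) _ _
  have hI : ∀ k ≤ v.reg b, I k (iterFor (P.den e) c k v) := by
    intro k
    induction k with
    | zero => intro _; exact h0
    | succ k ih =>
      intro hk
      exact (hs k hk _ (hfr k) (by simp) (ih (by omega))).1
  refine ⟨hI _ le_rfl, ?_⟩
  simp only [Code.time]
  refine Nat.add_le_add_left ?_ _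
  calc _ ≤ ∑ k ∈ Finset.range (v.reg b), (τ + 3) := by
        refine Finset.sum_le_sum fun k hk => ?_
        rw [Finset.mem_range] at hk
        have := (hs k hk _ (hfr k) (by simp) (hI k hk.le)).2
        omega
    _ = _ := by simp

end Frames

/-! ### Correctness of the compiler -/

section Compile

variable {d n : ℕ} (e : Env d n) (κ : ℕ)

/-- The machine state `s` represents the state `v`. -/
structure Rep (v : Mem) (s : State) : Prop where
  reg : ∀ r, s.nat (Reg.addr r) = v.reg r
  arr : ∀ A i j, s.nat (Arr.addr A i j) = v.arr A i j
  x : s.real 0 = v.x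
  y : s.real 1 = v.y
  pt : ∀ l, s.real (3 + l) = v.pt l
  est : s.estUsed = v.estUsed
  ref : s.refUsed = v.refUsed

theorem Rep.zero : Rep Mem.zero State.zero := by
  constructor <;> simp [Mem.zero, State.zero]

theorem exec_ofList (l : List Instr) (s : State) :
    Exec e κ (.ofList l) s (l.foldl (fun s i => i.run e s) s) (l.map (Instr.cost κ)).sum := by
  induction l generalizing s with
  | nil => exact .skip s
  | cons i l ih => exact .seq (.instr i s) (ih _)

variable {e}

theorem Rep.scratch {v : Mem} {s : State} (h : Rep v s) {a : ℕ} (ha : a < 4) (k : ℕ) :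
    Rep v (s.setNat a k) := by
  refine ⟨fun r => ?_, fun A i j => ?_, h.x, h.y, h.pt, h.est, h.ref⟩
  · have := r.four_le_addr
    simp only [State.setNat]
    rw [Function.update_of_ne (by omega)]
    exact h.reg r
  · have := A.four_le_addr i j
    simp only [State.setNat]
    rw [Function.update_of_ne (by omega)]
    exact h.arr A i j

theorem Rep.scratchReal {v : Mem} {s : State} (h : Rep v s) (k : ℝ) :
    Rep v (s.setReal 2 k) := by
  refine ⟨h.reg, h.arr, ?_, ?_, fun l => ?_, h.est, h.ref⟩ <;> simp only [State.setReal]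
  · rw [Function.update_of_ne (by omega)]; exact h.x
  · rw [Function.update_of_ne (by omega)]; exact h.y
  · rw [Function.update_of_ne (by omega)]; exact h.pt l

theorem Rep.set {v : Mem} {s : State} (h : Rep v s) (r : Reg) (k : ℕ) :
    Rep (v.set r k) (s.setNat r.addr k) := by
  refine ⟨fun r' => ?_, fun A i j => ?_, h.x, h.y, h.pt, h.est, h.ref⟩
  · simp only [State.setNat, Mem.set, Function.update_apply, Reg.addr_inj, h.reg]
  · simp only [State.setNat]
    rw [Function.update_of_ne (r.addr_ne_addr A i j).symm]
    exact h.arr A i j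

theorem Rep.setArr {v : Mem} {s : State} (h : Rep v s) (A : Arr) (i j k : ℕ) :
    Rep (v.setArr A i j k) (s.setNat (A.addr i j) k) := by
  refine ⟨fun r => ?_, fun A' i' j' => ?_, h.x, h.y, h.pt, h.est, h.ref⟩
  · simp only [State.setNat]
    rw [Function.update_of_ne (r.addr_ne_addr A i j)]
    exact h.reg r
  · simp only [State.setNat, Mem.setArr_arr, Function.update_apply, Arr.addr_inj, h.arr]

theorem Rep.setX {v : Mem} {s : State} (h : Rep v s) (a : ℝ) :
    Rep { v with x := a } (s.setReal 0 a) := by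
  refine ⟨h.reg, h.arr, ?_, ?_, fun l => ?_, h.est, h.ref⟩ <;> simp only [State.setReal]
  · simp
  · rw [Function.update_of_ne (by omega)]; exact h.y
  · rw [Function.update_of_ne (by omega)]; exact h.pt l

theorem Rep.setY {v : Mem} {s : State} (h : Rep v s) (a : ℝ) :
    Rep { v with y := a } (s.setReal 1 a) := by
  refine ⟨h.reg, h.arr, ?_, ?_, fun l => ?_, h.est, h.ref⟩ <;> simp only [State.setReal]
  · rw [Function.update_of_ne (by omega)]; exact h.x
  · simp
  · rw [Function.update_of_ne (by omega)]; exact h.pt l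

theorem Rep.setPt {v : Mem} {s : State} (h : Rep v s) (p : Cube d) :
    Rep (v.setPt p) (s.setPoint 3 p) := by
  refine ⟨h.reg, h.arr, ?_, ?_, fun l => ?_, h.est, h.ref⟩ <;>
    simp only [State.setPoint, Mem.setPt]
  · simpa using h.x
  · simpa using h.y
  · simp [h.pt]

theorem Rep.addrInstrs {v : Mem} {s : State} (h : Rep v s) (A : Arr) (i j : Reg) :
    Rep v ((addrInstrs A i j).foldl (fun s i => i.run e s) s) ∧
      ((WassersteinTradeoff.addrInstrs A i j).foldl (fun s i => i.run e s) s).nat 0 =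
        A.addr (v.reg i) (v.reg j) := by
  constructor
  · simp only [WassersteinTradeoff.addrInstrs, List.foldl, Instr.run]
    refine Rep.scratch (Rep.scratch (Rep.scratch (Rep.scratch (Rep.scratch (Rep.scratch
      (Rep.scratch h ?_ _) ?_ _) ?_ _) ?_ _) ?_ _) ?_ _) ?_ _ <;> decide
  · have hi := i.four_le_addr
    have hi0 : i.addr ≠ 0 := by omega
    simp [WassersteinTradeoff.addrInstrs, Instr.run, State.setNat, h.reg, Arr.addr,
      Function.update_of_ne hi0]

theorem Rep.op {v : Mem} {s : State} (h : Rep v s) (o : Op) :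
    Rep (o.den e v) (o.instrs.foldl (fun s i => i.run e s) s) := by
  cases o with
  | const a k => exact h.set _ _
  | size a => exact h.set _ _
  | copy a b =>
    have h1 := (h.scratch (a := 0) (by decide) 0).set a (v.reg b)
    have hb := b.four_le_addr
    have hb0 : b.addr ≠ 0 := by omega
    simpa [Op.den, Op.instrs, Instr.run, State.setNat, h.reg, Function.update_of_ne hb0] using h1
  | add a b c => simpa [Op.den, Op.instrs, Instr.run, h.reg] using h.set a (v.reg b + v.reg c)
  | sub a b c => simpa [Op.den, Op.instrs, Instr.run, h.reg] using h.set a (v.reg b - v.reg c)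
  | mul a b c => simpa [Op.den, Op.instrs, Instr.run, h.reg] using h.set a (v.reg b * v.reg c)
  | load a A i j =>
    obtain ⟨h1, h2⟩ := Rep.addrInstrs (e := e) h A i j
    simp only [Op.instrs, List.foldl_append, List.foldl_cons, List.foldl_nil, Op.den]
    generalize (WassersteinTradeoff.addrInstrs A i j).foldl (fun s i => i.run e s) s = s1
      at h1 h2 ⊢
    simp only [Instr.run]
    rw [h2, h1.arr]
    exact h1.set _ _
  | store A i j a =>
    obtain ⟨h1, h2⟩ := Rep.addrInstrs (e := e) h A i j
    simp only [Op.instrs, List.foldl_append, List.foldl_cons, List.foldl_nil, Op.den]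
    generalize (WassersteinTradeoff.addrInstrs A i j).foldl (fun s i => i.run e s) s = s1
      at h1 h2 ⊢
    simp only [Instr.run]
    rw [h2, h1.reg]
    exact h1.setArr _ _ _ _
  | xOfNat a => simpa [Op.den, Op.instrs, Instr.run, h.reg] using h.setX (v.reg a)
  | yOfNat a => simpa [Op.den, Op.instrs, Instr.run, h.reg] using h.setY (v.reg a)
  | xConst r => exact h.setX r
  | yConst r => exact h.setY r
  | xMul => simpa [Op.den, Op.instrs, Instr.run, h.x, h.y] using h.setX (v.x * v.y)
  | xDiv => simpa [Op.den, Op.instrs, Instr.run, h.x, h.y] using h.setX (v.x / v.y)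
  | xExp => simpa [Op.den, Op.instrs, Instr.run, h.x] using h.setX (Real.exp v.x)
  | xLog => simpa [Op.den, Op.instrs, Instr.run, h.x] using h.setX (Real.log v.x)
  | xCoord l =>
    have h1 := (((h.scratch (a := 0) (by decide) 3).scratch (a := 0) (by decide)
      (3 + v.reg l))).setX (v.pt (v.reg l))
    have hb := l.four_le_addr
    have hb0 : l.addr ≠ 0 := by omega
    simpa [Op.den, Op.instrs, Instr.run, State.setNat, h.reg, h.pt,
      Function.update_of_ne hb0] using h1
  | drawEst =>
    have h1 := h.setPt (e.estDraw v.estUsed)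
    simp only [Op.instrs, List.foldl, Instr.run, Op.den, h.est]
    exact ⟨h1.reg, h1.arr, h1.x, h1.y, h1.pt, rfl, h1.ref⟩
  | drawRef =>
    have h1 := h.setPt (e.refDraw v.refUsed)
    simp only [Op.instrs, List.foldl, Instr.run, Op.den, h.ref]
    exact ⟨h1.reg, h1.arr, h1.x, h1.y, h1.pt, h1.est, rfl⟩

/-- The machine cannot round. It counts `a` upwards until a copy of `a` in real cell 2 is no longer
below `x`, at four steps per increment. The induction is on the number `r` of increments still to
come. -/
theorem exec_ceil_loop {v : Mem} (a : Reg) (r k : ℕ) {s : State} (h : Rep (v.set a k) s)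
    (h2 : s.real 2 = k) (hr : k + r = ⌈v.x⌉₊) :
    ∃ s', Exec e κ (.loop (.realLt 2 0)
        (.ofList [.natConst 0 1, .natAdd a.addr a.addr 0, .realOfNat 2 a.addr])) s s'
        (1 + r * 4) ∧ Rep (v.set a ⌈v.x⌉₊) s' := by
  induction r generalizing k s with
  | zero =>
    have hk : ¬ (Test.realLt 2 0).Holds s := by
      have := h.x
      simp only [Test.Holds, h2, this, Mem.set_x, not_lt]
      rw [Nat.add_zero] at hr
      exact Nat.ceil_le.mp hr.ge
    exact ⟨s, .loopFalse hk, by rwa [← hr]⟩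
  | succ r ih =>
    have hk : (Test.realLt 2 0).Holds s := by
      have := h.x
      simp only [Test.Holds, h2, this, Mem.set_x]
      exact Nat.lt_ceil.mp (by omega)
    have hexec := exec_ofList e κ
      [.natConst 0 1, .natAdd a.addr a.addr 0, .realOfNat 2 a.addr] s
    have ha := a.four_le_addr
    have ha0 : a.addr ≠ 0 := by omega
    set s1 := [Instr.natConst 0 1, .natAdd a.addr a.addr 0, .realOfNat 2 a.addr].foldl
      (fun s i => i.run e s) s with hs1
    have hs1' : s1 = (((s.setNat 0 1).setNat a.addr (k + 1)).setReal 2 ((k + 1 : ℕ) : ℝ)) := by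
      have := h.reg a
      simp only [Mem.set_reg_self] at this
      simp [hs1, Instr.run, State.setNat, State.setReal, Function.update_of_ne ha0, this]
    have hrep : Rep (v.set a (k + 1)) s1 := by
      rw [hs1']
      have h3 := ((h.scratch (a := 0) (by decide) 1).set a (k + 1)).scratchReal ((k + 1 : ℕ) : ℝ)
      have : (v.set a k).set a (k + 1) = v.set a (k + 1) := by simp [Mem.set]
      rwa [this] at h3
    obtain ⟨s', h4, h5⟩ := ih (k + 1) hrep (by rw [hs1']; simp [State.setReal]) (by omega)
    refine ⟨s', ?_, h5⟩
    have := Exec.loopTrue hk hexec h4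
    convert this using 1
    simp [Instr.cost]
    ring

/-- Since the body writes neither the counter nor the bound, the while loop of the machine makes
exactly the prescribed number of iterations. The induction is on the number `r` of iterations left.
-/
theorem exec_for_loop {c b : Reg} {P : Code} (hcb : c ≠ b) (hc : c ∉ P.writes)
    (hb : b ∉ P.writes)
    (ih : ∀ v s, Rep v s → ∃ s', Exec e κ P.compile s s' (P.time e κ v) ∧ Rep (P.den e v) s')
    (v : Mem) (r k : ℕ) {s : State} (h : Rep (iterFor (P.den e) c k v) s)
    (hr : k + r = v.reg b) :
    ∃ s', Exec e κ (.loop (.natLt c.addr b.addr)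
        (.seq P.compile (.ofList [.natConst 0 1, .natAdd c.addr c.addr 0]))) s s'
        (1 + ∑ i ∈ Finset.range r, (P.time e κ (iterFor (P.den e) c (k + i) v) + 3)) ∧
      Rep (iterFor (P.den e) c (v.reg b) v) s' := by
  have hbk : ∀ k, (iterFor (P.den e) c k v).reg b = v.reg b := fun k =>
    (iterFor_frame (R := c :: P.writes) (As := P.arrWrites) (by simp)
      (fun v => (P.frame e v).mono (by simp) (by simp)) k v).reg b (by simp [hb, hcb.symm])
  induction r generalizing k s with
  | zero =>
    have hk : ¬ (Test.natLt c.addr b.addr).Holds s := by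
      simp only [Test.Holds, h.reg, hbk, iterFor_reg_self]; omega
    exact ⟨s, .loopFalse hk, by rwa [← hr]⟩
  | succ r ihr =>
    have hk : (Test.natLt c.addr b.addr).Holds s := by
      simp only [Test.Holds, h.reg, hbk, iterFor_reg_self]; omega
    obtain ⟨s1, hexec, hrep⟩ := ih _ _ h
    have hexec2 := exec_ofList e κ [.natConst 0 1, .natAdd c.addr c.addr 0] s1
    set s2 := [Instr.natConst 0 1, .natAdd c.addr c.addr 0].foldl
      (fun s i => i.run e s) s1 with hs2
    have ha := c.four_le_addr
    have ha0 : c.addr ≠ 0 := by omega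
    have hs2' : s2 = (s1.setNat 0 1).setNat c.addr (k + 1) := by
      have := hrep.reg c
      rw [((P.frame e _).reg c hc), iterFor_reg_self] at this
      simp [hs2, Instr.run, State.setNat, Function.update_of_ne ha0, this]
    have hrep2 : Rep (iterFor (P.den e) c (k + 1) v) s2 := by
      rw [hs2']
      exact (hrep.scratch (a := 0) (by decide) 1).set c (k + 1)
    obtain ⟨s', h4, h5⟩ := ihr (k + 1) hrep2 (by omega)
    refine ⟨s', ?_, h5⟩
    have := Exec.loopTrue hk (Exec.seq hexec hexec2) h4
    convert this using 1
    rw [Finset.sum_range_succ']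
    simp [Instr.cost, add_assoc, add_comm 1]
    ring

/-- The compiled program simulates the structured one and takes exactly the predicted time. From
here on only the structured semantics matters. -/
theorem Code.exec_compile (P : Code) (hP : P.WF) (v : Mem) (s : State) (h : Rep v s) :
    ∃ s', Exec e κ P.compile s s' (P.time e κ v) ∧ Rep (P.den e v) s' := by
  induction P generalizing v s with
  | op o => exact ⟨_, exec_ofList e κ _ s, h.op o⟩
  | ceil a =>
    have h1 := exec_ofList e κ [.natConst a.addr 0, .realOfNat 2 a.addr] s
    have h2 : Rep (v.set a 0) ([Instr.natConst a.addr 0, .realOfNat 2 a.addr].foldl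
        (fun s i => i.run e s) s) :=
      Rep.scratchReal (h.set a 0) _
    obtain ⟨s', h3, h4⟩ := exec_ceil_loop (e := e) κ a ⌈v.x⌉₊ 0 h2
      (by simp [Instr.run, State.setNat, State.setReal]) (by simp)
    refine ⟨s', ?_, h4⟩
    have ht : (Code.ceil a).time e κ v = ([Instr.natConst a.addr 0, .realOfNat 2 a.addr].map
        (Instr.cost κ)).sum + (1 + ⌈v.x⌉₊ * 4) := by
      simp only [Code.time, List.map, List.sum_cons, List.sum_nil, Instr.cost]; ring
    rw [ht]
    exact Exec.seq h1 h3
  | seq P Q ihP ihQ =>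
    obtain ⟨s1, h1, h2⟩ := ihP hP.1 v s h
    obtain ⟨s2, h3, h4⟩ := ihQ hP.2 _ s1 h2
    exact ⟨s2, .seq h1 h3, h4⟩
  | cond a b P Q ihP ihQ =>
    by_cases hab : v.reg a < v.reg b
    · obtain ⟨s1, h1, h2⟩ := ihP hP.1 v s h
      refine ⟨s1, ?_, by simpa [Code.den, hab] using h2⟩
      have : (Test.natLt a.addr b.addr).Holds s := by simpa [Test.Holds, h.reg] using hab
      simpa [Code.time, hab, Code.compile] using Exec.condTrue (Q := Q.compile) this h1
    · obtain ⟨s1, h1, h2⟩ := ihQ hP.2 v s h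
      refine ⟨s1, ?_, by simpa [Code.den, hab] using h2⟩
      have : ¬ (Test.natLt a.addr b.addr).Holds s := by simpa [Test.Holds, h.reg] using hab
      simpa [Code.time, hab, Code.compile] using Exec.condFalse (P := P.compile) this h1
  | forLt c b P ih =>
    obtain ⟨hcb, hc, hb, hP⟩ := hP
    have h1 := Exec.instr (e := e) (κ := κ) (.natConst c.addr 0) s
    have h2 : Rep (iterFor (P.den e) c 0 v) ((Instr.natConst c.addr 0).run e s) := h.set c 0
    obtain ⟨s', h3, h4⟩ := exec_for_loop κ hcb hc hb (ih hP) v (v.reg b) 0 h2 (by simp)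
    refine ⟨s', ?_, h4⟩
    have ht : (Code.forLt c b P).time e κ v = (Instr.natConst c.addr 0).cost κ +
        (1 + ∑ i ∈ Finset.range (v.reg b), (P.time e κ (iterFor (P.den e) c (0 + i) v) + 3)) := by
      simp only [Code.time, Instr.cost, Nat.zero_add]; ring
    rw [ht]
    exact Exec.seq h1 h3

end Compile

/-! ### Measurability -/

section Measurability

variable {d n : ℕ} {Ω : Type*} [MeasurableSpace Ω]

/-- The components of a random state are random variables. -/
structure MeasurableMem (f : Ω → Mem) : Prop where
  reg : ∀ r, Measurable fun ω => (f ω).reg r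
  arr : ∀ A i j, Measurable fun ω => (f ω).arr A i j
  x : Measurable fun ω => (f ω).x
  y : Measurable fun ω => (f ω).y
  pt : ∀ l, Measurable fun ω => (f ω).pt l
  est : Measurable fun ω => (f ω).estUsed
  ref : Measurable fun ω => (f ω).refUsed

/-- Indirect addressing is harmless for measurability: a random index takes only countably many
values. -/
theorem measurable_apply_nat {β : Type*} [MeasurableSpace β] {g : ℕ → Ω → β}
    (hg : ∀ k, Measurable (g k)) {k : Ω → ℕ} (hk : Measurable k) :
    Measurable fun ω => g (k ω) ω :=
  (measurable_from_prod_countable_right (f := fun q : ℕ × Ω => g q.1 q.2) hg).comp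
    (hk.prodMk measurable_id)

theorem MeasurableMem.set {f : Ω → Mem} (hf : MeasurableMem f) (r : Reg) {a : Ω → ℕ}
    (ha : Measurable a) : MeasurableMem fun ω => (f ω).set r (a ω) := by
  refine ⟨fun r' => ?_, hf.arr, hf.x, hf.y, hf.pt, hf.est, hf.ref⟩
  simp only [Mem.set_reg]
  split
  · exact ha
  · exact hf.reg r'

theorem MeasurableMem.setArr {f : Ω → Mem} (hf : MeasurableMem f) (A : Arr) {i j a : Ω → ℕ}
    (hi : Measurable i) (hj : Measurable j) (ha : Measurable a) :
    MeasurableMem fun ω => (f ω).setArr A (i ω) (j ω) (a ω) := by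
  refine ⟨hf.reg, fun A' i' j' => ?_, hf.x, hf.y, hf.pt, hf.est, hf.ref⟩
  simp only [Mem.setArr_arr]
  refine Measurable.ite ?_ ha (hf.arr _ _ _)
  refine (MeasurableSet.const _).inter (MeasurableSet.inter ?_ ?_)
  · exact measurableSet_eq_fun measurable_const hi
  · exact measurableSet_eq_fun measurable_const hj

theorem MeasurableMem.setPt {f : Ω → Mem} (hf : MeasurableMem f) {p : Ω → Cube d}
    (hp : Measurable p) : MeasurableMem fun ω => (f ω).setPt (p ω) := by
  refine ⟨hf.reg, hf.arr, hf.x, hf.y, fun l => ?_, hf.est, hf.ref⟩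
  simp only [Mem.setPt]
  by_cases h : l < d
  · simp only [h, dite_true]
    fun_prop
  · simpa only [h, dite_false] using hf.pt l

theorem MeasurableMem.op {f : Ω → Mem} (hf : MeasurableMem f) {e : Ω → Env d n}
    (hest : ∀ k, Measurable fun ω => (e ω).estDraw k)
    (href : ∀ k, Measurable fun ω => (e ω).refDraw k) (o : Op) :
    MeasurableMem fun ω => o.den (e ω) (f ω) := by
  cases o with
  | const a k => exact hf.set _ measurable_const
  | size a => exact hf.set _ measurable_const
  | copy a b => exact hf.set _ (hf.reg b)
  | add a b c => exact hf.set _ ((hf.reg b).add (hf.reg c))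
  | sub a b c => exact hf.set _ ((hf.reg b).sub (hf.reg c))
  | mul a b c => exact hf.set _ ((hf.reg b).mul (hf.reg c))
  | load a A i j =>
    exact hf.set _ (measurable_apply_nat (g := fun i' ω => (f ω).arr A i' ((f ω).reg j))
      (fun i' => measurable_apply_nat (g := fun j' ω => (f ω).arr A i' j')
        (fun j' => hf.arr A i' j') (hf.reg j)) (hf.reg i))
  | store A i j a => exact hf.setArr A (hf.reg i) (hf.reg j) (hf.reg a)
  | xOfNat a =>
    exact ⟨hf.reg, hf.arr, (measurable_from_top (f := fun k : ℕ => (k : ℝ))).comp (hf.reg a), hf.y,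
      hf.pt, hf.est, hf.ref⟩
  | yOfNat a =>
    exact ⟨hf.reg, hf.arr, hf.x, (measurable_from_top (f := fun k : ℕ => (k : ℝ))).comp (hf.reg a),
      hf.pt, hf.est, hf.ref⟩
  | xConst r => exact ⟨hf.reg, hf.arr, measurable_const, hf.y, hf.pt, hf.est, hf.ref⟩
  | yConst r => exact ⟨hf.reg, hf.arr, hf.x, measurable_const, hf.pt, hf.est, hf.ref⟩
  | xMul => exact ⟨hf.reg, hf.arr, hf.x.mul hf.y, hf.y, hf.pt, hf.est, hf.ref⟩
  | xDiv => exact ⟨hf.reg, hf.arr, hf.x.div hf.y, hf.y, hf.pt, hf.est, hf.ref⟩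
  | xExp => exact ⟨hf.reg, hf.arr, hf.x.exp, hf.y, hf.pt, hf.est, hf.ref⟩
  | xLog => exact ⟨hf.reg, hf.arr, hf.x.log, hf.y, hf.pt, hf.est, hf.ref⟩
  | xCoord l =>
    exact ⟨hf.reg, hf.arr, measurable_apply_nat (g := fun l ω => (f ω).pt l) hf.pt (hf.reg l),
      hf.y, hf.pt, hf.est, hf.ref⟩
  | drawEst =>
    have h := hf.setPt (measurable_apply_nat (g := fun k ω => (e ω).estDraw k) hest hf.est)
    exact ⟨h.reg, h.arr, h.x, h.y, h.pt, hf.est.add measurable_const, h.ref⟩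
  | drawRef =>
    have h := hf.setPt (measurable_apply_nat (g := fun k ω => (e ω).refDraw k) href hf.ref)
    exact ⟨h.reg, h.arr, h.x, h.y, h.pt, h.est, hf.ref.add measurable_const⟩

/-- This covers random branches (`β` is `Bool`) and random numbers of iterations (`β` is `ℕ`). -/
theorem MeasurableMem.cases {β : Type*} [MeasurableSpace β] [Countable β]
    [MeasurableSingletonClass β] {k : Ω → β} (hk : Measurable k) {f : β → Ω → Mem}
    (hf : ∀ b, MeasurableMem (f b)) : MeasurableMem fun ω => f (k ω) ω := by
  have key : ∀ {γ : Type} [MeasurableSpace γ] {g : β → Ω → γ}, (∀ b, Measurable (g b)) →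
      Measurable fun ω => g (k ω) ω := fun {γ} _ {g} hg =>
    (measurable_from_prod_countable_right (f := fun q : β × Ω => g q.1 q.2) hg).comp
      (hk.prodMk measurable_id)
  exact ⟨fun r => key (g := fun b ω => (f b ω).reg r) fun b => (hf b).reg r,
    fun A i j => key (g := fun b ω => (f b ω).arr A i j) fun b => (hf b).arr A i j,
    key (g := fun b ω => (f b ω).x) fun b => (hf b).x,
    key (g := fun b ω => (f b ω).y) fun b => (hf b).y,
    fun l => key (g := fun b ω => (f b ω).pt l) fun b => (hf b).pt l,
    key (g := fun b ω => (f b ω).estUsed) fun b => (hf b).est,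
    key (g := fun b ω => (f b ω).refUsed) fun b => (hf b).ref⟩

theorem Code.measurable_den {e : Ω → Env d n}
    (hest : ∀ k, Measurable fun ω => (e ω).estDraw k)
    (href : ∀ k, Measurable fun ω => (e ω).refDraw k) (P : Code) {f : Ω → Mem}
    (hf : MeasurableMem f) : MeasurableMem fun ω => P.den (e ω) (f ω) := by
  induction P generalizing f with
  | op o => exact hf.op hest href o
  | ceil a => exact hf.set a (Nat.measurable_ceil.comp hf.x)
  | seq P Q ihP ihQ => exact ihQ (ihP hf)
  | cond a b P Q ihP ihQ =>
    have hab : Measurable fun ω => decide ((f ω).reg a < (f ω).reg b) :=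
      measurable_to_bool (by simpa [Set.preimage] using measurableSet_lt (hf.reg a) (hf.reg b))
    have := MeasurableMem.cases hab
      (f := fun c ω => if c then P.den (e ω) (f ω) else Q.den (e ω) (f ω))
      (by rintro (_ | _) <;> simp [ihP hf, ihQ hf])
    simpa [Code.den] using this
  | forLt c b P ih =>
    refine MeasurableMem.cases (hf.reg b)
      (f := fun k ω => iterFor (P.den (e ω)) c k (f ω)) fun k => ?_
    induction k with
    | zero => exact hf.set c measurable_const
    | succ k ihk => exact (ih ihk).set c measurable_const

end Measurability

/-! ### The auction algorithm

Suppliers `i < M` with `a i` units bid for the units of the consumers `j < M`, of which there are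
`b j`. A unit of `j` is stale if it was bought before the last increase of the price `Q j`, and
fresh otherwise. The row with index `M` holds the units that were never bought. -/

/-- The invariants of the auction: `S` is the number of units left to the suppliers, `G` and `H`
count the stale and the fresh units. -/
structure AuctionInv (M B : ℕ) (C : ℕ → ℕ → ℕ) (a b S Q : ℕ → ℕ) (G H : ℕ → ℕ → ℕ) : Prop where
  supply : ∀ i < M, ∑ j ∈ Finset.range M, (G i j + H i j) + S i = a i
  demand : ∀ j < M, ∑ i ∈ Finset.range (M + 1), (G i j + H i j) = b j
  fresh : ∀ i < M, ∀ j < M, 0 < H i j → ∀ k < M, C i j + Q j ≤ C i k + Q k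
  stale : ∀ i < M, ∀ j < M, 0 < G i j → ∀ k < M, C i j + Q j ≤ C i k + Q k + 1
  unsold_fresh : ∀ j < M, H M j = 0
  unsold_price : ∀ j < M, 0 < G M j → Q j = 0
  price_le : ∀ j < M, Q j ≤ B + 1

/-- The number of steps made so far. -/
def auctionPot (M : ℕ) (b Q : ℕ → ℕ) (H : ℕ → ℕ → ℕ) : ℕ :=
  ∑ j ∈ Finset.range M, (Q j * (b j + 1) + ∑ i ∈ Finset.range M, H i j)

section Auction

variable {M B : ℕ} {C : ℕ → ℕ → ℕ} {a b S Q S' Q' : ℕ → ℕ} {G H G' H' : ℕ → ℕ → ℕ}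

theorem AuctionInv.init (hb : ∀ j < M, G M j = b j) (hG : ∀ i < M, ∀ j < M, G i j = 0)
    (hH : ∀ i j, H i j = 0) (hQ : ∀ j, Q j = 0) (hS : ∀ i < M, S i = a i) :
    AuctionInv M B C a b S Q G H := by
  refine ⟨fun i hi => ?_, fun j hj => ?_, fun i _ j _ h => ?_, fun i hi j hj h => ?_, fun j _ => ?_,
    fun j _ _ => hQ j, fun j _ => ?_⟩
  · rw [Finset.sum_eq_zero, hS i hi, zero_add]
    intro j hj
    rw [hG i hi j (Finset.mem_range.mp hj), hH, add_zero]
  · rw [Finset.sum_range_succ, Finset.sum_eq_zero, hb j hj, hH, zero_add, add_zero]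
    intro i hi
    rw [hG i (Finset.mem_range.mp hi) j hj, hH, add_zero]
  · simp [hH] at h
  · simp [hG i hi j hj] at h
  · exact hH _ _
  · simp [hQ]

theorem sum_indicator_col (M i own best : ℕ) (hbest : best < M) :
    ∑ j ∈ Finset.range M, (if i = own ∧ j = best then 1 else 0) = if i = own then 1 else 0 := by
  by_cases h : i = own <;> simp [h, hbest]

theorem sum_indicator_row (M j own best : ℕ) (hown : own < M) :
    ∑ i ∈ Finset.range M, (if i = own ∧ j = best then 1 else 0) = if j = best then 1 else 0 := by
  by_cases h : j = best <;> simp [h, hown]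

/-- The supplier `src` takes a stale unit of the consumer `best`. -/
theorem AuctionInv.move (h : AuctionInv M B C a b S Q G H) {src best own : ℕ} (hsrc : src < M)
    (hbest : best < M) (hown : own < M + 1)
    (hmin : ∀ k < M, C src best + Q best ≤ C src k + Q k) (hG : 0 < G own best)
    (hG' : ∀ i < M + 1, ∀ j < M,
      G' i j + (if i = own ∧ j = best then 1 else 0) = G i j)
    (hH' : ∀ i < M + 1, ∀ j < M,
      H' i j = H i j + (if i = src ∧ j = best then 1 else 0))
    (hS' : ∀ i < M, S' i + (if i = src then 1 else 0) = S i + (if i = own then 1 else 0)) :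
    AuctionInv M B C a b S' Q G' H' ∧ auctionPot M b Q H' = auctionPot M b Q H + 1 := by
  refine ⟨⟨fun i hi => ?_, fun j hj => ?_, fun i hi j hj hp k hk => ?_,
    fun i hi j hj hp k hk => ?_, fun j hj => ?_, fun j hj hp => ?_, h.price_le⟩, ?_⟩
  · have h1 : ∑ j ∈ Finset.range M, G' i j + (if i = own then 1 else 0) =
        ∑ j ∈ Finset.range M, G i j := by
      rw [← sum_indicator_col M i own best hbest, ← Finset.sum_add_distrib]
      exact Finset.sum_congr rfl fun j hj => hG' i (by omega) j (Finset.mem_range.mp hj)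
    have h2 : ∑ j ∈ Finset.range M, H' i j =
        ∑ j ∈ Finset.range M, H i j + (if i = src then 1 else 0) := by
      rw [← sum_indicator_col M i src best hbest, ← Finset.sum_add_distrib]
      exact Finset.sum_congr rfl fun j hj => hH' i (by omega) j (Finset.mem_range.mp hj)
    have h3 := h.supply i hi
    have h4 := hS' i hi
    rw [Finset.sum_add_distrib] at h3 ⊢
    omega
  · have h1 : ∑ i ∈ Finset.range (M + 1), G' i j + (if j = best then 1 else 0) =
        ∑ i ∈ Finset.range (M + 1), G i j := by
      rw [← sum_indicator_row (M + 1) j own best hown, ← Finset.sum_add_distrib]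
      exact Finset.sum_congr rfl fun i hi => hG' i (Finset.mem_range.mp hi) j hj
    have h2 : ∑ i ∈ Finset.range (M + 1), H' i j =
        ∑ i ∈ Finset.range (M + 1), H i j + (if j = best then 1 else 0) := by
      rw [← sum_indicator_row (M + 1) j src best (by omega), ← Finset.sum_add_distrib]
      exact Finset.sum_congr rfl fun i hi => hH' i (Finset.mem_range.mp hi) j hj
    have h3 := h.demand j hj
    rw [Finset.sum_add_distrib] at h3 ⊢
    omega
  -- The unit just bought is fresh because `best` minimizes cost plus price for `src`; all other
  -- fresh units were fresh before.
  · by_cases hij : i = src ∧ j = best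
    · obtain ⟨rfl, rfl⟩ := hij
      exact hmin k hk
    · have := hH' i (by omega) j hj
      simp only [hij, if_false, add_zero] at this
      exact h.fresh i hi j hj (this ▸ hp) k hk
  · have := hG' i (by omega) j hj
    exact h.stale i hi j hj (by omega) k hk
  · have h1 := hH' M (by omega) j hj
    have h2 := h.unsold_fresh j hj
    have h3 : ¬ (M = src ∧ j = best) := by omega
    simpa [h2, h3] using h1
  · have := hG' M (by omega) j hj
    exact h.unsold_price j hj (by omega)
  · have h1 : ∀ j ∈ Finset.range M, Q j * (b j + 1) + ∑ i ∈ Finset.range M, H' i j =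
        (Q j * (b j + 1) + ∑ i ∈ Finset.range M, H i j) + if j = best then 1 else 0 := by
      intro j hj
      rw [add_assoc, ← sum_indicator_row M j src best hsrc, ← Finset.sum_add_distrib]
      congr 1
      exact Finset.sum_congr rfl fun i hi =>
        hH' i (by rw [Finset.mem_range] at hi; omega) j (Finset.mem_range.mp hj)
    rw [auctionPot, Finset.sum_congr rfl h1, Finset.sum_add_distrib, auctionPot]
    simp [hbest]

/-- Some units are never bought. -/
theorem AuctionInv.exists_unsold (h : AuctionInv M B C a b S Q G H)
    (hab : ∑ i ∈ Finset.range M, a i < ∑ j ∈ Finset.range M, b j) : ∃ k < M, 0 < G M k := by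
  by_contra! hcon
  have h1 : ∑ j ∈ Finset.range M, b j =
      ∑ i ∈ Finset.range M, ∑ j ∈ Finset.range M, (G i j + H i j) := by
    rw [Finset.sum_comm]
    refine Finset.sum_congr rfl fun j hj => ?_
    have hj := Finset.mem_range.mp hj
    rw [← h.demand j hj, Finset.sum_range_succ, h.unsold_fresh j hj, Nat.le_zero.mp (hcon j hj)]
    simp
  have h2 : ∑ i ∈ Finset.range M, ∑ j ∈ Finset.range M, (G i j + H i j) ≤
      ∑ i ∈ Finset.range M, a i := Finset.sum_le_sum fun i hi => by
    have := h.supply i (Finset.mem_range.mp hi); omega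
  omega

/-- The consumer `best` raises its price. -/
theorem AuctionInv.raise (h : AuctionInv M B C a b S Q G H) (hC : ∀ i < M, ∀ j < M, C i j ≤ B)
    (hab : ∑ i ∈ Finset.range M, a i < ∑ j ∈ Finset.range M, b j)
    {src best : ℕ} (hsrc : src < M) (hbest : best < M)
    (hmin : ∀ k < M, C src best + Q best ≤ C src k + Q k)
    (hG : ∀ i < M + 1, G i best = 0)
    (hG' : ∀ i < M + 1, ∀ j < M, G' i j = if j = best then H i j else G i j)
    (hH' : ∀ i < M + 1, ∀ j < M, H' i j = if j = best then 0 else H i j)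
    (hQ' : ∀ j < M, Q' j = Q j + (if j = best then 1 else 0)) :
    AuctionInv M B C a b S Q' G' H' ∧ auctionPot M b Q' H' = auctionPot M b Q H + 1 := by
  have hsum : ∀ i < M + 1, ∀ j < M, G' i j + H' i j = G i j + H i j := by
    intro i hi j hj
    rw [hG' i hi j hj, hH' i hi j hj]
    split
    · rename_i hj; rw [hj, hG i hi]; simp
    · rfl
  refine ⟨⟨fun i hi => ?_, fun j hj => ?_, fun i hi j hj hp k hk => ?_,
    fun i hi j hj hp k hk => ?_, fun j hj => ?_, fun j hj hp => ?_, fun j hj => ?_⟩, ?_⟩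
  · rw [← h.supply i hi]
    congr 1
    exact Finset.sum_congr rfl fun j hj => hsum i (by omega) j (Finset.mem_range.mp hj)
  · rw [← h.demand j hj]
    exact Finset.sum_congr rfl fun i hi => hsum i (Finset.mem_range.mp hi) j hj
  -- No fresh unit of `best` remains. For the other consumers the own price is unchanged and the
  -- competing prices do not fall.
  · have h1 := hH' i (by omega) j hj
    by_cases hjb : j = best
    · simp [hjb] at h1; subst hjb; omega
    · simp only [hjb, if_false] at h1
      have h2 := h.fresh i hi j hj (h1 ▸ hp) k hk
      have h3 := hQ' j hj
      simp only [hjb, if_false] at h3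
      have h4 := hQ' k hk
      omega
  -- The units of `best` that become stale were exactly optimal before its price rose by 1, which
  -- gives the slack 1. Stale units of other consumers lose nothing when a competitor becomes
  -- dearer.
  · have h1 := hG' i (by omega) j hj
    have h3 := hQ' j hj
    have h4 := hQ' k hk
    by_cases hjb : j = best
    · simp only [hjb, if_true] at h1 h3
      have h2 := h.fresh i hi best hbest (by rw [← h1]; subst hjb; exact hp) k hk
      subst hjb
      split at h4 <;> omega
    · simp only [hjb, if_false] at h1 h3
      have h2 := h.stale i hi j hj (h1 ▸ hp) k hk
      omega
  · rw [hH' M (by omega) j hj, h.unsold_fresh j hj, ite_self]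
  -- A price rises only when `best` has no stale unit in any row, so none of its units is unsold.
  · have h1 := hG' M (by omega) j hj
    have h3 := hQ' j hj
    by_cases hjb : j = best
    · simp only [hjb, if_true, h.unsold_fresh best hbest] at h1
      subst hjb; omega
    · simp only [hjb, if_false] at h1 h3
      rw [h3]
      exact h.unsold_price j hj (h1 ▸ hp)
  · rw [hQ' j hj]
    split
    · rename_i hjb
      -- The consumer `k` with an unsold unit has price 0, so by minimality the old price of `best`
      -- is at most `C src k ≤ B`.
      obtain ⟨k, hk, hGk⟩ := h.exists_unsold hab
      have h1 := h.unsold_price k hk hGk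
      have h2 := hmin k hk
      have h3 := hC src hsrc k hk
      rw [hjb]; omega
    · exact h.price_le j hj
  -- All `b best` units of `best` are fresh before the rise and none afterwards, while the price
  -- term gains `b best + 1`. The net gain of the potential is 1.
  · have hbb : ∑ i ∈ Finset.range M, H i best = b best := by
      rw [← h.demand best hbest, Finset.sum_range_succ, h.unsold_fresh best hbest,
        hG M (by omega)]
      simp only [add_zero]
      exact Finset.sum_congr rfl fun i hi => by
        rw [hG i (by rw [Finset.mem_range] at hi; omega), zero_add]
    have h1 : ∀ j ∈ Finset.range M, Q' j * (b j + 1) + ∑ i ∈ Finset.range M, H' i j =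
        (Q j * (b j + 1) + ∑ i ∈ Finset.range M, H i j) + if j = best then 1 else 0 := by
      intro j hj
      have hj := Finset.mem_range.mp hj
      rw [hQ' j hj]
      by_cases hjb : j = best
      · have : ∑ i ∈ Finset.range M, H' i j = 0 := Finset.sum_eq_zero fun i hi => by
          rw [hH' i (by rw [Finset.mem_range] at hi; omega) j hj, if_pos hjb]
        subst hjb
        rw [this, hbb]
        simp
        ring
      · have : ∑ i ∈ Finset.range M, H' i j = ∑ i ∈ Finset.range M, H i j :=
          Finset.sum_congr rfl fun i hi => by
            rw [hH' i (by rw [Finset.mem_range] at hi; omega) j hj, if_neg hjb]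
        rw [this]
        simp [hjb]
    rw [auctionPot, Finset.sum_congr rfl h1, Finset.sum_add_distrib, auctionPot]
    simp [hbest]

/-- Each summand is at most `(B + 1) (b j + 1) + b j`, which is below `(B + 2) (b j + 1)`. -/
theorem AuctionInv.pot_lt (h : AuctionInv M B C a b S Q G H) (hM : 0 < M) :
    auctionPot M b Q H < (B + 2) * ∑ j ∈ Finset.range M, (b j + 1) := by
  rw [auctionPot, Finset.mul_sum]
  refine Finset.sum_lt_sum_of_nonempty (by simpa using hM.ne') fun j hj => ?_
  have hj := Finset.mem_range.mp hj
  have h1 := h.price_le j hj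
  have h2 : ∑ i ∈ Finset.range M, H i j ≤ b j := by
    rw [← h.demand j hj, Finset.sum_range_succ]
    refine le_trans (Finset.sum_le_sum fun i _ => ?_) (Nat.le_add_right _ _)
    omega
  nlinarith

end Auction

/-! ### The program -/

/-- Running a list of programs one after the other. -/
def Code.block : List Code → Code
  | [] => .op (.copy .zero .zero)
  | [P] => P
  | P :: l => .seq P (Code.block l)

/-- `a := ⌈n ^ r⌉₊` -/
def powCeilCode (a : Reg) (r : ℝ) : Code := .block
  [.op (.size .t), .op (.xOfNat .t), .op .xLog, .op (.yConst r), .op .xMul, .op .xExp, .ceil a]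

/-- `a := b / c` -/
def divCode (a b c : Reg) : Code := .block
  [.op (.add a b .one), .op (.xOfNat a), .op (.yOfNat c), .op .xDiv, .ceil a, .op (.sub a a .one)]

/-- Computes the parameters. -/
def setupCode (d : ℕ) (p γ : ℝ) (D : ℕ) : Code := .block
  [powCeilCode .m (γ / d), powCeilCode .L (γ * p / d), .op (.const .dim d), .op (.const .one 1),
    .op (.const .M 1), .forLt .l .dim (.op (.mul .M .M .m)), .op (.mul .U .M .L),
    .op (.mul .N .U .L), .op (.add .M' .M .one), .op (.const .steps D),
    -- The number of rounds is `(D L + 2) (2 M + M L)`, which is at least the bound for the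
    -- potential when costs are at most `D L`.
    .op (.mul .steps .steps .L), .op (.const .t 2), .op (.add .steps .steps .t),
    .op (.add .t .M .M), .op (.add .t .t .U), .op (.mul .steps .steps .t)]

/-- Computes the number of the cell of the point drawn last. -/
def locateCode : Code := .block
  [.op (.const .idx 0), .op (.const .pw 1),
    -- The digit `⌈x m⌉ - 1` makes the sides of cells half-open on the left. Truncated subtraction
    -- puts `x = 0` into the first cell.
    .forLt .l .dim (.block [.op (.xCoord .l), .op (.yOfNat .m), .op .xMul, .ceil .c,
      .op (.sub .c .c .one), .op (.mul .c .c .pw), .op (.add .idx .idx .c),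
      .op (.mul .pw .pw .m)])]

/-- Increases the count of a cell. -/
def countCode (A : Arr) : Code := .block
  [.op (.load .t A .idx .zero), .op (.add .t .t .one), .op (.store A .idx .zero .t)]

/-- Draws the samples and counts the points in each cell. -/
def collectCode : Code :=
  .forLt .k .N (.block [.op .drawRef, locateCode, countCode .A, .op .drawEst, locateCode,
    countCode .B])

/-- Rounds the counts. -/
def unitsCode : Code :=
  .forLt .i .M (.block [.op (.load .t .A .i .zero), divCode .s .t .L, .op (.store .S .i .zero .s),
    -- Supplies are rounded down and demands get one unit more than the quotient. This makes total
    -- demand strictly larger than total supply.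
    .op (.load .t .B .i .zero), divCode .s .t .L, .op (.add .s .s .one),
    .op (.store .G .M .i .s)])

/-- Computes the coordinates of the cells. -/
def digitsCode : Code :=
  .forLt .i .M (.block [.op (.copy .t .i),
    .forLt .l .dim (.block [divCode .c .t .m, .op (.mul .s .c .m), .op (.sub .s .t .s),
      .op (.store .digit .i .l .s), .op (.copy .t .c)])])

/-- Computes the rounded cost of moving from the cell `i` to the cell `j`. -/
def costEntryCode (p : ℝ) : Code := .block
  [.op (.const .c 0),
    .forLt .l .dim (.block [.op (.load .s .digit .i .l), .op (.load .t .digit .j .l),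
      -- One of the two truncated differences is 0, so their sum is the absolute difference.
      .op (.sub .idx .s .t), .op (.sub .s .t .s), .op (.add .s .s .idx), .op (.mul .s .s .s),
      .op (.add .c .c .s)]),
    -- Powers are computed as `exp (r log x)`, which would give 1 instead of 0 at `x = 0`, so that
    -- case is treated separately.
    .cond .zero .c
      (.block [.op (.xOfNat .c), .op (.mul .t .m .m), .op (.yOfNat .t), .op .xDiv, .op .xLog,
        .op (.yConst (p / 2)), .op .xMul, .op .xExp, .op (.yOfNat .L), .op .xMul, .ceil .c])
      (.op (.const .c 0)),
    .op (.store .cost .i .j .c)]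

/-- Computes the rounded costs. -/
def costsCode (p : ℝ) : Code := .forLt .i .M (.forLt .j .M (costEntryCode p))

/-- Finds a supplier with units left. -/
def findSupplierCode : Code := .block
  -- The value `M` is not the index of a supplier and means that none has been found.
  [.op (.copy .src .M),
    .forLt .i .M (.block [.op (.load .t .S .i .zero),
      .cond .zero .t (.op (.copy .src .i)) (.op (.const .c 0))])]

/-- Finds the cheapest consumer for the supplier `src`. -/
def findBestCode : Code := .block
  [.op (.const .best 0), .op (.load .t .cost .src .zero), .op (.load .c .Q .zero .zero),
    .op (.add .bestVal .t .c),
    .forLt .j .M (.block [.op (.load .t .cost .src .j), .op (.load .c .Q .j .zero),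
      .op (.add .t .t .c),
      .cond .t .bestVal (.block [.op (.copy .bestVal .t), .op (.copy .best .j)])
        (.op (.const .c 0))])]

/-- Finds an owner of a stale unit of the consumer `best`. -/
def findOwnerCode : Code := .block
  -- Row `M` of unsold units is a possible owner too, so here the value for failure is `M + 1`.
  [.op (.copy .own .M'),
    .forLt .i .M' (.block [.op (.load .t .G .i .best),
      .cond .zero .t (.op (.copy .own .i)) (.op (.const .c 0))])]

/-- The supplier `src` takes a unit of `best` from `own`. -/
def moveCode : Code := .block
  [.op (.load .t .G .own .best), .op (.sub .t .t .one), .op (.store .G .own .best .t),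
    -- For an unsold unit `own = M`, and this updates an entry of `S` that belongs to no supplier.
    .op (.load .t .S .own .zero), .op (.add .t .t .one), .op (.store .S .own .zero .t),
    .op (.load .t .H .src .best), .op (.add .t .t .one), .op (.store .H .src .best .t),
    .op (.load .t .S .src .zero), .op (.sub .t .t .one), .op (.store .S .src .zero .t)]

/-- The consumer `best` raises its price. -/
def raiseCode : Code := .block
  [.op (.load .t .Q .best .zero), .op (.add .t .t .one), .op (.store .Q .best .zero .t),
    .forLt .i .M (.block [.op (.load .t .H .i .best), .op (.store .G .i .best .t),
      .op (.store .H .i .best .zero)])]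

/-- The auction. -/
def auctionCode : Code :=
  -- The number of rounds is fixed in advance; once all supply is placed, the remaining rounds leave
  -- the arrays unchanged.
  .forLt .k .steps (.block [findSupplierCode,
    .cond .src .M
      (.block [findBestCode, findOwnerCode, .cond .own .M' moveCode raiseCode])
      (.op (.const .c 0))])

/-- Computes the output from the outcome of the auction. -/
def totalCode (p : ℝ) : Code := .block
  [.op (.const .tot 0),
    .forLt .i .M (.forLt .j .M (.block [.op (.load .t .G .i .j), .op (.load .c .H .i .j),
      .op (.add .t .t .c), .op (.load .c .cost .i .j), .op (.mul .t .t .c),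
      .op (.add .tot .tot .t)])),
    .cond .zero .tot
      (.block [.op (.xOfNat .tot), .op (.yOfNat .N), .op .xDiv, .op .xLog, .op (.yConst (1 / p)),
        .op .xMul, .op .xExp])
      (.op (.xConst 0))]

/-- The whole program. -/
def mainCode (d : ℕ) (p γ : ℝ) (D : ℕ) : Code := .block
  [setupCode d p γ D, collectCode, unitsCode, digitsCode, costsCode p, auctionCode, totalCode p]

theorem mainCode_wf (d : ℕ) (p γ : ℝ) (D : ℕ) : (mainCode d p γ D).WF := by
  simp [mainCode, setupCode, collectCode, unitsCode, digitsCode, costsCode, auctionCode, totalCode,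
    Code.block, powCeilCode, divCode, locateCode, countCode, costEntryCode, findSupplierCode,
    findBestCode, findOwnerCode, moveCode, raiseCode, Code.WF, Code.writes, Op.writes]

/-! ### Specification of the parts -/

section Spec

variable {d n : ℕ} (e : Env d n) (κ : ℕ)

/-- The parameters have been computed. -/
structure Ready (d m L D : ℕ) (v : Mem) : Prop where
  m_eq : v.reg .m = m
  L_eq : v.reg .L = L
  M_eq : v.reg .M = m ^ d
  M'_eq : v.reg .M' = m ^ d + 1
  U_eq : v.reg .U = m ^ d * L
  N_eq : v.reg .N = m ^ d * L * L
  steps_eq : v.reg .steps = (D * L + 2) * (m ^ d + m ^ d + m ^ d * L)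
  dim_eq : v.reg .dim = d
  one_eq : v.reg .one = 1
  zero_eq : v.reg .zero = 0

theorem Ready.frame {m L D : ℕ} {v w : Mem} {R : List Reg} {As : List Arr}
    (h : Ready d m L D v) (hf : Frame R As v w)
    (hR : ∀ r ∈ [Reg.m, .L, .M, .M', .U, .N, .steps, .dim, .one, .zero], r ∉ R) :
    Ready d m L D w := by
  constructor <;> rw [hf.reg _ (hR _ (by simp))]
  exacts [h.m_eq, h.L_eq, h.M_eq, h.M'_eq, h.U_eq, h.N_eq, h.steps_eq, h.dim_eq, h.one_eq, h.zero_eq]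

theorem Code.powCeil_spec (hn : 0 < n) (a : Reg) (r : ℝ) (v : Mem) :
    ((powCeilCode a r).den e v).reg a = ⌈(n : ℝ) ^ r⌉₊ ∧
      (∀ r', r' ≠ a → r' ≠ .t → ((powCeilCode a r).den e v).reg r' = v.reg r') ∧
      ((powCeilCode a r).den e v).arr = v.arr ∧
      ((powCeilCode a r).den e v).estUsed = v.estUsed ∧
      ((powCeilCode a r).den e v).refUsed = v.refUsed ∧
      (powCeilCode a r).time e κ v = 9 + 4 * ⌈(n : ℝ) ^ r⌉₊ := by
  have hn' : (0 : ℝ) < n := by exact_mod_cast hn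
  refine ⟨?_, fun r' h h' => ?_, rfl, rfl, rfl, ?_⟩
  · simp [powCeilCode, Code.block, Code.den, Op.den, Real.rpow_def_of_pos hn']
  · simp [powCeilCode, Code.block, Code.den, Op.den, Mem.set_reg, h, h']
  · simp [powCeilCode, Code.block, Code.den, Op.den, Code.time, Op.time, Op.instrs, Instr.cost,
      Real.rpow_def_of_pos hn']
    ring

/-- With `q` the integer quotient, `(a + 1) / c` lies in `(q, q + 1]`. Shifting by 1 is what turns a
ceiling into integer division. -/
theorem ceil_div_sub_one (a c : ℕ) (hc : 0 < c) : ⌈((a + 1 : ℕ) : ℝ) / c⌉₊ - 1 = a / c := by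
  have hc' : (0 : ℝ) < c := by exact_mod_cast hc
  have h : ⌈((a + 1 : ℕ) : ℝ) / c⌉₊ = a / c + 1 := by
    rw [Nat.ceil_eq_iff (Nat.succ_ne_zero _)]
    constructor
    · rw [Nat.succ_eq_add_one, Nat.add_sub_cancel, lt_div_iff₀ hc']
      exact_mod_cast Nat.lt_succ_of_le (Nat.div_mul_le_self a c)
    · rw [div_le_iff₀ hc']
      have := Nat.lt_mul_of_div_lt (Nat.lt_succ_self (a / c)) hc
      exact_mod_cast (by linarith [mul_comm c (a / c + 1)] : a + 1 ≤ (a / c + 1) * c)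
  rw [h, Nat.add_sub_cancel]

/-- The real registers `x` and `y` are scratch here, so their final values are left unspecified. -/
theorem Code.div_spec (a b c : Reg) (ha : a ≠ c) (ho : a ≠ .one) (v : Mem)
    (h1 : v.reg .one = 1) (hc : 0 < v.reg c) :
    (divCode a b c).den e v = { v.set a (v.reg b / v.reg c) with
      x := ((divCode a b c).den e v).x, y := ((divCode a b c).den e v).y } ∧
      (divCode a b c).time e κ v ≤ 12 + 4 * (v.reg b / v.reg c) := by
  have key := ceil_div_sub_one (v.reg b) (v.reg c) hc
  constructor
  · simp [divCode, Code.block, Code.den, Op.den, ha.symm, ho.symm, h1, Mem.set]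
    rw [← key]
    push_cast
    rfl
  · simp [divCode, Code.block, Code.den, Op.den, Code.time, Op.time, Op.instrs, Instr.cost,
      Mem.set_reg, ha.symm, h1]
    push_cast at key
    omega

theorem Code.setup_spec (hn : 0 < n) (p γ : ℝ) (D : ℕ) :
    Ready d ⌈(n : ℝ) ^ (γ / d)⌉₊ ⌈(n : ℝ) ^ (γ * p / d)⌉₊ D ((setupCode d p γ D).den e .zero) ∧
      ((setupCode d p γ D).den e .zero).arr = Mem.zero.arr ∧
      ((setupCode d p γ D).den e .zero).estUsed = 0 ∧
      ((setupCode d p γ D).den e .zero).refUsed = 0 ∧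
      (setupCode d p γ D).time e κ .zero ≤ 40 + 4 * d + 4 * ⌈(n : ℝ) ^ (γ / d)⌉₊ +
        4 * ⌈(n : ℝ) ^ (γ * p / d)⌉₊ := by
  obtain ⟨h1, h2, h3, h4, h5, h6⟩ := Code.powCeil_spec e κ hn .m (γ / d) .zero
  set v1 := (powCeilCode .m (γ / d)).den e .zero with hv1
  obtain ⟨g1, g2, g3, g4, g5, g6⟩ := Code.powCeil_spec e κ hn .L (γ * p / d) v1
  set v2 := (powCeilCode .L (γ * p / d)).den e v1 with hv2
  generalize hm : ⌈(n : ℝ) ^ (γ / d)⌉₊ = m at *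
  generalize hL : ⌈(n : ℝ) ^ (γ * p / d)⌉₊ = L at *
  have hm2 : v2.reg .m = m := by rw [g2 .m (by decide) (by decide), h1]
  have hz2 : v2.reg .zero = 0 := by
    rw [g2 .zero (by decide) (by decide), h2 .zero (by decide) (by decide)]; rfl
  set v3 := ((v2.set .dim d).set .one 1).set .M 1 with hv3
  have hloop := Code.forLt_rule e (κ := κ) (c := .l) (b := .dim) (P := .op (.mul .M .M .m))
    (v := v3) (fun k w => w.reg .M = m ^ k ∧ w.estUsed = 0 ∧ w.refUsed = 0) 1
    ⟨by simp [hv3, Mem.set_reg], by simp [hv3, g4, h4, Mem.zero],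
      by simp [hv3, g5, h5, Mem.zero]⟩
    (by
      rintro k - w hf - ⟨hM, he, hr⟩
      have hwm : w.reg .m = m := by
        rw [hf.reg .m (by decide)]; simp [hv3, Mem.set_reg, hm2]
      refine ⟨⟨?_, he, hr⟩, by simp [Code.time, Op.time, Op.instrs, Instr.cost]⟩
      simp [Code.den, Op.den, Mem.set_reg, hM, hwm, pow_succ])
  have hd3 : v3.reg .dim = d := by simp [hv3, Mem.set_reg]
  rw [hd3] at hloop
  have hfr := (Code.forLt .l .dim (.op (.mul .M .M .m))).frame e v3
  set v4 := (Code.forLt .l .dim (.op (.mul .M .M .m))).den e v3 with hv4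
  obtain ⟨⟨k1, k2, k3⟩, k4⟩ := hloop
  have f1 : v4.reg .m = m := by
    rw [hfr.reg .m (by decide)]; simp [hv3, Mem.set_reg, hm2]
  have f2 : v4.reg .L = L := by
    rw [hfr.reg .L (by decide)]; simp [hv3, Mem.set_reg, g1]
  have f3 : v4.reg .one = 1 := by
    rw [hfr.reg .one (by decide)]; simp [hv3, Mem.set_reg]
  have f4 : v4.reg .zero = 0 := by
    rw [hfr.reg .zero (by decide)]; simp [hv3, Mem.set_reg, hz2]
  have f5 : v4.reg .dim = d := by
    rw [hfr.reg .dim (by decide)]; simp [hv3, Mem.set_reg]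
  have f6 : v4.arr = Mem.zero.arr := by
    funext A
    rw [hfr.arr A (by simp [Code.arrWrites, Op.arrWrites])]
    simp [hv3, g3, h3]
  have hden : (setupCode d p γ D).den e .zero = (Code.block [.op (.mul .U .M .L),
    .op (.mul .N .U .L), .op (.add .M' .M .one), .op (.const .steps D),
    .op (.mul .steps .steps .L), .op (.const .t 2), .op (.add .steps .steps .t),
    .op (.add .t .M .M), .op (.add .t .t .U), .op (.mul .steps .steps .t)]).den e v4 := rfl
  refine ⟨?_, ?_, ?_, ?_, ?_⟩
  · rw [hden]
    constructor <;> simp [Code.block, Code.den, Op.den, Mem.set_reg, k1, f1, f2, f3, f4, f5]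
  · rw [hden, ← f6]; rfl
  · rw [hden]; simpa [Code.block, Code.den, Op.den] using k2
  · rw [hden]; simpa [Code.block, Code.den, Op.den] using k3
  · have ht : (setupCode d p γ D).time e κ .zero = (powCeilCode .m (γ / d)).time e κ .zero +
        ((powCeilCode .L (γ * p / d)).time e κ v1 +
          (3 + ((Code.forLt .l .dim (.op (.mul .M .M .m))).time e κ v3 + 10))) := by
      rw [setupCode]
      simp only [Code.block, Code.time, Op.time, Op.instrs, Instr.cost, List.map, List.sum_cons,
        List.sum_nil]
      simp only [← hv1, Code.den, Op.den, ← hv2, ← hv3]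
      ring
    rw [ht, h6, g6]
    omega

end Spec

/-! ### Locating the draws, counting them, and rounding the counts -/

section Spec

variable {d n : ℕ} (e : Env d n) (κ : ℕ)

/-- The number of the cell of the point with coordinates `x`. -/
def cellNum (m d : ℕ) (x : ℕ → ℝ) : ℕ := ∑ l ∈ Finset.range d, (⌈x l * m⌉₊ - 1) * m ^ l

theorem Code.locate_spec {m L D : ℕ} {v : Mem} (hv : Ready d m L D v)
    (hpt : ∀ l < d, v.pt l ≤ 1) :
    (locateCode.den e v).reg .idx = cellNum m d v.pt ∧
      (locateCode.den e v).estUsed = v.estUsed ∧ (locateCode.den e v).refUsed = v.refUsed ∧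
      locateCode.time e κ v ≤ 4 + d * (15 + 4 * m) := by
  set v0 := (v.set .idx 0).set .pw 1 with hv0
  have hv0' : Ready d m L D v0 :=
    (hv.frame (frame_set (R := [.idx, .pw]) (As := []) v (c := .idx) 0 (by simp)) (by decide)).frame
      (frame_set (R := [.idx, .pw]) (As := []) _ (c := .pw) 1 (by simp)) (by decide)
  have hloop := Code.forLt_rule e (κ := κ) (c := .l) (b := .dim) (P := .block [.op (.xCoord .l),
      .op (.yOfNat .m), .op .xMul, .ceil .c, .op (.sub .c .c .one), .op (.mul .c .c .pw),
      .op (.add .idx .idx .c), .op (.mul .pw .pw .m)])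
    (v := v0) (fun k w => w.reg .idx = cellNum m k v.pt ∧ w.reg .pw = m ^ k ∧ w.pt = v.pt ∧
      w.estUsed = v.estUsed ∧ w.refUsed = v.refUsed) (12 + 4 * m)
    ⟨by simp [hv0, Mem.set_reg, cellNum], by simp [hv0, Mem.set_reg], by simp [hv0],
      by simp [hv0], by simp [hv0]⟩
    (by
      rintro k hk w hf hwk ⟨h1, h2, h3, h4, h5⟩
      have hw := hv0'.frame hf (by decide)
      rw [hv0'.dim_eq] at hk
      refine ⟨⟨?_, ?_, ?_, ?_, ?_⟩, ?_⟩
      · simp [Code.block, Code.den, Op.den, Mem.set_reg, h1, h2, h3, hwk, hw.m_eq, hw.one_eq,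
          cellNum, Finset.sum_range_succ]
      · simp [Code.block, Code.den, Op.den, Mem.set_reg, h2, hw.m_eq, pow_succ]
      · simp [Code.block, Code.den, Op.den, h3]
      · simp [Code.block, Code.den, Op.den, h4]
      · simp [Code.block, Code.den, Op.den, h5]
      · have : ⌈v.pt k * m⌉₊ ≤ m := by
          refine Nat.ceil_le.mpr ?_
          exact mul_le_of_le_one_left (Nat.cast_nonneg m) (hpt k hk)
        simp [Code.block, Code.den, Code.time, Op.den, Op.time, Op.instrs, Instr.cost, h3, hwk,
          hw.m_eq]
        omega)
  rw [hv0'.dim_eq] at hloop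
  obtain ⟨⟨h1, -, -, h4, h5⟩, h6⟩ := hloop
  refine ⟨h1, h4, h5, ?_⟩
  have : ∀ P : Code, (Code.block [.op (.const .idx 0), .op (.const .pw 1), P]).time e κ v =
      2 + P.time e κ v0 := by
    intro P
    simp only [Code.block, Code.time, Op.time, Op.instrs, Instr.cost, List.map, List.sum_cons,
        List.sum_nil, Code.den, Op.den, ← hv0]
    ring
  rw [locateCode, this]
  refine (Nat.add_le_add_left h6 _).trans ?_
  have : 12 + 4 * m + 3 = 15 + 4 * m := by ring
  rw [this]; omega

/-- The number of the first `N` points that lie in the cell `i`. -/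
def cellCount (m : ℕ) (f : ℕ → Cube d) (N i : ℕ) : ℕ :=
  ((Finset.range N).filter
    fun k => cellNum m d (fun l => if h : l < d then (f k).1 ⟨l, h⟩ else 0) = i).card

theorem cellNum_congr {m d : ℕ} {x y : ℕ → ℝ} (h : ∀ l < d, x l = y l) :
    cellNum m d x = cellNum m d y :=
  Finset.sum_congr rfl fun l hl => by rw [h l (Finset.mem_range.mp hl)]

theorem cellCount_succ (m : ℕ) (f : ℕ → Cube d) (N i : ℕ) {x : ℕ → ℝ}
    (hx : ∀ l (h : l < d), x l = (f N).1 ⟨l, h⟩) :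
    cellCount m f (N + 1) i = cellCount m f N i + if i = cellNum m d x then 1 else 0 := by
  have : cellNum m d x = cellNum m d (fun l => if h : l < d then (f N).1 ⟨l, h⟩ else 0) :=
    cellNum_congr fun l hl => by simp [hl, hx l hl]
  rw [cellCount, Finset.range_add_one, Finset.filter_insert, this]
  split
  · rename_i h
    rw [Finset.card_insert_of_notMem (by simp), if_pos h.symm, cellCount]
  · rename_i h
    rw [if_neg (fun h' => h h'.symm), cellCount, add_zero]

theorem Code.count_spec (A : Arr) (v : Mem) (hz : v.reg .zero = 0) (ho : v.reg .one = 1) :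
    ((countCode A).den e v).arr A =
      (fun i j => v.arr A i j + if i = v.reg .idx ∧ j = 0 then 1 else 0) ∧
    (∀ A', A' ≠ A → ((countCode A).den e v).arr A' = v.arr A') ∧
    ((countCode A).den e v).estUsed = v.estUsed ∧ ((countCode A).den e v).refUsed = v.refUsed ∧
    (countCode A).time e κ v = 17 := by
  refine ⟨?_, fun A' h => ?_, rfl, rfl, ?_⟩
  · funext i j
    simp only [countCode, Code.block, Code.den, Op.den, Mem.setArr_arr, Mem.set_reg, Mem.set_arr,
      hz, ho]
    by_cases h : i = v.reg .idx ∧ j = 0 <;> simp [h]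
  · funext i j
    simp [countCode, Code.block, Code.den, Op.den, Mem.setArr_arr, h]
  · simp [countCode, Code.block, Code.time, Op.time, Op.instrs, Instr.cost, addrInstrs]

/-- Round `k` uses draw number `k` of both procedures, so the counts are those of the first `N`
terms of the two sequences. -/
theorem Code.collect_spec {m L D : ℕ} {v : Mem} (hv : Ready d m L D v)
    (hA : ∀ i j, v.arr .A i j = 0) (hB : ∀ i j, v.arr .B i j = 0)
    (he : v.estUsed = 0) (hr : v.refUsed = 0) :
    Ready d m L D (collectCode.den e v) ∧
      (∀ i, (collectCode.den e v).arr .A i 0 = cellCount m e.refDraw (m ^ d * L * L) i) ∧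
      (∀ i, (collectCode.den e v).arr .B i 0 = cellCount m e.estDraw (m ^ d * L * L) i) ∧
      (∀ A, A ≠ .A → A ≠ .B → (collectCode.den e v).arr A = v.arr A) ∧
      collectCode.time e κ v ≤ 2 + m ^ d * L * L * (2 * κ + 47 + 2 * (d * (15 + 4 * m))) := by
  have hfr := collectCode.frame e v
  have hloop := Code.forLt_rule e (κ := κ) (c := .k) (b := .N)
    (P := .block [.op .drawRef, locateCode, countCode .A, .op .drawEst, locateCode, countCode .B])
    (v := v) (fun k w => (∀ i, w.arr .A i 0 = cellCount m e.refDraw k i) ∧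
      (∀ i, w.arr .B i 0 = cellCount m e.estDraw k i) ∧ w.estUsed = k ∧ w.refUsed = k)
    (2 * κ + 44 + 2 * (d * (15 + 4 * m)))
    ⟨by simp [hA, cellCount], by simp [hB, cellCount], by simp [he], by simp [hr]⟩
    (by
      rintro k - w hf - ⟨h1, h2, h3, h4⟩
      have hw := hv.frame hf (by decide)
      set w1 := Op.drawRef.den e w with hw1
      have r1 : Ready d m L D w1 := hw.frame (Op.drawRef.frame e w) (by decide)
      have p1 : ∀ l (h : l < d), w1.pt l = (e.refDraw k).1 ⟨l, h⟩ := by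
        intro l h; simp [hw1, Op.den, Mem.setPt, h, h4]
      obtain ⟨a1, a2, a3, a4⟩ := Code.locate_spec e κ r1 (fun l h => by
        rw [p1 l h]; exact ((e.refDraw k).2 _).2)
      have r2 := r1.frame (locateCode.frame e w1) (by decide)
      have q2 := (locateCode.frame e w1).arr
      set w2 := locateCode.den e w1 with hw2
      obtain ⟨b1, b2, b3, b4, b5⟩ := Code.count_spec e κ .A w2 r2.zero_eq r2.one_eq
      have r3 := r2.frame ((countCode .A).frame e w2) (by decide)
      set w3 := (countCode .A).den e w2 with hw3
      set w4 := Op.drawEst.den e w3 with hw4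
      have r4 : Ready d m L D w4 := r3.frame (Op.drawEst.frame e w3) (by decide)
      have u3 : w3.estUsed = k := by rw [b3, a2]; exact h3
      have v3 : w3.refUsed = k + 1 := by rw [b4, a3]; simp [hw1, Op.den, h4]
      have p4 : ∀ l (h : l < d), w4.pt l = (e.estDraw k).1 ⟨l, h⟩ := by
        intro l h; simp [hw4, Op.den, Mem.setPt, h, u3]
      obtain ⟨c1, c2, c3, c4⟩ := Code.locate_spec e κ r4 (fun l h => by
        rw [p4 l h]; exact ((e.estDraw k).2 _).2)
      have r5 := r4.frame (locateCode.frame e w4) (by decide)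
      have q5 := (locateCode.frame e w4).arr
      set w5 := locateCode.den e w4 with hw5
      obtain ⟨d1, d2, d3, d4, d5⟩ := Code.count_spec e κ .B w5 r5.zero_eq r5.one_eq
      set w6 := (countCode .B).den e w5 with hw6
      have hden : (Code.block [.op .drawRef, locateCode, countCode .A, .op .drawEst, locateCode,
        countCode .B]).den e w = w6 := rfl
      rw [hden]
      refine ⟨⟨fun i => ?_, fun i => ?_, ?_, ?_⟩, ?_⟩
      · rw [Mem.set_arr, d2 _ (by decide), q5 _ (by decide)]
        change w3.arr .A i 0 = _
        rw [b1, q2 _ (by decide), a1, cellCount_succ m e.refDraw k i p1]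
        simp only [and_true, ← h1 i]
        rfl
      · rw [Mem.set_arr, d1, q5 _ (by decide), c1, cellCount_succ m e.estDraw k i p4]
        have : w4.arr .B i 0 = w.arr .B i 0 := by
          change w3.arr .B i 0 = _
          rw [b2 _ (by decide), q2 _ (by decide)]; rfl
        simp only [and_true, this, h2 i]
      · rw [Mem.set_estUsed, d3, c2]; simp [hw4, Op.den, u3]
      · rw [Mem.set_refUsed, d4, c3]; simp [hw4, Op.den, Mem.setPt, v3]
      · have : (Code.block [.op .drawRef, locateCode, countCode .A, .op .drawEst, locateCode,
            countCode .B]).time e κ w = (κ + 1) + (locateCode.time e κ w1 +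
              ((countCode .A).time e κ w2 + ((κ + 1) + (locateCode.time e κ w4 +
                (countCode .B).time e κ w5)))) := by
          simp only [Code.block, Code.time, Op.time, Op.instrs, Instr.cost, List.map,
            List.sum_cons, List.sum_nil, Code.den]
          rfl
        rw [this, b5, d5]
        omega)
  rw [hv.N_eq] at hloop
  obtain ⟨⟨h1, h2, -, -⟩, h3⟩ := hloop
  refine ⟨hv.frame hfr (by decide), h1, h2, fun A hA hB => hfr.arr A ?_, ?_⟩
  · cases A <;> first | contradiction | decide
  · refine h3.trans (le_of_eq ?_)
    ring

theorem Code.units_spec {m L D : ℕ} {v : Mem} (hv : Ready d m L D v) (hL : 0 < L) {A0 B0 : ℕ → ℕ}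
    (hA : ∀ i, v.arr .A i 0 = A0 i) (hB : ∀ i, v.arr .B i 0 = B0 i)
    (hAm : ∀ i, A0 i ≤ m ^ d * L * L) (hBm : ∀ i, B0 i ≤ m ^ d * L * L)
    (hG : ∀ i j, v.arr .G i j = 0) :
    Ready d m L D (unitsCode.den e v) ∧
      (∀ i < m ^ d, (unitsCode.den e v).arr .S i 0 = A0 i / L) ∧
      (∀ i < m ^ d, (unitsCode.den e v).arr .G (m ^ d) i = B0 i / L + 1) ∧
      (∀ i < m ^ d, ∀ j, (unitsCode.den e v).arr .G i j = 0) ∧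
      (∀ A, A ≠ .S → A ≠ .G → (unitsCode.den e v).arr A = v.arr A) ∧
      unitsCode.time e κ v ≤ 2 + m ^ d * (60 + 8 * (m ^ d * L)) := by
  have hfr := unitsCode.frame e v
  have hloop := Code.forLt_rule e (κ := κ) (c := .i) (b := .M)
    (P := .block [.op (.load .t .A .i .zero), divCode .s .t .L, .op (.store .S .i .zero .s),
      .op (.load .t .B .i .zero), divCode .s .t .L, .op (.add .s .s .one),
      .op (.store .G .M .i .s)])
    (v := v) (fun k w => (∀ i < k, w.arr .S i 0 = A0 i / L) ∧
      (∀ i < k, w.arr .G (m ^ d) i = B0 i / L + 1) ∧ (∀ i < m ^ d, ∀ j, w.arr .G i j = 0))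
    (57 + 8 * (m ^ d * L))
    ⟨by simp, by simp, by simp [hG]⟩
    (by
      rintro k hk w hf hwk ⟨h1, h2, h3⟩
      have hw := hv.frame hf (by decide)
      rw [hv.M_eq] at hk
      have wA : w.arr .A k 0 = A0 k := by rw [hf.arr .A (by decide), hA]
      have wB : w.arr .B k 0 = B0 k := by rw [hf.arr .B (by decide), hB]
      set w1 := (Op.load .t .A .i .zero).den e w with hw1
      have e1 : w1 = w.set .t (A0 k) := by simp [hw1, Op.den, hwk, hw.zero_eq, wA]
      obtain ⟨a1, a2⟩ := Code.div_spec e κ .s .t .L (by decide) (by decide) w1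
        (by simp [e1, Mem.set_reg, hw.one_eq]) (by simpa [e1, Mem.set_reg, hw.L_eq] using hL)
      have a3 : w1.reg .t / w1.reg .L = A0 k / L := by simp [e1, Mem.set_reg, hw.L_eq]
      rw [a3] at a1 a2
      set w2 := (divCode .s .t .L).den e w1 with hw2
      set w3 := (Op.load .t .B .i .zero).den e ((Op.store .S .i .zero .s).den e w2) with hw3
      have e3 : w3 = { ((w.set .t (A0 k)).set .s (A0 k / L)).setArr .S k 0 (A0 k / L) |>.set .t
          (B0 k) with x := w2.x, y := w2.y } := by
        simp only [hw3, Op.den]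
        rw [a1]
        simp [e1, Mem.setArr, Mem.set, hwk, hw.zero_eq, wB]
      obtain ⟨b1, b2⟩ := Code.div_spec e κ .s .t .L (by decide) (by decide) w3
        (by simp [e3, Mem.set_reg, hw.one_eq]) (by simpa [e3, Mem.set_reg, hw.L_eq] using hL)
      have b3 : w3.reg .t / w3.reg .L = B0 k / L := by simp [e3, Mem.set_reg, hw.L_eq]
      rw [b3] at b1 b2
      set w4 := (divCode .s .t .L).den e w3 with hw4
      have hden : (Code.block [.op (.load .t .A .i .zero), divCode .s .t .L,
        .op (.store .S .i .zero .s), .op (.load .t .B .i .zero), divCode .s .t .L,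
        .op (.add .s .s .one), .op (.store .G .M .i .s)]).den e w =
        (Op.store .G .M .i .s).den e ((Op.add .s .s .one).den e w4) := rfl
      have harr : ∀ A i j, ((Op.store .G .M .i .s).den e ((Op.add .s .s .one).den e w4)).arr A i j =
          if A = .G ∧ i = m ^ d ∧ j = k then B0 k / L + 1 else
            if A = .S ∧ i = k ∧ j = 0 then A0 k / L else w.arr A i j := by
        intro A i j
        simp only [Op.den]
        rw [b1]
        simp [e3, Mem.set_reg, Mem.setArr_arr, hwk, hw.M_eq, hw.one_eq]
      rw [hden]
      refine ⟨⟨fun i hi => ?_, fun i hi => ?_, fun i hi j => ?_⟩, ?_⟩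
      · rw [Mem.set_arr, harr]
        by_cases hik : i = k
        · simp [hik]
        · simpa [hik] using h1 i (by omega)
      · rw [Mem.set_arr, harr]
        by_cases hik : i = k
        · simp [hik]
        · simpa [hik] using h2 i (by omega)
      · rw [Mem.set_arr, harr]
        simpa [hi.ne] using h3 i hi j
      · have : (Code.block [.op (.load .t .A .i .zero), divCode .s .t .L,
          .op (.store .S .i .zero .s), .op (.load .t .B .i .zero), divCode .s .t .L,
          .op (.add .s .s .one), .op (.store .G .M .i .s)]).time e κ w =
            8 + ((divCode .s .t .L).time e κ w1 + (8 + (8 + ((divCode .s .t .L).time e κ w3 +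
              (1 + 8))))) := by
          simp only [Code.block, Code.time, Op.time, Op.instrs, Instr.cost, List.map,
            List.sum_cons, List.sum_nil, Code.den, addrInstrs, List.map_append, List.sum_append]
          rfl
        rw [this]
        have c1 : A0 k / L ≤ m ^ d * L := Nat.div_le_of_le_mul (by
          rw [mul_comm L]; exact hAm k)
        have c2 : B0 k / L ≤ m ^ d * L := Nat.div_le_of_le_mul (by
          rw [mul_comm L]; exact hBm k)
        omega)
  rw [hv.M_eq] at hloop
  obtain ⟨⟨h1, h2, h3⟩, h4⟩ := hloop
  refine ⟨hv.frame hfr (by decide), h1, h2, h3, fun A hA hB => hfr.arr A ?_, ?_⟩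
  · cases A <;> first | contradiction | decide
  · refine h4.trans (le_of_eq ?_)
    ring

end Spec

/-! ### Digits of cell numbers and rounded costs -/

section Spec

variable {d n : ℕ} (e : Env d n) (κ : ℕ)

/-- A coordinate of a cell. -/
def cellDigit (m i l : ℕ) : ℕ := i / m ^ l % m

theorem Code.digits_spec {m L D : ℕ} {v : Mem} (hv : Ready d m L D v) (hm : 0 < m) :
    Ready d m L D (digitsCode.den e v) ∧
      (∀ i < m ^ d, ∀ l < d, (digitsCode.den e v).arr .digit i l = cellDigit m i l) ∧
      (∀ A, A ≠ .digit → (digitsCode.den e v).arr A = v.arr A) ∧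
      digitsCode.time e κ v ≤ 2 + m ^ d * (7 + d * (27 + 4 * m ^ d)) := by
  have hfr := digitsCode.frame e v
  set inner := Code.block [divCode .c .t .m, .op (.mul .s .c .m), .op (.sub .s .t .s),
      .op (.store .digit .i .l .s), .op (.copy .t .c)] with hinner
  have hloop := Code.forLt_rule e (κ := κ) (c := .i) (b := .M)
    (P := .block [.op (.copy .t .i), .forLt .l .dim inner])
    (v := v) (fun k w => ∀ i < k, ∀ l < d, w.arr .digit i l = cellDigit m i l)
    (4 + d * (27 + 4 * m ^ d)) (by simp)
    (by
      rintro k hk w hf hwk h1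
      have hw := hv.frame hf (by decide)
      rw [hv.M_eq] at hk
      set w1 := (Op.copy .t .i).den e w with hw1
      have r1 : Ready d m L D w1 := hw.frame ((Op.copy .t .i).frame e w) (by decide)
      have i1 : w1.reg .i = k := by simp [hw1, Op.den, Mem.set_reg, hwk]
      have hin := Code.forLt_rule e (κ := κ) (c := .l) (b := .dim) (P := inner) (v := w1)
        -- Dividing repeatedly by `m`, register `t` holds `k / m ^ l` before digit `l` is extracted.
        (fun l u => (∀ i < k, ∀ l < d, u.arr .digit i l = cellDigit m i l) ∧
          (∀ l' < l, u.arr .digit k l' = cellDigit m k l') ∧ u.reg .t = k / m ^ l)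
        (24 + 4 * m ^ d)
        ⟨h1, by simp, by simp [hw1, Op.den, Mem.set_reg, hwk]⟩
        (by
          rintro l - u hfu hul ⟨h2, h3, h4⟩
          have hu := r1.frame hfu (by decide)
          have iu : u.reg .i = k := by rw [hfu.reg .i (by decide), i1]
          obtain ⟨a1, a2⟩ := Code.div_spec e κ .c .t .m (by decide) (by decide) u hu.one_eq
            (by rw [hu.m_eq]; exact hm)
          have hq : u.reg .t / u.reg .m = k / m ^ (l + 1) := by
            rw [h4, hu.m_eq, Nat.div_div_eq_div_mul, pow_succ]
          have hr : u.reg .t - u.reg .t / u.reg .m * u.reg .m = cellDigit m k l := by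
            rw [hu.m_eq, mul_comm, ← Nat.mod_eq_sub, h4, cellDigit]
          set u1 := (divCode .c .t .m).den e u with hu1
          have hden : inner.den e u = (Op.copy .t .c).den e ((Op.store .digit .i .l .s).den e
            ((Op.sub .s .t .s).den e ((Op.mul .s .c .m).den e u1))) := rfl
          have harr : ∀ i' l', (inner.den e u).arr .digit i' l' =
              if i' = k ∧ l' = l then cellDigit m k l else u.arr .digit i' l' := by
            intro i' l'
            rw [hden]
            simp only [Op.den]
            rw [a1]
            simp [Mem.set_reg, Mem.setArr_arr, hul, iu, hr]
          refine ⟨⟨fun i' hi' l' hl' => ?_, fun l' hl' => ?_, ?_⟩, ?_⟩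
          · rw [Mem.set_arr, harr]
            simpa [hi'.ne] using h2 i' hi' l' hl'
          · rw [Mem.set_arr, harr]
            by_cases hll : l' = l
            · simp [hll]
            · simpa [hll] using h3 l' (by omega)
          · rw [hden]
            simp only [Op.den]
            rw [a1]
            simp [Mem.set_reg, hq]
          · have : inner.time e κ u = (divCode .c .t .m).time e κ u + 12 := by
              simp only [hinner, Code.block, Code.time, Op.time, Op.instrs, Instr.cost, List.map,
                List.sum_cons, List.sum_nil, addrInstrs, List.map_append, List.sum_append]
              ring
            rw [this]
            have : u.reg .t / u.reg .m ≤ m ^ d := by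
              rw [hq]
              exact (Nat.div_le_self _ _).trans hk.le
            omega)
      rw [r1.dim_eq] at hin
      obtain ⟨⟨h2, h3, -⟩, h4⟩ := hin
      refine ⟨fun i hi l hl => ?_, ?_⟩
      · rcases Nat.lt_succ_iff_lt_or_eq.mp hi with hi | rfl
        · exact h2 i hi l hl
        · exact h3 l hl
      · have : (Code.block [.op (.copy .t .i), .forLt .l .dim inner]).time e κ w =
            2 + (Code.forLt .l .dim inner).time e κ w1 := by
          simp only [Code.block, Code.time, Op.time, Op.instrs, Instr.cost, List.map,
            List.sum_cons, List.sum_nil, Code.den]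
          rfl
        rw [this]
        have : 24 + 4 * m ^ d + 3 = 27 + 4 * m ^ d := by ring
        rw [this] at h4
        omega)
  rw [hv.M_eq] at hloop
  obtain ⟨h1, h2⟩ := hloop
  refine ⟨hv.frame hfr (by decide), h1, fun A hA => hfr.arr A ?_, ?_⟩
  · cases A <;> first | contradiction | decide
  · refine h2.trans (le_of_eq ?_)
    ring

/-- The square of the distance of two cells, in units of the mesh. -/
def cellSqDist (m d i j : ℕ) : ℕ :=
  ∑ l ∈ Finset.range d, ((cellDigit m i l - cellDigit m j l) +
    (cellDigit m j l - cellDigit m i l)) ^ 2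

/-- The rounded cost of moving from the cell `i` to the cell `j`. -/
def cellCost (m L d : ℕ) (p : ℝ) (i j : ℕ) : ℕ :=
  if 0 < cellSqDist m d i j then
    ⌈Real.exp (Real.log ((cellSqDist m d i j : ℝ) / ((m * m : ℕ) : ℝ)) * (p / 2)) * L⌉₊ else 0

theorem Code.costEntry_spec {m L D B i j : ℕ} {p : ℝ} {v : Mem} (hv : Ready d m L D v)
    (hi : v.reg .i = i) (hj : v.reg .j = j)
    (hdi : ∀ l < d, v.arr .digit i l = cellDigit m i l)
    (hdj : ∀ l < d, v.arr .digit j l = cellDigit m j l) (hB : cellCost m L d p i j ≤ B) :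
    ((costEntryCode p).den e v).arr .cost =
      (fun i' j' => if i' = i ∧ j' = j then cellCost m L d p i j else v.arr .cost i' j') ∧
      (costEntryCode p).time e κ v ≤ 25 + 24 * d + 4 * B := by
  set inner := Code.block [.op (.load .s .digit .i .l), .op (.load .t .digit .j .l),
      .op (.sub .idx .s .t), .op (.sub .s .t .s), .op (.add .s .s .idx), .op (.mul .s .s .s),
      .op (.add .c .c .s)] with hinner
  set v1 := v.set .c 0 with hv1
  have r1 : Ready d m L D v1 := hv.frame (frame_set (R := [.c]) (As := []) v 0 (by simp))
    (by decide)
  have hloop := Code.forLt_rule e (κ := κ) (c := .l) (b := .dim) (P := inner)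
    (v := v1) (fun k w => w.reg .c = cellSqDist m k i j) 21
    (by simp [hv1, Mem.set_reg, cellSqDist])
    (by
      rintro k hk w hf hwk h1
      rw [r1.dim_eq] at hk
      have iw : w.reg .i = i := by
        rw [hf.reg .i (by decide)]; simpa [hv1, Mem.set_reg] using hi
      have jw : w.reg .j = j := by
        rw [hf.reg .j (by decide)]; simpa [hv1, Mem.set_reg] using hj
      have dw : w.arr .digit = v.arr .digit := by rw [hf.arr .digit (by decide)]; rfl
      constructor
      · simp [hinner, Code.block, Code.den, Op.den, Mem.set_reg, h1, hwk, iw, jw, dw, hdi k hk,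
          hdj k hk, cellSqDist, Finset.sum_range_succ]
        ring
      · simp [hinner, Code.block, Code.time, Op.time, Op.instrs, Instr.cost, addrInstrs])
  have hfr := (Code.forLt .l .dim inner).frame e v1
  rw [r1.dim_eq] at hloop
  set v2 := (Code.forLt .l .dim inner).den e v1 with hv2
  have r2 : Ready d m L D v2 := r1.frame hfr (by decide)
  have i2 : v2.reg .i = i := by
    rw [hfr.reg .i (by decide)]; simpa [hv1, Mem.set_reg] using hi
  have j2 : v2.reg .j = j := by
    rw [hfr.reg .j (by decide)]; simpa [hv1, Mem.set_reg] using hj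
  have c2 : v2.arr .cost = v.arr .cost := by rw [hfr.arr .cost (by decide)]; rfl
  obtain ⟨h1, h2⟩ := hloop
  set tail := Code.cond .zero .c
      (.block [.op (.xOfNat .c), .op (.mul .t .m .m), .op (.yOfNat .t), .op .xDiv, .op .xLog,
        .op (.yConst (p / 2)), .op .xMul, .op .xExp, .op (.yOfNat .L), .op .xMul, .ceil .c])
      (.op (.const .c 0)) with htail
  have ht : (tail.den e v2).reg .c = cellCost m L d p i j ∧
      tail.time e κ v2 ≤ 14 + 4 * cellCost m L d p i j := by
    by_cases hq : 0 < cellSqDist m d i j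
    · simp [htail, Code.block, Code.den, Code.time, Op.den, Op.time, Op.instrs, Instr.cost,
        Mem.set_reg, r2.zero_eq, h1, hq, r2.m_eq, r2.L_eq, cellCost]
      omega
    · simp [htail, Code.block, Code.den, Code.time, Op.den, Op.time, Op.instrs, Instr.cost,
        r2.zero_eq, h1, hq, cellCost]
  have hft := tail.frame e v2
  have i3 : (tail.den e v2).reg .i = i := by rw [hft.reg .i (of_decide_eq_true rfl), i2]
  have j3 : (tail.den e v2).reg .j = j := by rw [hft.reg .j (of_decide_eq_true rfl), j2]
  have c3 : (tail.den e v2).arr .cost = v.arr .cost := by rw [hft.arr .cost (of_decide_eq_true rfl), c2]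
  constructor
  · have hden : (costEntryCode p).den e v = (Op.store .cost .i .j .c).den e (tail.den e v2) := rfl
    rw [hden]
    funext i' j'
    simp [Op.den, Mem.setArr_arr, i3, j3, c3, ht.1]
  · have : (costEntryCode p).time e κ v = 1 + ((Code.forLt .l .dim inner).time e κ v1 +
        (tail.time e κ v2 + 8)) := by
      simp only [costEntryCode, Code.block, Code.time, Op.time, Op.instrs, Instr.cost, List.map,
        List.sum_cons, List.sum_nil, addrInstrs, List.map_append, List.sum_append]
      rfl
    rw [this]
    omega

theorem Code.costs_spec {m L D B : ℕ} {p : ℝ} {v : Mem} (hv : Ready d m L D v)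
    (hd : ∀ i < m ^ d, ∀ l < d, v.arr .digit i l = cellDigit m i l)
    (hB : ∀ i < m ^ d, ∀ j < m ^ d, cellCost m L d p i j ≤ B) :
    Ready d m L D ((costsCode p).den e v) ∧
      (∀ i < m ^ d, ∀ j < m ^ d, ((costsCode p).den e v).arr .cost i j = cellCost m L d p i j) ∧
      (∀ A, A ≠ .cost → ((costsCode p).den e v).arr A = v.arr A) ∧
      (costsCode p).time e κ v ≤ 2 + m ^ d * (5 + m ^ d * (28 + 24 * d + 4 * B)) := by
  have hfr := (costsCode p).frame e v
  have hloop := Code.forLt_rule e (κ := κ) (c := .i) (b := .M)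
    (P := .forLt .j .M (costEntryCode p))
    (v := v) (fun k w => ∀ i < k, ∀ j < m ^ d, w.arr .cost i j = cellCost m L d p i j)
    (2 + m ^ d * (28 + 24 * d + 4 * B)) (by simp)
    (by
      rintro k hk w hf hwk h1
      have hw := hv.frame hf (of_decide_eq_true rfl)
      rw [hv.M_eq] at hk
      have hin := Code.forLt_rule e (κ := κ) (c := .j) (b := .M) (P := costEntryCode p) (v := w)
        (fun l u => (∀ i < k, ∀ j < m ^ d, u.arr .cost i j = cellCost m L d p i j) ∧
          (∀ j < l, u.arr .cost k j = cellCost m L d p k j))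
        (25 + 24 * d + 4 * B)
        ⟨h1, by simp⟩
        (by
          rintro l hl u hfu hul ⟨h2, h3⟩
          rw [hw.M_eq] at hl
          have hu := hw.frame hfu (of_decide_eq_true rfl)
          have iu : u.reg .i = k := by rw [hfu.reg .i (of_decide_eq_true rfl), hwk]
          have du : u.arr .digit = v.arr .digit := by
            rw [hfu.arr .digit (of_decide_eq_true rfl), hf.arr .digit (of_decide_eq_true rfl)]
          obtain ⟨a1, a2⟩ := Code.costEntry_spec e κ hu iu hul (by rw [du]; exact hd k hk)
            (by rw [du]; exact hd l hl) (hB k hk l hl)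
          refine ⟨⟨fun i' hi' j' hj' => ?_, fun j' hj' => ?_⟩, a2⟩
          · rw [Mem.set_arr, a1]
            simpa [hi'.ne] using h2 i' hi' j' hj'
          · rw [Mem.set_arr, a1]
            by_cases hll : j' = l
            · simp [hll]
            · simpa [hll] using h3 j' (by omega))
      rw [hw.M_eq] at hin
      obtain ⟨⟨h2, h3⟩, h4⟩ := hin
      refine ⟨fun i hi j hj => ?_, ?_⟩
      · rcases Nat.lt_succ_iff_lt_or_eq.mp hi with hi | rfl
        · exact h2 i hi j hj
        · exact h3 j hj
      · refine h4.trans (le_of_eq ?_)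
        ring)
  rw [hv.M_eq] at hloop
  obtain ⟨h1, h2⟩ := hloop
  refine ⟨hv.frame hfr (of_decide_eq_true rfl), h1, fun A hA => hfr.arr A ?_, ?_⟩
  · cases A <;> first | contradiction | exact of_decide_eq_true rfl
  · refine h2.trans (le_of_eq ?_)
    ring

end Spec

/-! ### The searches and updates in one round of the auction -/

section Spec

variable {d n : ℕ} (e : Env d n) (κ : ℕ)

theorem Code.findSupplier_spec {m L D : ℕ} {v : Mem} (hv : Ready d m L D v) :
    (((findSupplierCode.den e v).reg .src < m ^ d ∧
        0 < v.arr .S ((findSupplierCode.den e v).reg .src) 0) ∨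
      ((findSupplierCode.den e v).reg .src = m ^ d ∧ ∀ i < m ^ d, v.arr .S i 0 = 0)) ∧
      findSupplierCode.time e κ v ≤ 4 + m ^ d * 14 := by
  set v1 := (Op.copy .src .M).den e v with hv1
  have r1 : Ready d m L D v1 := hv.frame ((Op.copy .src .M).frame e v) (by decide)
  have hloop := Code.forLt_rule e (κ := κ) (c := .i) (b := .M)
    (P := .block [.op (.load .t .S .i .zero),
      .cond .zero .t (.op (.copy .src .i)) (.op (.const .c 0))])
    (v := v1) (fun k w => (w.reg .src < m ^ d ∧ 0 < v.arr .S (w.reg .src) 0) ∨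
      (w.reg .src = m ^ d ∧ ∀ i < k, v.arr .S i 0 = 0)) 11
    (Or.inr ⟨by simp [hv1, Op.den, Mem.set_reg, hv.M_eq], by simp⟩)
    (by
      rintro k hk w hf hwk h1
      have hw := r1.frame hf (by decide)
      rw [r1.M_eq] at hk
      have hS : w.arr .S = v.arr .S := by rw [hf.arr .S (by decide)]; rfl
      by_cases hp : 0 < v.arr .S k 0
      · constructor
        · left
          simp [Code.block, Code.den, Op.den, Mem.set_reg, hw.zero_eq, hS, hwk, hp, hk]
        · simp [Code.block, Code.den, Op.den, Code.time, Op.time, Op.instrs, Instr.cost,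
            Mem.set_reg, addrInstrs, hw.zero_eq, hS, hwk, hp]
      · constructor
        · have : ((Code.block [.op (.load .t .S .i .zero), .cond .zero .t (.op (.copy .src .i))
              (.op (.const .c 0))]).den e w |>.set .i (k + 1)).reg .src = w.reg .src := by
            simp [Code.block, Code.den, Op.den, Mem.set_reg, hw.zero_eq, hS, hwk, hp]
          rw [this]
          refine h1.imp id fun h => ⟨h.1, fun i hi => ?_⟩
          rcases Nat.lt_succ_iff_lt_or_eq.mp hi with hi | rfl
          · exact h.2 i hi
          · omega
        · simp [Code.block, Code.den, Op.den, Code.time, Op.time, Op.instrs, Instr.cost,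
            Mem.set_reg, addrInstrs, hw.zero_eq, hS, hwk, hp])
  rw [r1.M_eq] at hloop
  refine ⟨hloop.1, ?_⟩
  have : findSupplierCode.time e κ v = 2 + (Code.forLt .i .M (.block [.op (.load .t .S .i .zero),
      .cond .zero .t (.op (.copy .src .i)) (.op (.const .c 0))])).time e κ v1 := by
    simp only [findSupplierCode, Code.block, Code.time, Op.time, Op.instrs, Instr.cost, List.map,
      List.sum_cons, List.sum_nil]
    rfl
  rw [this]
  have := hloop.2
  omega

theorem Code.findOwner_spec {m L D : ℕ} {v : Mem} (hv : Ready d m L D v) :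
    (((findOwnerCode.den e v).reg .own < m ^ d + 1 ∧
        0 < v.arr .G ((findOwnerCode.den e v).reg .own) (v.reg .best)) ∨
      ((findOwnerCode.den e v).reg .own = m ^ d + 1 ∧
        ∀ i < m ^ d + 1, v.arr .G i (v.reg .best) = 0)) ∧
      findOwnerCode.time e κ v ≤ 4 + (m ^ d + 1) * 14 := by
  set v1 := (Op.copy .own .M').den e v with hv1
  have r1 : Ready d m L D v1 := hv.frame ((Op.copy .own .M').frame e v) (by decide)
  have b1 : v1.reg .best = v.reg .best := by simp [hv1, Op.den, Mem.set_reg]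
  have hloop := Code.forLt_rule e (κ := κ) (c := .i) (b := .M')
    (P := .block [.op (.load .t .G .i .best),
      .cond .zero .t (.op (.copy .own .i)) (.op (.const .c 0))])
    (v := v1) (fun k w => (w.reg .own < m ^ d + 1 ∧ 0 < v.arr .G (w.reg .own) (v.reg .best)) ∨
      (w.reg .own = m ^ d + 1 ∧ ∀ i < k, v.arr .G i (v.reg .best) = 0)) 11
    (Or.inr ⟨by simp [hv1, Op.den, Mem.set_reg, hv.M'_eq], by simp⟩)
    (by
      rintro k hk w hf hwk h1
      have hw := r1.frame hf (by decide)
      rw [r1.M'_eq] at hk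
      have hG : w.arr .G = v.arr .G := by rw [hf.arr .G (by decide)]; rfl
      have hb : w.reg .best = v.reg .best := by rw [hf.reg .best (by decide), b1]
      by_cases hp : 0 < v.arr .G k (v.reg .best)
      · constructor
        · left
          simp [Code.block, Code.den, Op.den, Mem.set_reg, hw.zero_eq, hG, hb, hwk, hp, hk]
        · simp [Code.block, Code.den, Op.den, Code.time, Op.time, Op.instrs, Instr.cost,
            Mem.set_reg, addrInstrs, hw.zero_eq, hG, hb, hwk, hp]
      · constructor
        · have : ((Code.block [.op (.load .t .G .i .best), .cond .zero .t (.op (.copy .own .i))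
              (.op (.const .c 0))]).den e w |>.set .i (k + 1)).reg .own = w.reg .own := by
            simp [Code.block, Code.den, Op.den, Mem.set_reg, hw.zero_eq, hG, hb, hwk, hp]
          rw [this]
          refine h1.imp id fun h => ⟨h.1, fun i hi => ?_⟩
          rcases Nat.lt_succ_iff_lt_or_eq.mp hi with hi | rfl
          · exact h.2 i hi
          · omega
        · simp [Code.block, Code.den, Op.den, Code.time, Op.time, Op.instrs, Instr.cost,
            Mem.set_reg, addrInstrs, hw.zero_eq, hG, hb, hwk, hp])
  rw [r1.M'_eq] at hloop
  refine ⟨hloop.1, ?_⟩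
  have : findOwnerCode.time e κ v = 2 + (Code.forLt .i .M' (.block [.op (.load .t .G .i .best),
      .cond .zero .t (.op (.copy .own .i)) (.op (.const .c 0))])).time e κ v1 := by
    simp only [findOwnerCode, Code.block, Code.time, Op.time, Op.instrs, Instr.cost, List.map,
      List.sum_cons, List.sum_nil]
    rfl
  rw [this]
  have := hloop.2
  omega

theorem Code.findBest_spec {m L D : ℕ} {v : Mem} (hv : Ready d m L D v) (hM : 0 < m ^ d) :
    (findBestCode.den e v).reg .best < m ^ d ∧
      (∀ k < m ^ d, v.arr .cost (v.reg .src) ((findBestCode.den e v).reg .best) +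
        v.arr .Q ((findBestCode.den e v).reg .best) 0 ≤
          v.arr .cost (v.reg .src) k + v.arr .Q k 0) ∧
      findBestCode.time e κ v ≤ 20 + m ^ d * 25 := by
  set v1 := (Code.block [.op (.const .best 0), .op (.load .t .cost .src .zero),
    .op (.load .c .Q .zero .zero), .op (.add .bestVal .t .c)]).den e v with hv1
  have r1 : Ready d m L D v1 := hv.frame (Code.frame e _ v) (by decide)
  set body := Code.block [.op (.load .t .cost .src .j), .op (.load .c .Q .j .zero),
      .op (.add .t .t .c),
      .cond .t .bestVal (.block [.op (.copy .bestVal .t), .op (.copy .best .j)])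
        (.op (.const .c 0))] with hbody
  have hloop := Code.forLt_rule e (κ := κ) (c := .j) (b := .M) (P := body)
    (v := v1) (fun k w => w.reg .best < m ^ d ∧
      w.reg .bestVal = v.arr .cost (v.reg .src) (w.reg .best) + v.arr .Q (w.reg .best) 0 ∧
      ∀ j < k, w.reg .bestVal ≤ v.arr .cost (v.reg .src) j + v.arr .Q j 0) 22
    ⟨by simp [hv1, Code.block, Code.den, Op.den, Mem.set_reg, hM],
      by simp [hv1, Code.block, Code.den, Op.den, Mem.set_reg, hv.zero_eq], by simp⟩
    (by
      rintro k hk w hf hwk ⟨h1, h2, h3⟩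
      have hw := r1.frame hf (by decide)
      rw [r1.M_eq] at hk
      have hC : w.arr .cost = v.arr .cost := by rw [hf.arr .cost (by decide)]; rfl
      have hQ : w.arr .Q = v.arr .Q := by rw [hf.arr .Q (by decide)]; rfl
      have hs : w.reg .src = v.reg .src := by
        rw [hf.reg .src (by decide)]
        simp [hv1, Code.block, Code.den, Op.den, Mem.set_reg]
      by_cases hp : v.arr .cost (v.reg .src) k + v.arr .Q k 0 < w.reg .bestVal
      · constructor
        · have e1 : ((body.den e w).set .j (k + 1)).reg .best = k := by
            simp [hbody, Code.block, Code.den, Op.den, Mem.set_reg, hC, hQ, hs, hwk, hp,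
              hw.zero_eq]
          have e2 : ((body.den e w).set .j (k + 1)).reg .bestVal =
              v.arr .cost (v.reg .src) k + v.arr .Q k 0 := by
            simp [hbody, Code.block, Code.den, Op.den, Mem.set_reg, hC, hQ, hs, hwk, hp,
              hw.zero_eq]
          rw [e1, e2]
          refine ⟨hk, rfl, fun j hj => ?_⟩
          rcases Nat.lt_succ_iff_lt_or_eq.mp hj with hj | rfl
          · exact hp.le.trans (h3 j hj)
          · exact le_rfl
        · simp [hbody, Code.block, Code.den, Op.den, Code.time, Op.time, Op.instrs, Instr.cost,
            Mem.set_reg, addrInstrs, hw.zero_eq, hC, hQ, hs, hwk, hp]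
      · constructor
        · have e1 : ((body.den e w).set .j (k + 1)).reg .best = w.reg .best := by
            simp [hbody, Code.block, Code.den, Op.den, Mem.set_reg, hC, hQ, hs, hwk, hp,
              hw.zero_eq]
          have e2 : ((body.den e w).set .j (k + 1)).reg .bestVal = w.reg .bestVal := by
            simp [hbody, Code.block, Code.den, Op.den, Mem.set_reg, hC, hQ, hs, hwk, hp,
              hw.zero_eq]
          rw [e1, e2]
          refine ⟨h1, h2, fun j hj => ?_⟩
          rcases Nat.lt_succ_iff_lt_or_eq.mp hj with hj | rfl
          · exact h3 j hj
          · omega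
        · simp [hbody, Code.block, Code.den, Op.den, Code.time, Op.time, Op.instrs, Instr.cost,
            Mem.set_reg, addrInstrs, hw.zero_eq, hC, hQ, hs, hwk, hp])
  rw [r1.M_eq] at hloop
  obtain ⟨⟨h1, h2, h3⟩, h4⟩ := hloop
  have hden : findBestCode.den e v = (Code.forLt .j .M body).den e v1 := rfl
  rw [hden]
  refine ⟨h1, fun k hk => h2 ▸ h3 k hk, ?_⟩
  have : findBestCode.time e κ v = 18 + (Code.forLt .j .M body).time e κ v1 := by
    simp only [findBestCode, Code.block, Code.time, Op.time, Op.instrs, Instr.cost, List.map,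
      List.sum_cons, List.sum_nil, addrInstrs, List.map_append, List.sum_append]
    rw [← add_assoc, ← add_assoc, ← add_assoc]
    rfl
  rw [this]
  omega

theorem Code.move_spec {v : Mem} (hz : v.reg .zero = 0) (ho : v.reg .one = 1)
    (hG : 0 < v.arr .G (v.reg .own) (v.reg .best)) (hS : 0 < v.arr .S (v.reg .src) 0) :
    (∀ i j, (moveCode.den e v).arr .G i j +
      (if i = v.reg .own ∧ j = v.reg .best then 1 else 0) = v.arr .G i j) ∧
    (∀ i j, (moveCode.den e v).arr .H i j = v.arr .H i j +
      (if i = v.reg .src ∧ j = v.reg .best then 1 else 0)) ∧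
    (∀ i, (moveCode.den e v).arr .S i 0 + (if i = v.reg .src then 1 else 0) =
      v.arr .S i 0 + (if i = v.reg .own then 1 else 0)) ∧
    moveCode.time e κ v = 68 := by
  refine ⟨fun i j => ?_, fun i j => ?_, fun i => ?_, ?_⟩
  · simp only [moveCode, Code.block, Code.den, Op.den, Mem.setArr_arr, Mem.setArr_reg, Mem.set_reg,
      Mem.set_arr, ho]
    by_cases h : i = v.reg .own ∧ j = v.reg .best
    · obtain ⟨rfl, rfl⟩ := h
      simp
      omega
    · simp [h]
  · simp only [moveCode, Code.block, Code.den, Op.den, Mem.setArr_arr, Mem.setArr_reg, Mem.set_reg,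
      Mem.set_arr, ho]
    by_cases h : i = v.reg .src ∧ j = v.reg .best
    · obtain ⟨rfl, rfl⟩ := h
      simp
    · simp [h]
  · simp only [moveCode, Code.block, Code.den, Op.den, Mem.setArr_arr, Mem.setArr_reg, Mem.set_reg,
      Mem.set_arr, ho, hz]
    -- A supplier may replace its own stale unit by a fresh one (`src = own`); then both changes of
    -- `S` cancel.
    by_cases h : i = v.reg .src
    · by_cases h' : v.reg .src = v.reg .own
      · simp [h, h']
      · simp [h, h']
        omega
    · simp [h]
      split <;> simp_all
  · simp [moveCode, Code.block, Code.time, Op.time, Op.instrs, Instr.cost, addrInstrs]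

theorem Code.raise_spec {m L D : ℕ} {v : Mem} (hv : Ready d m L D v) :
    (∀ i < m ^ d, ∀ j, (raiseCode.den e v).arr .G i j =
      if j = v.reg .best then v.arr .H i j else v.arr .G i j) ∧
    (∀ j, (raiseCode.den e v).arr .G (m ^ d) j = v.arr .G (m ^ d) j) ∧
    (∀ i < m ^ d, ∀ j, (raiseCode.den e v).arr .H i j =
      if j = v.reg .best then 0 else v.arr .H i j) ∧
    (∀ j, (raiseCode.den e v).arr .H (m ^ d) j = v.arr .H (m ^ d) j) ∧
    (∀ j, (raiseCode.den e v).arr .Q j 0 = v.arr .Q j 0 + if j = v.reg .best then 1 else 0) ∧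
    raiseCode.time e κ v ≤ 19 + m ^ d * 27 := by
  set v1 := (Code.block [.op (.load .t .Q .best .zero), .op (.add .t .t .one),
    .op (.store .Q .best .zero .t)]).den e v with hv1
  have r1 : Ready d m L D v1 := hv.frame (Code.frame e _ v) (by decide)
  have b1 : v1.reg .best = v.reg .best := by
    simp [hv1, Code.block, Code.den, Op.den, Mem.set_reg]
  have G1 : v1.arr .G = v.arr .G := by
    funext i j; simp [hv1, Code.block, Code.den, Op.den, Mem.setArr_arr]
  have H1 : v1.arr .H = v.arr .H := by
    funext i j; simp [hv1, Code.block, Code.den, Op.den, Mem.setArr_arr]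
  have Q1 : ∀ j, v1.arr .Q j 0 = v.arr .Q j 0 + if j = v.reg .best then 1 else 0 := by
    intro j
    by_cases h : j = v.reg .best <;>
      simp [hv1, Code.block, Code.den, Op.den, Mem.setArr_arr, Mem.set_reg, h, hv.zero_eq,
        hv.one_eq]
  set body := Code.block [.op (.load .t .H .i .best), .op (.store .G .i .best .t),
      .op (.store .H .i .best .zero)] with hbody
  have hloop := Code.forLt_rule e (κ := κ) (c := .i) (b := .M) (P := body)
    (v := v1) (fun k w =>
      (∀ i j, w.arr .G i j = if i < k ∧ j = v.reg .best then v.arr .H i j else v.arr .G i j) ∧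
      (∀ i j, w.arr .H i j = if i < k ∧ j = v.reg .best then 0 else v.arr .H i j)) 24
    ⟨by simp [G1], by simp [H1]⟩
    (by
      rintro k hk w hf hwk ⟨h1, h2⟩
      have hw := r1.frame hf (by decide)
      have hb : w.reg .best = v.reg .best := by rw [hf.reg .best (by decide), b1]
      refine ⟨⟨fun i j => ?_, fun i j => ?_⟩, ?_⟩
      · simp [hbody, Code.block, Code.den, Op.den, Mem.setArr_arr, Mem.set_reg, hb, hwk, h2]
        by_cases hik : i = k
        · subst hik
          by_cases hj : j = v.reg .best
          · simp [hj]
          · simp [hj, h1]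
        · have : i ≤ k ↔ i < k := by omega
          simp [hik, h1, this]
      · simp [hbody, Code.block, Code.den, Op.den, Mem.setArr_arr, Mem.set_reg, hb, hwk,
          hw.zero_eq]
        by_cases hik : i = k
        · subst hik
          by_cases hj : j = v.reg .best
          · simp [hj]
          · simp [hj, h2]
        · have : i ≤ k ↔ i < k := by omega
          simp [hik, h2, this]
      · simp [hbody, Code.block, Code.time, Op.time, Op.instrs, Instr.cost, addrInstrs])
  have hfr := (Code.forLt .i .M body).frame e v1
  rw [r1.M_eq] at hloop
  obtain ⟨⟨h1, h2⟩, h3⟩ := hloop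
  have hden : raiseCode.den e v = (Code.forLt .i .M body).den e v1 := rfl
  rw [hden]
  refine ⟨fun i hi j => ?_, fun j => ?_, fun i hi j => ?_, fun j => ?_, fun j => ?_, ?_⟩
  · rw [h1]; simp [hi]
  · rw [h1]; simp
  · rw [h2]; simp [hi]
  · rw [h2]; simp
  · rw [hfr.arr .Q (by decide), Q1]
  · have : raiseCode.time e κ v = 17 + (Code.forLt .i .M body).time e κ v1 := by
      simp only [raiseCode, Code.block, Code.time, Op.time, Op.instrs, Instr.cost, List.map,
        List.sum_cons, List.sum_nil, addrInstrs, List.map_append, List.sum_append]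
      rw [← add_assoc, ← add_assoc]
      rfl
    rw [this]
    omega

end Spec

/-! ### The auction as a whole, and the output -/

section Spec

variable {d n : ℕ} (e : Env d n) (κ : ℕ)

/-- The invariants of the auction hold for a memory state. -/
def Mem.Auction (M B : ℕ) (a b : ℕ → ℕ) (v : Mem) : Prop :=
  AuctionInv M B (v.arr .cost) a b (fun i => v.arr .S i 0) (fun j => v.arr .Q j 0) (v.arr .G)
    (v.arr .H)

/-- The number of steps of the auction made so far. -/
def Mem.pot (M : ℕ) (b : ℕ → ℕ) (v : Mem) : ℕ :=
  auctionPot M b (fun j => v.arr .Q j 0) (v.arr .H)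

/-- A round either finds no supply and stays idle, or performs a move or a price rise. Both of these
increase the potential by exactly 1, so the potential counts the active rounds. -/
theorem Code.auctionStep_spec {m L D B : ℕ} {a b : ℕ → ℕ} {v : Mem} (hv : Ready d m L D v)
    (hM : 0 < m ^ d) (hC : ∀ i < m ^ d, ∀ j < m ^ d, v.arr .cost i j ≤ B)
    (hab : ∑ i ∈ Finset.range (m ^ d), a i < ∑ j ∈ Finset.range (m ^ d), b j)
    (h : v.Auction (m ^ d) B a b) {P : Code}
    (hP : P = .block [findSupplierCode, .cond .src .M
      (.block [findBestCode, findOwnerCode, .cond .own .M' moveCode raiseCode])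
      (.op (.const .c 0))]) :
    (P.den e v).Auction (m ^ d) B a b ∧
      (((∀ i < m ^ d, v.arr .S i 0 = 0) ∧ ∀ i < m ^ d, (P.den e v).arr .S i 0 = 0) ∨
        ((∃ i < m ^ d, 0 < v.arr .S i 0) ∧ (P.den e v).pot (m ^ d) b = v.pot (m ^ d) b + 1)) ∧
      P.time e κ v ≤ 132 + m ^ d * 80 := by
  obtain ⟨h1, h2⟩ := Code.findSupplier_spec e κ hv
  have hf1 := findSupplierCode.frame e v
  have r1 := hv.frame hf1 (by decide)
  have A1 : ∀ A, (findSupplierCode.den e v).arr A = v.arr A := fun A => hf1.arr A (by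
    cases A <;> decide)
  set v1 := findSupplierCode.den e v with hv1
  have ht : P.time e κ v = findSupplierCode.time e κ v + ((if v1.reg .src < v1.reg .M then
      (Code.block [findBestCode, findOwnerCode, .cond .own .M' moveCode raiseCode]).time e κ v1
      else 1) + 1) := by rw [hP]; rfl
  rcases h1 with ⟨hsrc, hS⟩ | ⟨hsrc, hS⟩
  · obtain ⟨b1, b2, b3⟩ := Code.findBest_spec e κ r1 hM
    have hf2 := findBestCode.frame e v1
    have r2 := r1.frame hf2 (by decide)
    have A2 : ∀ A, (findBestCode.den e v1).arr A = v.arr A := fun A => by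
      rw [hf2.arr A (by cases A <;> decide), A1]
    have s2 := hf2.reg .src (by decide)
    set v2 := findBestCode.den e v1 with hv2
    obtain ⟨c1, c2⟩ := Code.findOwner_spec e κ r2
    have hf3 := findOwnerCode.frame e v2
    have r3 := r2.frame hf3 (by decide)
    have A3 : ∀ A, (findOwnerCode.den e v2).arr A = v.arr A := fun A => by
      rw [hf3.arr A (by cases A <;> decide), A2]
    have s3 := hf3.reg .src (by decide)
    have t3 := hf3.reg .best (by decide)
    set v3 := findOwnerCode.den e v2 with hv3
    have hcond : v1.reg .src < v1.reg .M := by rw [r1.M_eq]; exact hsrc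
    have hden : P.den e v = (Code.cond .own .M' moveCode raiseCode).den e v3 := by
      rw [hP]
      change (if v1.reg .src < v1.reg .M then _ else _) = _
      rw [if_pos hcond]
      rfl
    have ht2 : (Code.block [findBestCode, findOwnerCode,
        .cond .own .M' moveCode raiseCode]).time e κ v1 = findBestCode.time e κ v1 +
        (findOwnerCode.time e κ v2 + ((if v3.reg .own < v3.reg .M' then moveCode.time e κ v3 else
          raiseCode.time e κ v3) + 1)) := rfl
    rw [if_pos hcond, ht2] at ht
    rw [hden]
    simp only [Code.den]
    have hmin : ∀ k < m ^ d, v.arr .cost (v3.reg .src) (v3.reg .best) +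
        v.arr .Q (v3.reg .best) 0 ≤ v.arr .cost (v3.reg .src) k + v.arr .Q k 0 := by
      intro k hk
      rw [s3, s2, t3]
      simpa only [A1] using b2 k hk
    have hsrc3 : v3.reg .src < m ^ d := by rw [s3, s2]; exact hsrc
    have hbest3 : v3.reg .best < m ^ d := by rw [t3]; exact b1
    rw [← t3] at c1
    simp only [A2] at c1
    rcases c1 with ⟨hown, hG⟩ | ⟨hown, hG⟩
    · have hlt : v3.reg .own < v3.reg .M' := by rw [r3.M'_eq]; exact hown
      rw [if_pos hlt] at ht ⊢
      obtain ⟨g1, g2, g3, g4⟩ := Code.move_spec e κ r3.zero_eq r3.one_eq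
        (by rw [A3]; exact hG) (by rw [A3, s3, s2]; exact hS)
      have hf4 := moveCode.frame e v3
      have C4 : (moveCode.den e v3).arr .cost = v.arr .cost := by
        rw [hf4.arr .cost (by decide), A3]
      have Q4 : (moveCode.den e v3).arr .Q = v.arr .Q := by
        rw [hf4.arr .Q (by decide), A3]
      simp only [A3] at g1 g2 g3
      have := AuctionInv.move h hsrc3 hbest3 hown hmin hG (fun i _ j _ => g1 i j)
        (fun i _ j _ => g2 i j) (S' := fun i => (moveCode.den e v3).arr .S i 0)
        (fun i _ => g3 i)
      refine ⟨?_, Or.inr ⟨⟨_, hsrc, hS⟩, ?_⟩, ?_⟩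
      · simp only [Mem.Auction, C4, Q4]
        exact this.1
      · simp only [Mem.pot, Q4]
        exact this.2
      · omega
    · have hlt : ¬ v3.reg .own < v3.reg .M' := by rw [r3.M'_eq, hown]; exact lt_irrefl _
      rw [if_neg hlt] at ht ⊢
      obtain ⟨g1, g2, g3, g4, g5, g6⟩ := Code.raise_spec e κ r3
      have hf4 := raiseCode.frame e v3
      have C4 : (raiseCode.den e v3).arr .cost = v.arr .cost := by
        rw [hf4.arr .cost (by decide), A3]
      have S4 : (raiseCode.den e v3).arr .S = v.arr .S := by
        rw [hf4.arr .S (by decide), A3]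
      simp only [A3] at g1 g2 g3 g4 g5
      have := AuctionInv.raise h hC hab hsrc3 hbest3 hmin hG
        (G' := (raiseCode.den e v3).arr .G) (H' := (raiseCode.den e v3).arr .H)
        (Q' := fun j => (raiseCode.den e v3).arr .Q j 0)
        (fun i hi j hj => by
          rcases Nat.lt_succ_iff_lt_or_eq.mp hi with hi | rfl
          · exact g1 i hi j
          -- The program does not update row `M` when a price rises. It need not: there are no fresh
          -- units in that row, and no stale ones of `best`.
          · rw [g2]
            split
            · rename_i hj'
              rw [h.unsold_fresh j hj, hj', hG _ (by omega)]
            · rfl)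
        (fun i hi j hj => by
          rcases Nat.lt_succ_iff_lt_or_eq.mp hi with hi | rfl
          · exact g3 i hi j
          · rw [g4, h.unsold_fresh j hj, ite_self])
        (fun j _ => g5 j)
      refine ⟨?_, Or.inr ⟨⟨_, hsrc, hS⟩, ?_⟩, ?_⟩
      · simp only [Mem.Auction, C4, S4]
        exact this.1
      · exact this.2
      · omega
  · have hcond : ¬ v1.reg .src < v1.reg .M := by rw [r1.M_eq, hsrc]; exact lt_irrefl _
    have hden : P.den e v = v1.set .c 0 := by
      rw [hP]
      change (if v1.reg .src < v1.reg .M then _ else _) = _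
      rw [if_neg hcond]
      rfl
    rw [if_neg hcond] at ht
    rw [hden]
    refine ⟨?_, Or.inl ⟨hS, ?_⟩, ?_⟩
    · simp only [Mem.Auction, Mem.set_arr, A1]
      exact h
    · simpa only [Mem.set_arr, A1] using hS
    · omega

/-- If some supply were left at the end, every round would have been active, and the potential would
have reached the number of rounds, contradicting `AuctionInv.pot_lt`. -/
theorem Code.auction_spec {m L D : ℕ} {a b : ℕ → ℕ} {v : Mem} (hv : Ready d m L D v)
    (hM : 0 < m ^ d) (hC : ∀ i < m ^ d, ∀ j < m ^ d, v.arr .cost i j ≤ D * L)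
    (hab : ∑ i ∈ Finset.range (m ^ d), a i < ∑ j ∈ Finset.range (m ^ d), b j)
    (hb : ∑ j ∈ Finset.range (m ^ d), (b j + 1) ≤ m ^ d + m ^ d + m ^ d * L)
    (h : v.Auction (m ^ d) (D * L) a b) :
    Ready d m L D (auctionCode.den e v) ∧
      (auctionCode.den e v).Auction (m ^ d) (D * L) a b ∧
      (∀ i < m ^ d, (auctionCode.den e v).arr .S i 0 = 0) ∧
      (auctionCode.den e v).arr .cost = v.arr .cost ∧
      auctionCode.time e κ v ≤
        2 + (D * L + 2) * (m ^ d + m ^ d + m ^ d * L) * (135 + m ^ d * 80) := by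
  have hfr := auctionCode.frame e v
  have hloop := Code.forLt_rule e (κ := κ) (c := .k) (b := .steps)
    (P := .block [findSupplierCode, .cond .src .M
      (.block [findBestCode, findOwnerCode, .cond .own .M' moveCode raiseCode])
      (.op (.const .c 0))])
    (v := v) (fun k w => w.Auction (m ^ d) (D * L) a b ∧
      ((∀ i < m ^ d, w.arr .S i 0 = 0) ∨ k ≤ w.pot (m ^ d) b)) (132 + m ^ d * 80)
    ⟨h, Or.inr (Nat.zero_le _)⟩
    (by
      rintro k - w hf - ⟨h1, h2⟩
      have hw := hv.frame hf (by decide)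
      obtain ⟨g1, g2, g3⟩ := Code.auctionStep_spec e κ hw hM
        (by rw [hf.arr .cost (by decide)]; exact hC) hab h1 rfl
      refine ⟨⟨g1, ?_⟩, g3⟩
      rcases g2 with g2 | g2
      · exact Or.inl g2.2
      · rcases h2 with h2 | h2
        · obtain ⟨⟨i, hi, hp⟩, -⟩ := g2
          exact absurd (h2 i hi) hp.ne'
        · right
          exact (Nat.succ_le_succ h2).trans g2.2.ge)
  rw [hv.steps_eq] at hloop
  obtain ⟨⟨h1, h2⟩, h3⟩ := hloop
  refine ⟨hv.frame hfr (by decide), h1, ?_, hfr.arr .cost (by decide), ?_⟩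
  · refine h2.resolve_right fun h4 => ?_
    have h5 := AuctionInv.pot_lt h1 hM
    have h6 := Nat.mul_le_mul_left (D * L + 2) hb
    exact absurd (h4.trans_lt h5) (not_lt.mpr h6)
  · refine h3.trans (le_of_eq ?_)
    ring

theorem Code.total_spec {m L D : ℕ} (p : ℝ) {v : Mem} (hv : Ready d m L D v) {tot : ℕ}
    (htot : tot = ∑ i ∈ Finset.range (m ^ d), ∑ j ∈ Finset.range (m ^ d),
      (v.arr .G i j + v.arr .H i j) * v.arr .cost i j) :
    ((totalCode p).den e v).x = (if 0 < tot then
        Real.exp (Real.log ((tot : ℝ) / ((m ^ d * L * L : ℕ) : ℝ)) * (1 / p)) else 0) ∧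
      (totalCode p).time e κ v ≤ 12 + m ^ d * (5 + m ^ d * 30) := by
  set v1 := v.set .tot 0 with hv1
  have r1 : Ready d m L D v1 := hv.frame (frame_set (R := [.tot]) (As := []) v 0 (by simp))
    (by decide)
  set body := Code.block [.op (.load .t .G .i .j), .op (.load .c .H .i .j),
      .op (.add .t .t .c), .op (.load .c .cost .i .j), .op (.mul .t .t .c),
      .op (.add .tot .tot .t)] with hbody
  have hloop := Code.forLt_rule e (κ := κ) (c := .i) (b := .M) (P := .forLt .j .M body)
    (v := v1) (fun k w => w.reg .tot = ∑ i ∈ Finset.range k, ∑ j ∈ Finset.range (m ^ d),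
      (v.arr .G i j + v.arr .H i j) * v.arr .cost i j) (2 + m ^ d * 30)
    (by simp [hv1, Mem.set_reg])
    (by
      rintro k hk w hf hwk h1
      have hw := r1.frame hf (by decide)
      have hin := Code.forLt_rule e (κ := κ) (c := .j) (b := .M) (P := body) (v := w)
        (fun l u => u.reg .tot = ∑ i ∈ Finset.range k, ∑ j ∈ Finset.range (m ^ d),
          (v.arr .G i j + v.arr .H i j) * v.arr .cost i j +
          ∑ j ∈ Finset.range l, (v.arr .G k j + v.arr .H k j) * v.arr .cost k j) 27
        (by simpa [Mem.set_reg] using h1)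
        (by
          rintro l hl u hfu hul h2
          have iu : u.reg .i = k := by rw [hfu.reg .i (by decide), hwk]
          have Gu : ∀ A, u.arr A = v.arr A := fun A => by
            rw [hfu.arr A (by cases A <;> decide), hf.arr A (by cases A <;> decide)]; rfl
          constructor
          · simp [hbody, Code.block, Code.den, Op.den, Mem.set_reg, h2, iu, hul, Gu,
              Finset.sum_range_succ, add_assoc]
          · simp [hbody, Code.block, Code.time, Op.time, Op.instrs, Instr.cost, addrInstrs])
      rw [hw.M_eq] at hin
      refine ⟨?_, hin.2⟩
      rw [Mem.set_reg_of_ne _ _ (by decide), hin.1, Finset.sum_range_succ])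
  rw [r1.M_eq] at hloop
  have hfr := (Code.forLt .i .M (.forLt .j .M body)).frame e v1
  set v2 := (Code.forLt .i .M (.forLt .j .M body)).den e v1 with hv2
  have r2 : Ready d m L D v2 := r1.frame hfr (by decide)
  obtain ⟨h1, h2⟩ := hloop
  rw [← htot] at h1
  set tail := Code.cond .zero .tot
      (.block [.op (.xOfNat .tot), .op (.yOfNat .N), .op .xDiv, .op .xLog, .op (.yConst (1 / p)),
        .op .xMul, .op .xExp])
      (.op (.xConst 0)) with htail
  have hden : (totalCode p).den e v = tail.den e v2 := rfl
  have ht : (totalCode p).time e κ v = 1 + ((Code.forLt .i .M (.forLt .j .M body)).time e κ v1 +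
      tail.time e κ v2) := rfl
  rw [hden, ht]
  by_cases hp : 0 < tot
  · constructor
    · simp [htail, Code.block, Code.den, Op.den, r2.zero_eq, h1, hp, r2.N_eq]
    · have : tail.time e κ v2 = 8 := by
        simp [htail, Code.block, Code.time, Op.time, Op.instrs, Instr.cost, r2.zero_eq, h1, hp]
      rw [this]
      have : m ^ d * (2 + m ^ d * 30 + 3) = m ^ d * (5 + m ^ d * 30) := by ring
      omega
  · constructor
    · simp [htail, Code.block, Code.den, Op.den, r2.zero_eq, h1, hp]
    · have : tail.time e κ v2 = 2 := by
        simp [htail, Code.time, Op.time, Op.instrs, Instr.cost, r2.zero_eq, h1, hp]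
      rw [this]
      have : m ^ d * (2 + m ^ d * 30 + 3) = m ^ d * (5 + m ^ d * 30) := by ring
      omega

end Spec

/-! ### Cells -/

theorem ceil_mul_sub_one_lt {x : ℝ} (hx : x ≤ 1) {m : ℕ} (hm : 0 < m) : ⌈x * m⌉₊ - 1 < m := by
  have : ⌈x * m⌉₊ ≤ m := Nat.ceil_le.mpr (mul_le_of_le_one_left (Nat.cast_nonneg m) hx)
  omega

theorem cellNum_lt {m d : ℕ} (hm : 0 < m) {x : ℕ → ℝ} (hx : ∀ l < d, x l ≤ 1) :
    cellNum m d x < m ^ d := by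
  induction d with
  | zero => simp [cellNum]
  | succ d ih =>
    have h1 := ih fun l hl => hx l (by omega)
    have h2 := ceil_mul_sub_one_lt (hx d (by omega)) hm
    rw [cellNum, Finset.sum_range_succ, ← cellNum, pow_succ]
    nlinarith

/-- The number of a cell is written in base `m`. A new leading digit contributes a multiple of `m ^
(l + 1)` and does not affect digit `l`. -/
theorem cellDigit_cellNum {m d : ℕ} (hm : 0 < m) {x : ℕ → ℝ} (hx : ∀ l < d, x l ≤ 1) {l : ℕ}
    (hl : l < d) : cellDigit m (cellNum m d x) l = ⌈x l * m⌉₊ - 1 := by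
  induction d with
  | zero => omega
  | succ d ih =>
    have h0 : ∀ l < d, x l ≤ 1 := fun l hl => hx l (by omega)
    rw [cellNum, Finset.sum_range_succ, ← cellNum]
    rcases Nat.lt_succ_iff_lt_or_eq.mp hl with hl | rfl
    · rw [← ih h0 hl, cellDigit, cellDigit]
      obtain ⟨r, rfl⟩ : ∃ r, d = l + 1 + r := ⟨d - (l + 1), by omega⟩
      have : cellNum m (l + 1 + r) x + (⌈x (l + 1 + r) * m⌉₊ - 1) * m ^ (l + 1 + r) =
          cellNum m (l + 1 + r) x + m ^ l * (m * (m ^ r * (⌈x (l + 1 + r) * m⌉₊ - 1))) := by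
        ring
      rw [this, Nat.add_mul_div_left _ _ (pow_pos hm l), Nat.add_mul_mod_self_left]
    · rw [cellDigit, Nat.add_mul_div_right _ _ (pow_pos hm l),
        Nat.div_eq_of_lt (cellNum_lt hm h0), zero_add,
        Nat.mod_eq_of_lt (ceil_mul_sub_one_lt (hx l (by omega)) hm)]

/-- The cell of a point of the cube. -/
def cellOf {d : ℕ} (m : ℕ) (x : Cube d) : ℕ :=
  cellNum m d fun l => if h : l < d then x.1 ⟨l, h⟩ else 0

theorem cellOf_lt {d m : ℕ} (hm : 0 < m) (x : Cube d) : cellOf m x < m ^ d :=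
  cellNum_lt hm fun l hl => by simpa [hl] using (x.2 ⟨l, hl⟩).2

theorem cellCount_eq {d : ℕ} (m : ℕ) (f : ℕ → Cube d) (N i : ℕ) :
    cellCount m f N i = ((Finset.range N).filter fun k => cellOf m (f k) = i).card := rfl

theorem cellCount_le {d : ℕ} (m : ℕ) (f : ℕ → Cube d) (N i : ℕ) : cellCount m f N i ≤ N :=
  (Finset.card_filter_le _ _).trans (by simp)

theorem sum_cellCount {d m : ℕ} (hm : 0 < m) (f : ℕ → Cube d) (N : ℕ) :
    ∑ i ∈ Finset.range (m ^ d), cellCount m f N i = N := by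
  simp only [cellCount_eq]
  rw [← Finset.card_eq_sum_card_fiberwise]
  · simp
  · intro k _
    simpa using cellOf_lt hm (f k)

theorem sum_div_le {ι : Type*} (s : Finset ι) (c : ι → ℕ) (L : ℕ) :
    (∑ i ∈ s, c i / L) * L ≤ ∑ i ∈ s, c i := by
  rw [Finset.sum_mul]
  exact Finset.sum_le_sum fun i _ => Nat.div_mul_le_self _ _

/-- Each `c i` is strictly below `(c i / L + 1) * L`; the gain of 1 per index makes the demand
exceed the supply. -/
theorem sum_le_sum_div {ι : Type*} (s : Finset ι) (c : ι → ℕ) {L : ℕ} (hL : 0 < L) :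
    ∑ i ∈ s, c i + s.card ≤ (∑ i ∈ s, (c i / L + 1)) * L := by
  rw [Finset.card_eq_sum_ones, ← Finset.sum_add_distrib, Finset.sum_mul]
  refine Finset.sum_le_sum fun i _ => ?_
  have := Nat.lt_mul_of_div_lt (Nat.lt_succ_self (c i / L)) hL
  exact this

/-! ### The outcome of the program -/

/-- A bound for the running time. -/
def mainTime (d D m L κ : ℕ) : ℕ :=
  (40 + 4 * d + 4 * m + 4 * L) +
    ((2 + m ^ d * L * L * (2 * κ + 47 + 2 * (d * (15 + 4 * m)))) +
    ((2 + m ^ d * (60 + 8 * (m ^ d * L))) + ((2 + m ^ d * (7 + d * (27 + 4 * m ^ d))) +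
    ((2 + m ^ d * (5 + m ^ d * (28 + 24 * d + 4 * (D * L)))) +
    ((2 + (D * L + 2) * (m ^ d + m ^ d + m ^ d * L) * (135 + m ^ d * 80)) +
    (12 + m ^ d * (5 + m ^ d * 30)))))))

/-- `F` is a plan that is almost optimal, and `q` are prices that show this. -/
structure PlanCertificate (M B : ℕ) (C : ℕ → ℕ → ℕ) (a b : ℕ → ℕ) (F : ℕ → ℕ → ℕ)
    (q : ℕ → ℕ) : Prop where
  row : ∀ i < M, ∑ j ∈ Finset.range M, F i j = a i
  col : ∀ j < M, ∑ i ∈ Finset.range M, F i j ≤ b j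
  slack : ∀ i < M, ∀ j < M, 0 < F i j → ∀ k < M, C i j + q j ≤ C i k + q k + 1
  price : ∀ j < M, q j ≤ B + 1

/-- All that the analysis needs to know about the run: the output is the normalized cost of some
certified plan, to the power `1 / p`. Which plan the auction finds is irrelevant. -/
theorem Code.main_spec {d n : ℕ} (e : Env d n) (κ : ℕ) (hn : 0 < n) {p γ : ℝ} (hp : 0 < p) {D m L : ℕ}
    (hm : m = ⌈(n : ℝ) ^ (γ / d)⌉₊) (hL : L = ⌈(n : ℝ) ^ (γ * p / d)⌉₊)
    (hC : ∀ i < m ^ d, ∀ j < m ^ d, cellCost m L d p i j ≤ D * L) :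
    (∃ F q, PlanCertificate (m ^ d) (D * L) (cellCost m L d p)
        (fun i => cellCount m e.refDraw (m ^ d * L * L) i / L)
        (fun j => cellCount m e.estDraw (m ^ d * L * L) j / L + 1) F q ∧
      ((mainCode d p γ D).den e .zero).x = (((∑ i ∈ Finset.range (m ^ d),
        ∑ j ∈ Finset.range (m ^ d), F i j * cellCost m L d p i j : ℕ) : ℝ) /
          ((m ^ d * L * L : ℕ) : ℝ)) ^ (1 / p)) ∧
      (mainCode d p γ D).time e κ .zero ≤ mainTime d D m L κ := by
  have hn' : (0 : ℝ) < n := by exact_mod_cast hn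
  have hm0 : 0 < m := by rw [hm]; exact Nat.ceil_pos.mpr (Real.rpow_pos_of_pos hn' _)
  have hL0 : 0 < L := by rw [hL]; exact Nat.ceil_pos.mpr (Real.rpow_pos_of_pos hn' _)
  have hM0 : 0 < m ^ d := pow_pos hm0 d
  set N := m ^ d * L * L with hN
  obtain ⟨r1, a1, b1, c1, t1⟩ := Code.setup_spec e κ hn p γ D
  rw [← hm, ← hL] at r1 t1
  set v1 := (setupCode d p γ D).den e .zero with hv1
  obtain ⟨r2, A2, B2, f2, t2⟩ := Code.collect_spec e κ r1 (by simp [a1, Mem.zero])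
    (by simp [a1, Mem.zero]) b1 c1
  set v2 := collectCode.den e v1 with hv2
  obtain ⟨r3, S3, G3, H3, f3, t3⟩ := Code.units_spec e κ r2 hL0 A2 B2
    (fun i => cellCount_le _ _ _ _) (fun i => cellCount_le _ _ _ _)
    (by simp [f2, a1, Mem.zero])
  set v3 := unitsCode.den e v2 with hv3
  obtain ⟨r4, d4, f4, t4⟩ := Code.digits_spec e κ r3 hm0
  set v4 := digitsCode.den e v3 with hv4
  obtain ⟨r5, C5, f5, t5⟩ := Code.costs_spec e κ r4 d4 hC
  set v5 := (costsCode p).den e v4 with hv5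
  set a : ℕ → ℕ := fun i => cellCount m e.refDraw N i / L with ha
  set b : ℕ → ℕ := fun j => cellCount m e.estDraw N j / L + 1 with hb
  have hsa : (∑ i ∈ Finset.range (m ^ d), a i) * L ≤ N := by
    have := sum_div_le (Finset.range (m ^ d)) (cellCount m e.refDraw N) L
    rwa [sum_cellCount hm0] at this
  have hsb : N + m ^ d ≤ (∑ i ∈ Finset.range (m ^ d), b i) * L := by
    have := sum_le_sum_div (Finset.range (m ^ d)) (cellCount m e.estDraw N) hL0
    rwa [sum_cellCount hm0, Finset.card_range] at this
  -- `(∑ a) L ≤ N < N + M ≤ (∑ b) L`.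
  have hab : ∑ i ∈ Finset.range (m ^ d), a i < ∑ j ∈ Finset.range (m ^ d), b j := by
    by_contra! hcon
    have := Nat.mul_le_mul_right L hcon
    omega
  have hb2 : ∑ j ∈ Finset.range (m ^ d), (b j + 1) ≤ m ^ d + m ^ d + m ^ d * L := by
    have h1 := sum_div_le (Finset.range (m ^ d)) (cellCount m e.estDraw N) L
    rw [sum_cellCount hm0] at h1
    have h2 := Nat.le_of_mul_le_mul_right h1 hL0
    simp only [hb, Finset.sum_add_distrib, Finset.sum_const, Finset.card_range, smul_eq_mul,
      mul_one]
    omega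
  have arr5 : ∀ A, A ≠ .A → A ≠ .B → A ≠ .S → A ≠ .G → A ≠ .digit → A ≠ .cost →
      v5.arr A = fun _ _ => 0 := by
    intro A h1 h2 h3 h4 h5 h6
    rw [f5 A h6, f4 A h5, f3 A h3 h4, f2 A h1 h2, a1]; rfl
  have hinv : v5.Auction (m ^ d) (D * L) a b := by
    refine AuctionInv.init (fun j hj => ?_) (fun i hi j hj => ?_) (fun i j => ?_) (fun j => ?_)
      (fun i hi => ?_)
    · rw [f5 .G (by decide), f4 .G (by decide)]; exact G3 j hj
    · rw [f5 .G (by decide), f4 .G (by decide)]; exact H3 i hi j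
    · rw [arr5] <;> decide
    · rw [arr5] <;> decide
    · rw [f5 .S (by decide), f4 .S (by decide)]; exact S3 i hi
  obtain ⟨r6, i6, s6, c6, t6⟩ := Code.auction_spec e κ r5 hM0
    (fun i hi j hj => by rw [C5 i hi j hj]; exact hC i hi j hj) hab hb2 hinv
  set v6 := auctionCode.den e v5 with hv6
  obtain ⟨x7, t7⟩ := Code.total_spec e κ p r6 rfl
  have C6 : ∀ i < m ^ d, ∀ j < m ^ d, v6.arr .cost i j = cellCost m L d p i j := by
    intro i hi j hj
    rw [c6, C5 i hi j hj]
  -- The plan consists of the stale and the fresh units in the rows of suppliers. Leaving out row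
  -- `M` makes the column condition an inequality.
  refine ⟨⟨fun i j => v6.arr .G i j + v6.arr .H i j, fun j => v6.arr .Q j 0, ?_, ?_⟩, ?_⟩
  · refine ⟨fun i hi => ?_, fun j hj => ?_, fun i hi j hj hp k hk => ?_, i6.price_le⟩
    · have := i6.supply i hi
      simp only [s6 i hi, add_zero] at this
      exact this
    · rw [← i6.demand j hj, Finset.sum_range_succ]
      exact Nat.le_add_right _ _
    · rw [← C6 i hi j hj, ← C6 i hi k hk]
      rcases Nat.eq_zero_or_pos (v6.arr .H i j) with h | h
      · exact i6.stale i hi j hj (by omega) k hk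
      · exact (i6.fresh i hi j hj h k hk).trans (Nat.le_succ _)
  · have hden : (mainCode d p γ D).den e .zero = (totalCode p).den e v6 := by
      simp only [mainCode, Code.block, Code.den, ← hv1, ← hv2, ← hv3, ← hv4, ← hv5, ← hv6]
    rw [hden, x7]
    have hsum : ∑ i ∈ Finset.range (m ^ d), ∑ j ∈ Finset.range (m ^ d),
        (v6.arr .G i j + v6.arr .H i j) * v6.arr .cost i j = ∑ i ∈ Finset.range (m ^ d),
        ∑ j ∈ Finset.range (m ^ d), (v6.arr .G i j + v6.arr .H i j) * cellCost m L d p i j :=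
      Finset.sum_congr rfl fun i hi => Finset.sum_congr rfl fun j hj => by
        rw [C6 i (Finset.mem_range.mp hi) j (Finset.mem_range.mp hj)]
    rw [hsum]
    split
    · rename_i hpos
      rw [Real.rpow_def_of_pos]
      have h1 : 0 < m ^ d * L * L := by positivity
      have h2 : (0 : ℝ) < ((m ^ d * L * L : ℕ) : ℝ) := by exact_mod_cast h1
      exact div_pos (by exact_mod_cast hpos) h2
    · rename_i hpos
      rw [Nat.eq_zero_of_not_pos hpos]
      simp [hp.ne']
  · have : (mainCode d p γ D).time e κ .zero = (setupCode d p γ D).time e κ .zero +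
        (collectCode.time e κ v1 + (unitsCode.time e κ v2 + (digitsCode.time e κ v3 +
          ((costsCode p).time e κ v4 + (auctionCode.time e κ v5 +
            (totalCode p).time e κ v6))))) := by
      simp only [mainCode, Code.block, Code.time, ← hv1, ← hv2, ← hv3, ← hv4, ← hv5, ← hv6]
    rw [this]
    exact add_le_add t1 (add_le_add t2 (add_le_add t3 (add_le_add t4 (add_le_add t5
      (add_le_add t6 t7)))))

/-! ### Transport between finite distributions -/

/-- `P` is a transport plan from `ρ` to `ν`. -/
structure IsPlan {ι : Type*} [Fintype ι] (P : ι → ι → ℝ) (ρ ν : ι → ℝ) : Prop where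
  nonneg : ∀ i j, 0 ≤ P i j
  row : ∀ i, ∑ j, P i j = ρ i
  col : ∀ j, ∑ i, P i j = ν j

section Finite

variable {ι : Type*} [Fintype ι]

theorem mul_min_one_div_le {r ρ : ℝ} (hr : 0 ≤ r) (hρ : 0 ≤ ρ) : r * min 1 (ρ / r) ≤ ρ := by
  rcases hr.eq_or_lt with rfl | hr
  · simpa using hρ
  · calc r * min 1 (ρ / r) ≤ r * (ρ / r) := by gcongr; exact min_le_right _ _
      _ = ρ := by field_simp

theorem mul_one_sub_min_le {r ρ : ℝ} (hr : 0 ≤ r) :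
    r * (1 - min 1 (ρ / r)) ≤ |r - ρ| := by
  rcases hr.eq_or_lt with rfl | hr
  · simp
  · rcases le_total 1 (ρ / r) with h | h
    · simp [min_eq_left h]
    · rw [min_eq_right h]
      calc r * (1 - ρ / r) = r - ρ := by field_simp
        _ ≤ |r - ρ| := le_abs_self _

/-- A matrix whose marginals are close to `ρ` and `ν` is close to a plan. -/
theorem exists_isPlan {F K : ι → ι → ℝ} {ρ ν r c : ι → ℝ} {D : ℝ} (hF : IsPlan F r c)
    (hρ : ∀ i, 0 ≤ ρ i) (hν : ∀ j, 0 ≤ ν j) (hρ1 : ∑ i, ρ i = 1) (hν1 : ∑ j, ν j = 1)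
    (hK : ∀ i j, 0 ≤ K i j) (hKD : ∀ i j, K i j ≤ D) (hD : 0 ≤ D) :
    ∃ P, IsPlan P ρ ν ∧ ∑ i, ∑ j, P i j * K i j ≤ ∑ i, ∑ j, F i j * K i j +
      D * (2 * (∑ i, |r i - ρ i| + ∑ j, |c j - ν j|)) := by
  have hr : ∀ i, 0 ≤ r i := fun i => by
    rw [← hF.row i]; exact Finset.sum_nonneg fun j _ => hF.nonneg i j
  have hc : ∀ j, 0 ≤ c j := fun j => by
    rw [← hF.col j]; exact Finset.sum_nonneg fun i _ => hF.nonneg i j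
  set u : ι → ℝ := fun i => min 1 (ρ i / r i) with hu
  set w : ι → ℝ := fun j => min 1 (ν j / c j) with hw
  have hu0 : ∀ i, 0 ≤ u i := fun i => le_min zero_le_one (div_nonneg (hρ i) (hr i))
  have hw0 : ∀ j, 0 ≤ w j := fun j => le_min zero_le_one (div_nonneg (hν j) (hc j))
  have hu1 : ∀ i, u i ≤ 1 := fun i => min_le_left _ _
  have hw1 : ∀ j, w j ≤ 1 := fun j => min_le_left _ _
  -- Shrinking rows and columns that are too heavy brings both marginals below their targets. When
  -- `r i = 0` the quotient is 0 by convention, but the row of `F` is then 0 anyway.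
  set F' : ι → ι → ℝ := fun i j => F i j * (u i * w j) with hF'
  have hF'0 : ∀ i j, 0 ≤ F' i j := fun i j =>
    mul_nonneg (hF.nonneg i j) (mul_nonneg (hu0 i) (hw0 j))
  have hF'F : ∀ i j, F' i j ≤ F i j := fun i j =>
    mul_le_of_le_one_right (hF.nonneg i j) (mul_le_one₀ (hu1 i) (hw0 j) (hw1 j))
  set α : ι → ℝ := fun i => ρ i - ∑ j, F' i j with hα
  set β : ι → ℝ := fun j => ν j - ∑ i, F' i j with hβ
  have hα0 : ∀ i, 0 ≤ α i := fun i => by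
    refine sub_nonneg.mpr (le_trans ?_ (mul_min_one_div_le (hr i) (hρ i)))
    rw [← hF.row i, Finset.sum_mul, hF.row i]
    refine Finset.sum_le_sum fun j _ => ?_
    exact mul_le_mul_of_nonneg_left (mul_le_of_le_one_right (hu0 i) (hw1 j)) (hF.nonneg i j)
  have hβ0 : ∀ j, 0 ≤ β j := fun j => by
    refine sub_nonneg.mpr (le_trans ?_ (mul_min_one_div_le (hc j) (hν j)))
    rw [← hF.col j, Finset.sum_mul, hF.col j]
    refine Finset.sum_le_sum fun i _ => ?_
    exact mul_le_mul_of_nonneg_left (mul_le_of_le_one_left (hw0 j) (hu1 i)) (hF.nonneg i j)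
  set s : ℝ := 1 - ∑ i, ∑ j, F' i j with hs
  have hαs : ∑ i, α i = s := by simp only [hα, Finset.sum_sub_distrib, hρ1, hs]
  have hβs : ∑ j, β j = s := by
    simp only [hβ, Finset.sum_sub_distrib, hν1, hs]
    rw [Finset.sum_comm]
  have hs0 : 0 ≤ s := hαs ▸ Finset.sum_nonneg fun i _ => hα0 i
  have hα_zero : s = 0 → ∀ i, α i = 0 := fun h i =>
    (Finset.sum_eq_zero_iff_of_nonneg fun i _ => hα0 i).mp (hαs.trans h) i (Finset.mem_univ i)
  have hβ_zero : s = 0 → ∀ j, β j = 0 := fun h j =>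
    (Finset.sum_eq_zero_iff_of_nonneg fun j _ => hβ0 j).mp (hβs.trans h) j (Finset.mem_univ j)
  -- The missing mass is what `F` lacks to total mass 1 plus what the shrinking removed; each part
  -- is at most the error of the marginals.
  have hs_le : s ≤ 2 * (∑ i, |r i - ρ i| + ∑ j, |c j - ν j|) := by
    have h1 : ∑ i, ∑ j, F i j - ∑ i, ∑ j, F' i j ≤ ∑ i, |r i - ρ i| + ∑ j, |c j - ν j| := by
      have h2 : ∀ i j, F i j - F' i j ≤ F i j * (1 - u i) + F i j * (1 - w j) := fun i j => by
        have : 0 ≤ F i j * ((1 - u i) * (1 - w j)) := mul_nonneg (hF.nonneg i j)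
          (mul_nonneg (sub_nonneg.mpr (hu1 i)) (sub_nonneg.mpr (hw1 j)))
        simp only [hF']
        nlinarith
      calc ∑ i, ∑ j, F i j - ∑ i, ∑ j, F' i j = ∑ i, ∑ j, (F i j - F' i j) := by
            simp only [Finset.sum_sub_distrib]
        _ ≤ ∑ i, ∑ j, (F i j * (1 - u i) + F i j * (1 - w j)) :=
            Finset.sum_le_sum fun i _ => Finset.sum_le_sum fun j _ => h2 i j
        _ = ∑ i, r i * (1 - u i) + ∑ j, c j * (1 - w j) := by
            simp only [Finset.sum_add_distrib]
            congr 1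
            · exact Finset.sum_congr rfl fun i _ => by rw [← Finset.sum_mul, hF.row]
            · rw [Finset.sum_comm]
              exact Finset.sum_congr rfl fun j _ => by rw [← Finset.sum_mul, hF.col]
        _ ≤ _ := add_le_add (Finset.sum_le_sum fun i _ => mul_one_sub_min_le (hr i))
            (Finset.sum_le_sum fun j _ => mul_one_sub_min_le (hc j))
    have h3 : 1 - ∑ i, ∑ j, F i j ≤ ∑ i, |r i - ρ i| := by
      rw [← hρ1]
      simp only [hF.row]
      rw [← Finset.sum_sub_distrib]
      exact Finset.sum_le_sum fun i _ => by rw [abs_sub_comm]; exact le_abs_self _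
    have h4 : 0 ≤ ∑ j, |c j - ν j| := Finset.sum_nonneg fun _ _ => abs_nonneg _
    linarith
  -- The missing mass is filled in as a normalized product of the deficits. If `s = 0`, all deficits
  -- vanish and so does the quotient.
  refine ⟨fun i j => F' i j + α i * β j / s, ⟨fun i j => ?_, fun i => ?_, fun j => ?_⟩, ?_⟩
  · exact add_nonneg (hF'0 i j) (div_nonneg (mul_nonneg (hα0 i) (hβ0 j)) hs0)
  · rw [Finset.sum_add_distrib, ← Finset.sum_div, ← Finset.mul_sum, hβs]
    by_cases h : s = 0
    · have := hα_zero h i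
      simp only [hα] at this
      simp [h]; linarith
    · rw [mul_div_cancel_right₀ _ h]; simp [hα]
  · rw [Finset.sum_add_distrib, ← Finset.sum_div, ← Finset.sum_mul, hαs]
    by_cases h : s = 0
    · have := hβ_zero h j
      simp only [hβ] at this
      simp [h]; linarith
    · rw [mul_div_cancel_left₀ _ h]; simp [hβ]
  · have h1 : ∑ i, ∑ j, α i * β j / s = s := by
      have : ∑ i, ∑ j, α i * β j / s = s * s / s := by
        rw [← hαs, Finset.sum_mul, Finset.sum_div]
        refine Finset.sum_congr rfl fun i _ => ?_
        rw [← Finset.sum_div, ← Finset.mul_sum, hαs, hβs]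
      rw [this, mul_self_div_self]
    calc ∑ i, ∑ j, (F' i j + α i * β j / s) * K i j
        ≤ ∑ i, ∑ j, (F i j * K i j + α i * β j / s * D) := by
          refine Finset.sum_le_sum fun i _ => Finset.sum_le_sum fun j _ => ?_
          rw [add_mul]
          refine add_le_add (mul_le_mul_of_nonneg_right (hF'F i j) (hK i j)) ?_
          exact mul_le_mul_of_nonneg_left (hKD i j)
            (div_nonneg (mul_nonneg (hα0 i) (hβ0 j)) hs0)
      _ = ∑ i, ∑ j, F i j * K i j + D * s := by
          simp only [Finset.sum_add_distrib, ← Finset.sum_mul]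
          rw [h1, mul_comm]
      _ ≤ _ := by gcongr

/-- Weak duality, with errors. -/
theorem cost_le_of_dual {F P C : ι → ι → ℝ} {ρ ν r c φ q : ι → ℝ} {B : ℝ} (hF : IsPlan F r c)
    (hP : IsPlan P ρ ν) (hslack : ∀ i j, F i j * C i j ≤ F i j * (φ i + 1 - q j))
    (hfeas : ∀ i j, φ i ≤ C i j + q j) (hφ0 : ∀ i, 0 ≤ φ i) (hφ : ∀ i, φ i ≤ B)
    (hq0 : ∀ j, 0 ≤ q j) (hq : ∀ j, q j ≤ B) :
    ∑ i, ∑ j, F i j * C i j ≤ ∑ i, ∑ j, P i j * C i j + ∑ i, r i +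
      B * (∑ i, |r i - ρ i| + ∑ j, |c j - ν j|) := by
  -- Slackness bounds the cost of `F` by its dual value plus 1 per unit of mass, and feasibility
  -- bounds the dual value for `ρ`, `ν` by the cost of `P`. The two dual values differ by the errors
  -- of the marginals times `B`.
  have h1 : ∑ i, ∑ j, F i j * C i j ≤ ∑ i, r i * φ i + ∑ i, r i - ∑ j, c j * q j := by
    calc ∑ i, ∑ j, F i j * C i j ≤ ∑ i, ∑ j, (F i j * φ i + F i j - F i j * q j) :=
          Finset.sum_le_sum fun i _ => Finset.sum_le_sum fun j _ => by
            have := hslack i j; linarith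
      _ = _ := by
        simp only [Finset.sum_sub_distrib, Finset.sum_add_distrib, ← Finset.sum_mul, hF.row]
        rw [Finset.sum_comm (f := fun i j => F i j * q j)]
        simp only [← Finset.sum_mul, hF.col]
  have h2 : ∑ i, ρ i * φ i - ∑ j, ν j * q j ≤ ∑ i, ∑ j, P i j * C i j := by
    calc ∑ i, ρ i * φ i - ∑ j, ν j * q j = ∑ i, ∑ j, (P i j * φ i - P i j * q j) := by
          simp only [Finset.sum_sub_distrib, ← Finset.sum_mul, hP.row]
          rw [Finset.sum_comm (f := fun i j => P i j * q j)]
          simp only [← Finset.sum_mul, hP.col]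
      _ ≤ _ := Finset.sum_le_sum fun i _ => Finset.sum_le_sum fun j _ => by
          rw [← mul_sub]
          exact mul_le_mul_of_nonneg_left (by linarith [hfeas i j]) (hP.nonneg i j)
  have h3 : ∑ i, r i * φ i - ∑ i, ρ i * φ i ≤ B * ∑ i, |r i - ρ i| := by
    rw [← Finset.sum_sub_distrib, Finset.mul_sum]
    refine Finset.sum_le_sum fun i _ => ?_
    rw [← sub_mul, mul_comm B]
    exact mul_le_mul (le_abs_self _) (hφ i) (hφ0 i) (abs_nonneg _)
  have h4 : ∑ j, ν j * q j - ∑ j, c j * q j ≤ B * ∑ j, |c j - ν j| := by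
    rw [← Finset.sum_sub_distrib, Finset.mul_sum]
    refine Finset.sum_le_sum fun j _ => ?_
    rw [← sub_mul, mul_comm B, abs_sub_comm]
    exact mul_le_mul (le_abs_self _) (hq j) (hq0 j) (abs_nonneg _)
  linarith

end Finite

theorem div_le_cast_div_add_one (x : ℕ) {L : ℕ} (hL : 0 < L) :
    (x : ℝ) / L ≤ ((x / L : ℕ) : ℝ) + 1 := by
  rw [div_le_iff₀ (by exact_mod_cast hL)]
  have h : x ≤ (x / L + 1) * L := (Nat.lt_mul_of_div_lt (Nat.lt_succ_self (x / L)) hL).le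
  exact_mod_cast h

/-- The value of a certified plan for the rounded distributions is close to the cost of the
transport between the original ones. -/
theorem PlanCertificate.estimate {M L D : ℕ} (hM : 0 < M) (hL : 0 < L) {C : ℕ → ℕ → ℕ}
    {a b : ℕ → ℕ} {F : ℕ → ℕ → ℕ} {q : ℕ → ℕ}
    (h : PlanCertificate M (D * L) C (fun i => a i / L) (fun j => b j / L + 1) F q)
    (ha : ∑ i ∈ Finset.range M, a i = M * L * L) (hb : ∑ j ∈ Finset.range M, b j = M * L * L)
    {K : Fin M → Fin M → ℝ} (hK : ∀ i j, 0 ≤ K i j) (hKD : ∀ i j, K i j ≤ D)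
    (hCK : ∀ i j : Fin M, C i j = ⌈K i j * L⌉₊) {ρ ν : Fin M → ℝ} (hρ : ∀ i, 0 ≤ ρ i)
    (hν : ∀ j, 0 ≤ ν j) (hρ1 : ∑ i, ρ i = 1) (hν1 : ∑ j, ν j = 1) {A E : ℝ}
    (hA : A = ((∑ i ∈ Finset.range M, ∑ j ∈ Finset.range M, F i j * C i j : ℕ) : ℝ) /
      ((M * L * L : ℕ) : ℝ))
    (hE : E = (8 * D + 6) * (∑ i : Fin M, |(a i : ℝ) / ((M * L * L : ℕ) : ℝ) - ρ i| +
      ∑ j : Fin M, |(b j : ℝ) / ((M * L * L : ℕ) : ℝ) - ν j| + 1 / L)) :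
    (∃ P, IsPlan P ρ ν ∧ ∑ i, ∑ j, P i j * K i j ≤ A + E) ∧
      ∀ P, IsPlan P ρ ν → A ≤ ∑ i, ∑ j, P i j * K i j + E := by
  have hL' : (0 : ℝ) < L := by exact_mod_cast hL
  have hL1 : (1 : ℝ) ≤ L := by exact_mod_cast hL
  have hM' : (0 : ℝ) < M := by exact_mod_cast hM
  have hD0 : (0 : ℝ) ≤ D := Nat.cast_nonneg D
  set U : ℝ := M * L with hU
  have hU0 : 0 < U := mul_pos hM' hL'
  have hN : ((M * L * L : ℕ) : ℝ) = U * L := by push_cast; ring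
  rw [hN] at hA hE
  set G : Fin M → Fin M → ℝ := fun i j => (F i j : ℝ) / U with hG
  set r : Fin M → ℝ := fun i => ((a i / L : ℕ) : ℝ) / U with hr
  -- The demand only bounds what a consumer receives, so the second marginal has to be that of the
  -- plan itself.
  set c : Fin M → ℝ := fun j => ∑ i, G i j with hc
  have hplan : IsPlan G r c := by
    refine ⟨fun i j => by positivity, fun i => ?_, fun j => rfl⟩
    simp only [hG, hr]
    rw [← Finset.sum_div, ← h.row i i.2, Finset.sum_range]
    push_cast; rfl
  have hceil : ∀ x : ℕ, |((x / L : ℕ) : ℝ) / U - (x : ℝ) / (U * L)| ≤ 1 / U := by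
    intro x
    have h1 : ((x / L : ℕ) : ℝ) ≤ x / L := Nat.cast_div_le
    have h2 : (x : ℝ) / L ≤ ((x / L : ℕ) : ℝ) + 1 := div_le_cast_div_add_one x hL
    have h3 : (x : ℝ) / (U * L) = x / L / U := by field_simp
    rw [h3, ← sub_div, abs_div, abs_of_pos hU0]
    gcongr
    rw [abs_le]; constructor <;> linarith
  have hMU : (M : ℝ) * (1 / U) = 1 / L := by rw [hU]; field_simp
  set δ1 := ∑ i : Fin M, |(a i : ℝ) / (U * L) - ρ i| with hδ1
  set δ2 := ∑ j : Fin M, |(b j : ℝ) / (U * L) - ν j| with hδ2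
  have hδ1' : 0 ≤ δ1 := Finset.sum_nonneg fun _ _ => abs_nonneg _
  have hδ2' : 0 ≤ δ2 := Finset.sum_nonneg fun _ _ => abs_nonneg _
  have e1 : ∑ i, |r i - ρ i| ≤ δ1 + 1 / L := by
    calc ∑ i, |r i - ρ i| ≤ ∑ i : Fin M, (|(a i : ℝ) / (U * L) - ρ i| + 1 / U) :=
          Finset.sum_le_sum fun i _ => by
            have := abs_sub_le (r i) ((a i : ℝ) / (U * L)) (ρ i)
            linarith [hceil (a i)]
      _ = _ := by rw [Finset.sum_add_distrib]; simp [← hMU, hδ1]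
  have hsa : (∑ i ∈ Finset.range M, a i / L) ≤ M * L := by
    refine Nat.le_of_mul_le_mul_right ?_ hL
    exact (sum_div_le _ _ _).trans ha.le
  have hsa' : M * L ≤ (∑ i ∈ Finset.range M, a i / L) + M := by
    have := sum_le_sum_div (Finset.range M) a hL
    rw [ha, Finset.sum_add_distrib] at this
    simp only [Finset.card_range, Finset.sum_const, smul_eq_mul, mul_one] at this
    refine Nat.le_of_mul_le_mul_right ?_ hL
    omega
  have hsb : (∑ j ∈ Finset.range M, (b j / L + 1)) ≤ M * L + M := by
    rw [Finset.sum_add_distrib]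
    simp only [Finset.card_range, Finset.sum_const, smul_eq_mul, mul_one]
    refine Nat.add_le_add_right (Nat.le_of_mul_le_mul_right ?_ hL) _
    exact (sum_div_le _ _ _).trans hb.le
  have hrsum : ∑ i, r i = ((∑ i ∈ Finset.range M, a i / L : ℕ) : ℝ) / U := by
    rw [Finset.sum_range, ← Finset.sum_div]; push_cast; rfl
  have hr1 : ∑ i, r i ≤ 1 := by
    rw [hrsum, div_le_one hU0, hU]; exact_mod_cast hsa
  -- Unsold units account for `2 / L`: the two roundings leave at most `2 M` of them, in units of `1
  -- / (M L)`. Rounding the demand adds another `1 / L`.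
  have e2 : ∑ j, |c j - ν j| ≤ δ2 + 3 / L := by
    have h1 : ∀ j : Fin M, c j ≤ ((b j / L + 1 : ℕ) : ℝ) / U := fun j => by
      simp only [hc, hG]
      rw [← Finset.sum_div]
      gcongr
      have := h.col j j.2
      rw [Finset.sum_range] at this
      exact_mod_cast this
    have h2 : ∑ j : Fin M, (((b j / L + 1 : ℕ) : ℝ) / U - c j) ≤ 2 / L := by
      rw [Finset.sum_sub_distrib]
      have h3 : ∑ j, c j = ∑ i, r i := by
        simp only [hc]
        rw [Finset.sum_comm]
        exact Finset.sum_congr rfl fun i _ => hplan.row i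
      have h4 : ∑ j : Fin M, ((b j / L + 1 : ℕ) : ℝ) / U =
          ((∑ j ∈ Finset.range M, (b j / L + 1) : ℕ) : ℝ) / U := by
        rw [Finset.sum_range, ← Finset.sum_div]; push_cast; rfl
      rw [h3, hrsum, h4, ← sub_div]
      have h5 : (2 : ℝ) / L = (2 * M) / U := by rw [hU]; field_simp
      rw [h5]
      gcongr
      have h6 : ((∑ j ∈ Finset.range M, (b j / L + 1) : ℕ) : ℝ) ≤ M * L + M := by
        exact_mod_cast hsb
      have h7 : (M * L : ℝ) ≤ ((∑ i ∈ Finset.range M, a i / L : ℕ) : ℝ) + M := by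
        exact_mod_cast hsa'
      linarith
    have h8 : ∀ j : Fin M, |((b j / L + 1 : ℕ) : ℝ) / U - (b j : ℝ) / (U * L)| ≤ 1 / U := by
      intro j
      have h1 : ((b j / L : ℕ) : ℝ) ≤ b j / L := Nat.cast_div_le
      have h2 : (b j : ℝ) / L ≤ ((b j / L : ℕ) : ℝ) + 1 := div_le_cast_div_add_one _ hL
      have h3 : (b j : ℝ) / (U * L) = b j / L / U := by field_simp
      rw [h3, ← sub_div, abs_div, abs_of_pos hU0]
      gcongr
      push_cast
      rw [abs_le]; constructor <;> linarith
    calc ∑ j, |c j - ν j| ≤ ∑ j : Fin M, ((((b j / L + 1 : ℕ) : ℝ) / U - c j) +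
          (|(b j : ℝ) / (U * L) - ν j| + 1 / U)) := Finset.sum_le_sum fun j _ => by
            have t1 := abs_sub_le (c j) (((b j / L + 1 : ℕ) : ℝ) / U) (ν j)
            have t2 := abs_sub_le (((b j / L + 1 : ℕ) : ℝ) / U) ((b j : ℝ) / (U * L)) (ν j)
            have t3 : |c j - ((b j / L + 1 : ℕ) : ℝ) / U| = ((b j / L + 1 : ℕ) : ℝ) / U - c j := by
              rw [abs_sub_comm]; exact abs_of_nonneg (sub_nonneg.mpr (h1 j))
            linarith [h8 j]
      _ ≤ 2 / L + (δ2 + 1 / L) := by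
          rw [Finset.sum_add_distrib, Finset.sum_add_distrib]
          refine add_le_add h2 (le_of_eq ?_)
          simp [← hMU, hδ2]
      _ = _ := by ring
  set η := ∑ i, |r i - ρ i| + ∑ j, |c j - ν j| with hη
  have hη' : η ≤ δ1 + δ2 + 4 * (1 / L) := by
    have : (3 : ℝ) / L = 3 * (1 / L) := by ring
    linarith
  have hLinv : 0 < 1 / (L : ℝ) := by positivity
  have hAG : ∑ i, ∑ j, G i j * (C i j : ℝ) = A * L := by
    rw [hA, Finset.sum_range]
    simp only [hG, Finset.sum_range]
    push_cast
    rw [div_mul_eq_mul_div, mul_div_mul_right _ _ hL'.ne', Finset.sum_div]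
    refine Finset.sum_congr rfl fun i _ => ?_
    rw [Finset.sum_div]
    exact Finset.sum_congr rfl fun j _ => by ring
  have hCK1 : ∀ i j : Fin M, K i j * L ≤ C i j := fun i j => by rw [hCK]; exact Nat.le_ceil _
  have hCK2 : ∀ i j : Fin M, (C i j : ℝ) ≤ K i j * L + 1 := fun i j => by
    rw [hCK]; exact (Nat.ceil_lt_add_one (mul_nonneg (hK i j) hL'.le)).le
  constructor
  · obtain ⟨P, hP, hle⟩ := exists_isPlan hplan hρ hν hρ1 hν1 hK hKD hD0
    refine ⟨P, hP, hle.trans ?_⟩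
    have h1 : ∑ i, ∑ j, G i j * K i j ≤ A := by
      have : (∑ i, ∑ j, G i j * K i j) * L ≤ A * L := by
        rw [← hAG, Finset.sum_mul]
        refine Finset.sum_le_sum fun i _ => ?_
        rw [Finset.sum_mul]
        refine Finset.sum_le_sum fun j _ => ?_
        rw [mul_assoc]
        exact mul_le_mul_of_nonneg_left (hCK1 i j) (hplan.nonneg i j)
      exact le_of_mul_le_mul_right this hL'
    refine add_le_add h1 ?_
    rw [hE]
    nlinarith [mul_le_mul_of_nonneg_left hη' hD0, mul_nonneg hD0 hδ1', mul_nonneg hD0 hδ2']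
  · intro P hP
    have hCle : ∀ i j : Fin M, C i j ≤ D * L := fun i j => by
      rw [hCK]
      refine Nat.ceil_le.mpr ?_
      push_cast
      exact mul_le_mul_of_nonneg_right (hKD i j) hL'.le
    -- The dual variable of supplier `i` is its smallest cost plus price, attained at `k i`.
    have hmin : ∀ i : Fin M, ∃ k : Fin M, ∀ j : Fin M, C i k + q k ≤ C i j + q j := fun i => by
      obtain ⟨k, -, hk⟩ := Finset.exists_min_image (Finset.univ : Finset (Fin M))
        (fun j => C i j + q j) ⟨⟨0, hM⟩, Finset.mem_univ _⟩
      exact ⟨k, fun j => hk j (Finset.mem_univ j)⟩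
    choose k hk using hmin
    -- Costs are at most `D L` and prices at most `D L + 1`; this bounds both kinds of dual
    -- variables.
    have hBn : ∀ x : ℕ, x ≤ 2 * (D * L) + 1 → (x : ℝ) ≤ (2 * D + 1) * L := fun x hx => by
      have : (x : ℝ) ≤ 2 * (D * L) + 1 := by exact_mod_cast hx
      linarith
    have hdual := cost_le_of_dual (C := fun i j : Fin M => (C i j : ℝ))
      (φ := fun i : Fin M => ((C i (k i) + q (k i) : ℕ) : ℝ)) (q := fun j : Fin M => (q j : ℝ))
      (B := (2 * D + 1) * L) hplan hP
      (fun i j => by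
        rcases Nat.eq_zero_or_pos (F i j) with h0 | h0
        · simp [hG, h0]
        · refine mul_le_mul_of_nonneg_left ?_ (hplan.nonneg i j)
          have := h.slack i i.2 j j.2 h0 (k i) (k i).2
          have : ((C i j : ℕ) : ℝ) + q j ≤ C i (k i) + q (k i) + 1 := by exact_mod_cast this
          push_cast
          linarith)
      (fun i j => by have := hk i j; exact_mod_cast this)
      (fun i => Nat.cast_nonneg _)
      (fun i => hBn _ (by have := hCle i (k i); have := h.price (k i) (k i).2; omega))
      (fun j => Nat.cast_nonneg _)
      (fun j => hBn _ (by have := h.price j j.2; omega))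
    rw [hAG] at hdual
    have h1 : ∑ i, ∑ j, P i j * (C i j : ℝ) ≤ (∑ i, ∑ j, P i j * K i j) * L + 1 := by
      have : ∑ i, ∑ j, P i j = 1 := by simp only [hP.row, hρ1]
      rw [← this, Finset.sum_mul, ← Finset.sum_add_distrib]
      refine Finset.sum_le_sum fun i _ => ?_
      rw [Finset.sum_mul, ← Finset.sum_add_distrib]
      refine Finset.sum_le_sum fun j _ => ?_
      have := mul_le_mul_of_nonneg_left (hCK2 i j) (hP.nonneg i j)
      linarith
    -- One `1 / L` comes from the slack of the auction and one from rounding the costs. With `η ≤ δ1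
    -- + δ2 + 4 / L` the coefficient of `1 / L` becomes `2 + 4 (2 D + 1) = 8 D + 6`.
    have h2 : A * L ≤ (∑ i, ∑ j, P i j * K i j + 2 * (1 / L) + (2 * D + 1) * η) * L := by
      have : (2 * (1 / (L : ℝ))) * L = 2 := by field_simp
      rw [add_mul, add_mul, this]
      linarith
    refine (le_of_mul_le_mul_right h2 hL').trans ?_
    rw [add_assoc]
    refine add_le_add le_rfl ?_
    rw [hE]
    nlinarith [mul_le_mul_of_nonneg_left hη' hD0, mul_nonneg hD0 hδ1', mul_nonneg hD0 hδ2']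

/-! ### The Wasserstein distance -/

section Wasserstein

variable {E : Type*} [MeasurableSpace E]

theorem wasserstein_eq_iInf [PseudoEMetricSpace E] {p : ℝ} (hp : 0 < p) (μ ν : Measure E) :
    wasserstein p μ ν = ⨅ π ∈ couplings μ ν, (∫⁻ z, edist z.1 z.2 ^ p ∂π) ^ (1 / p) := by
  have hp' : 0 < 1 / p := by positivity
  change ENNReal.orderIsoRpow (1 / p) hp' _ = _
  rw [OrderIso.map_iInf]
  refine iInf_congr fun π => ?_
  rw [OrderIso.map_iInf]
  rfl

theorem wasserstein_le [PseudoEMetricSpace E] {p : ℝ} (hp : 0 < p) {μ ν : Measure E}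
    {π : Measure (E × E)} (hπ : π ∈ couplings μ ν) :
    wasserstein p μ ν ≤ (∫⁻ z, edist z.1 z.2 ^ p ∂π) ^ (1 / p) := by
  rw [wasserstein_eq_iInf hp]
  exact iInf₂_le π hπ

theorem le_wasserstein [PseudoEMetricSpace E] {p : ℝ} (hp : 0 < p) {μ ν : Measure E} {a : ℝ≥0∞}
    (h : ∀ π ∈ couplings μ ν, a ≤ (∫⁻ z, edist z.1 z.2 ^ p ∂π) ^ (1 / p)) :
    a ≤ wasserstein p μ ν := by
  rw [wasserstein_eq_iInf hp]
  exact le_iInf₂ h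

theorem couplings_swap {μ ν : Measure E} {π : Measure (E × E)} (hπ : π ∈ couplings μ ν) :
    π.map Prod.swap ∈ couplings ν μ := by
  constructor
  · rw [Measure.map_map measurable_fst measurable_swap]; exact hπ.2
  · rw [Measure.map_map measurable_snd measurable_swap]; exact hπ.1

theorem isProbabilityMeasure_of_mem_couplings {μ ν : Measure E} [IsProbabilityMeasure μ]
    {π : Measure (E × E)} (hπ : π ∈ couplings μ ν) : IsProbabilityMeasure π := by
  constructor
  have h : (π.map Prod.fst) Set.univ = 1 := by rw [hπ.1]; simp
  rwa [Measure.map_apply measurable_fst MeasurableSet.univ] at h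

/-- Gluing of couplings. -/
theorem exists_gluing [StandardBorelSpace E] {μ ν ρ : Measure E} [IsProbabilityMeasure μ]
    [IsProbabilityMeasure ν] {π₁ π₂ : Measure (E × E)} (h₁ : π₁ ∈ couplings μ ν)
    (h₂ : π₂ ∈ couplings ν ρ) :
    ∃ θ : Measure ((E × E) × E), θ.map Prod.fst = π₁ ∧ θ.map (fun z => (z.1.2, z.2)) = π₂ := by
  have := isProbabilityMeasure_of_mem_couplings h₁
  have := isProbabilityMeasure_of_mem_couplings h₂
  have : Nonempty E := by
    by_contra hcon
    rw [not_nonempty_iff] at hcon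
    have h1 := measure_univ (μ := μ)
    rw [Set.univ_eq_empty_iff.mpr hcon] at h1
    simp at h1
  -- Draw a pair from `π₁`, then the third point from `π₂` conditioned on the middle point.
  refine ⟨π₁ ⊗ₘ (π₂.condKernel.comap Prod.snd measurable_snd), Measure.fst_compProd _ _, ?_⟩
  conv_rhs => rw [← π₂.disintegrate π₂.condKernel]
  have hfst : π₂.fst = π₁.map Prod.snd := h₂.1.trans h₁.2.symm
  have hm : Measurable fun z : (E × E) × E => (z.1.2, z.2) := by fun_prop
  refine Measure.ext_of_lintegral _ fun f hf => ?_
  rw [lintegral_map hf hm, Measure.lintegral_compProd (f := fun z : (E × E) × E => f (z.1.2, z.2)) (hf.comp hm),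
    Measure.lintegral_compProd hf, hfst, lintegral_map _ measurable_snd]
  · rfl
  · exact hf.lintegral_kernel_prod_right'

section Metric

variable [PseudoEMetricSpace E] [OpensMeasurableSpace E] [SecondCountableTopology E]

theorem measurable_edist_rpow (p : ℝ) : Measurable fun z : E × E => edist z.1 z.2 ^ p :=
  (measurable_fst.edist measurable_snd).pow_const p

theorem wasserstein_comm_le {p : ℝ} (hp : 0 < p) (μ ν : Measure E) :
    wasserstein p μ ν ≤ wasserstein p ν μ := by
  refine le_wasserstein hp fun π hπ => ?_
  refine (wasserstein_le hp (couplings_swap hπ)).trans (le_of_eq ?_)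
  rw [lintegral_map (measurable_edist_rpow p) measurable_swap]
  simp [edist_comm]

theorem wasserstein_comm {p : ℝ} (hp : 0 < p) (μ ν : Measure E) :
    wasserstein p μ ν = wasserstein p ν μ :=
  le_antisymm (wasserstein_comm_le hp μ ν) (wasserstein_comm_le hp ν μ)

/-- Glue two couplings along `ν` and apply Minkowski's inequality on the space of triples. Working
with the infimum over all couplings avoids the existence of optimal ones. -/
theorem wasserstein_triangle [StandardBorelSpace E] {p : ℝ} (hp : 1 ≤ p) (μ ν ρ : Measure E)
    [IsProbabilityMeasure μ] [IsProbabilityMeasure ν] :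
    wasserstein p μ ρ ≤ wasserstein p μ ν + wasserstein p ν ρ := by
  have hp0 : 0 < p := by linarith
  rw [wasserstein_eq_iInf hp0 μ ν, wasserstein_eq_iInf hp0 ν ρ]
  simp only [ENNReal.iInf_add, ENNReal.add_iInf]
  refine le_iInf₂ fun π₂ h₂ => le_iInf₂ fun π₁ h₁ => ?_
  obtain ⟨θ, hθ₁, hθ₂⟩ := exists_gluing h₁ h₂
  have hm2 : Measurable fun z : (E × E) × E => (z.1.2, z.2) := by fun_prop
  have hm3 : Measurable fun z : (E × E) × E => (z.1.1, z.2) := by fun_prop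
  have hc : θ.map (fun z => (z.1.1, z.2)) ∈ couplings μ ρ := by
    constructor
    · rw [Measure.map_map measurable_fst hm3, ← h₁.1, ← hθ₁,
        Measure.map_map measurable_fst measurable_fst]
      rfl
    · rw [Measure.map_map measurable_snd hm3, ← h₂.2, ← hθ₂,
        Measure.map_map measurable_snd hm2]
      rfl
  have e1 : ∫⁻ z, edist z.1 z.2 ^ p ∂π₁ = ∫⁻ z, edist z.1.1 z.1.2 ^ p ∂θ := by
    rw [← hθ₁, lintegral_map (measurable_edist_rpow p) measurable_fst]
  have e2 : ∫⁻ z, edist z.1 z.2 ^ p ∂π₂ = ∫⁻ z, edist z.1.2 z.2 ^ p ∂θ := by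
    rw [← hθ₂, lintegral_map (measurable_edist_rpow p) hm2]
  refine (wasserstein_le hp0 hc).trans ?_
  rw [lintegral_map (measurable_edist_rpow p) hm3, e1, e2]
  refine le_trans ?_ (ENNReal.lintegral_Lp_add_le (f := fun z : (E × E) × E => edist z.1.1 z.1.2)
    (g := fun z => edist z.1.2 z.2) ?_ ?_ hp)
  · gcongr
    exact edist_triangle _ _ _
  · exact (measurable_fst.fst.edist measurable_fst.snd).aemeasurable
  · exact (measurable_fst.snd.edist measurable_snd).aemeasurable

end Metric

/-! ### Discretization -/

section Cells

variable {M : ℕ} {cell : E → Fin M}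

theorem lintegral_cells (hcell : Measurable cell) (π : Measure (E × E))
    (f : Fin M → Fin M → ℝ≥0∞) :
    ∫⁻ z, f (cell z.1) (cell z.2) ∂π =
      ∑ i, ∑ j, f i j * π ((cell ⁻¹' {i}) ×ˢ (cell ⁻¹' {j})) := by
  have hm : Measurable fun z : E × E => (cell z.1, cell z.2) := by fun_prop
  have h := lintegral_map (μ := π) (f := fun q : Fin M × Fin M => f q.1 q.2)
    (measurable_of_finite _) hm
  rw [← h, lintegral_fintype, Fintype.sum_prod_type]
  refine Finset.sum_congr rfl fun i _ => Finset.sum_congr rfl fun j _ => ?_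
  rw [Measure.map_apply hm (measurableSet_singleton _)]
  congr 2
  ext z
  simp

theorem sum_measure_cells (hcell : Measurable cell) (μ : Measure E) (s : Set E) :
    ∑ i, μ (cell ⁻¹' {i} ∩ s) = μ s := by
  have h := sum_measure_preimage_singleton (μ := μ.restrict s) (f := cell) Finset.univ
    (fun i _ => hcell (measurableSet_singleton i))
  simp only [Finset.coe_univ, Set.preimage_univ, Measure.restrict_apply MeasurableSet.univ,
    Set.univ_inter] at h
  rw [← h]
  exact Finset.sum_congr rfl fun i _ =>
    (Measure.restrict_apply (hcell (measurableSet_singleton i))).symm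

theorem sum_measureReal_cells (hcell : Measurable cell) (μ : Measure E)
    [IsProbabilityMeasure μ] : ∑ i, μ.real (cell ⁻¹' {i}) = 1 := by
  have h := sum_measure_cells hcell μ Set.univ
  simp only [Set.inter_univ, measure_univ] at h
  simp only [measureReal_def]
  rw [← ENNReal.toReal_sum fun i _ => measure_ne_top _ _, h, ENNReal.toReal_one]

/-- A coupling gives a plan for the masses of the cells. -/
theorem isPlan_of_coupling (hcell : Measurable cell) {μ ν : Measure E} [IsProbabilityMeasure μ]
    {π : Measure (E × E)} (hπ : π ∈ couplings μ ν) :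
    IsPlan (fun i j => π.real ((cell ⁻¹' {i}) ×ˢ (cell ⁻¹' {j})))
      (fun i => μ.real (cell ⁻¹' {i})) (fun j => ν.real (cell ⁻¹' {j})) := by
  have := isProbabilityMeasure_of_mem_couplings hπ
  have hm : ∀ i, MeasurableSet (cell ⁻¹' {i}) := fun i => hcell (measurableSet_singleton i)
  refine ⟨fun i j => measureReal_nonneg, fun i => ?_, fun j => ?_⟩
  · simp only [measureReal_def]
    rw [← ENNReal.toReal_sum fun i _ => measure_ne_top _ _, ← hπ.1,
      Measure.map_apply measurable_fst (hm i),
      ← sum_measure_cells (hcell.comp measurable_snd) π (Prod.fst ⁻¹' (cell ⁻¹' {i}))]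
    congr 1
    refine Finset.sum_congr rfl fun j _ => congrArg π ?_
    ext z; simp [and_comm]
  · simp only [measureReal_def]
    rw [← ENNReal.toReal_sum fun i _ => measure_ne_top _ _, ← hπ.2,
      Measure.map_apply measurable_snd (hm j),
      ← sum_measure_cells (hcell.comp measurable_fst) π (Prod.snd ⁻¹' (cell ⁻¹' {j}))]
    congr 1

/-- A plan for the masses of the cells comes from a coupling. -/
theorem exists_coupling_of_isPlan (hcell : Measurable cell) {μ ν : Measure E}
    [IsProbabilityMeasure μ] [IsProbabilityMeasure ν] {P : Fin M → Fin M → ℝ}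
    (hP : IsPlan P (fun i => μ.real (cell ⁻¹' {i})) (fun j => ν.real (cell ⁻¹' {j}))) :
    ∃ π ∈ couplings μ ν,
      ∀ i j, π ((cell ⁻¹' {i}) ×ˢ (cell ⁻¹' {j})) = ENNReal.ofReal (P i j) := by
  have hm : ∀ i, MeasurableSet (cell ⁻¹' {i}) := fun i => hcell (measurableSet_singleton i)
  -- The conditional measure on a null cell is 0 rather than a probability measure, but the plan
  -- puts no mass there.
  have hsame : ∀ (μ : Measure E) [IsProbabilityMeasure μ] (i : Fin M) (a : ℝ),
      (μ.real (cell ⁻¹' {i}) = 0 → a = 0) →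
      ∀ s, cell ⁻¹' {i} ⊆ s → ENNReal.ofReal a * μ[s | cell ⁻¹' {i}] = ENNReal.ofReal a := by
    intro μ _ i a ha s hs
    by_cases h0 : μ (cell ⁻¹' {i}) = 0
    · rw [ha (by simp [measureReal_def, h0])]; simp
    · rw [cond_apply (hm i), Set.inter_eq_left.mpr hs,
        ENNReal.inv_mul_cancel h0 (measure_ne_top _ _), mul_one]
  have hother : ∀ (μ : Measure E) [IsProbabilityMeasure μ] (i i' : Fin M), i' ≠ i →
      μ[cell ⁻¹' {i'} | cell ⁻¹' {i}] = 0 := by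
    intro μ _ i i' h
    rw [cond_apply (hm i)]
    have : cell ⁻¹' {i} ∩ cell ⁻¹' {i'} = ∅ := by
      ext x; simp only [Set.mem_inter_iff, Set.mem_preimage, Set.mem_singleton_iff,
        Set.mem_empty_iff_false, iff_false, not_and]
      rintro rfl h'; exact h h'.symm
    simp [this]
  have hrow : ∀ i j, μ.real (cell ⁻¹' {i}) = 0 → P i j = 0 := fun i j h =>
    (Finset.sum_eq_zero_iff_of_nonneg fun j _ => hP.nonneg i j).mp ((hP.row i).trans h) j
      (Finset.mem_univ j)
  have hcol : ∀ i j, ν.real (cell ⁻¹' {j}) = 0 → P i j = 0 := fun i j h =>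
    (Finset.sum_eq_zero_iff_of_nonneg fun i _ => hP.nonneg i j).mp ((hP.col j).trans h) i
      (Finset.mem_univ i)
  -- The mass `P i j` is spread as the product of the conditional laws on the two cells.
  set π : Measure (E × E) := ∑ i, ∑ j,
    ENNReal.ofReal (P i j) • (μ[|cell ⁻¹' {i}]).prod (ν[|cell ⁻¹' {j}]) with hπ
  have hprod : ∀ s t : Set E, π (s ×ˢ t) =
      ∑ i, ∑ j, ENNReal.ofReal (P i j) * (μ[s | cell ⁻¹' {i}] * ν[t | cell ⁻¹' {j}]) := by
    intro s t
    simp [hπ, Measure.finsetSum_apply, Measure.prod_prod]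
  refine ⟨π, ⟨?_, ?_⟩, fun i j => ?_⟩
  · ext s hs
    rw [Measure.map_apply measurable_fst hs]
    have : Prod.fst ⁻¹' s = s ×ˢ (Set.univ : Set E) := by ext; simp
    rw [this, hprod, ← sum_measure_cells hcell μ s]
    refine Finset.sum_congr rfl fun i _ => ?_
    rw [← cond_mul_eq_inter (hm i), ← ofReal_measureReal (μ := μ) (s := cell ⁻¹' {i}), ← hP.row i,
      ENNReal.ofReal_sum_of_nonneg fun j _ => hP.nonneg i j, Finset.mul_sum]
    refine Finset.sum_congr rfl fun j _ => ?_
    rw [mul_left_comm, hsame ν j _ (hcol i j) _ (Set.subset_univ _)]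
  · ext s hs
    rw [Measure.map_apply measurable_snd hs]
    have : Prod.snd ⁻¹' s = (Set.univ : Set E) ×ˢ s := by ext; simp
    rw [this, hprod, ← sum_measure_cells hcell ν s, Finset.sum_comm]
    refine Finset.sum_congr rfl fun j _ => ?_
    rw [← cond_mul_eq_inter (hm j), ← ofReal_measureReal (μ := ν) (s := cell ⁻¹' {j}), ← hP.col j,
      ENNReal.ofReal_sum_of_nonneg fun i _ => hP.nonneg i j, Finset.mul_sum]
    refine Finset.sum_congr rfl fun i _ => ?_
    rw [← mul_assoc, hsame μ i _ (hrow i j) _ (Set.subset_univ _), mul_comm]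
  · rw [hprod, Finset.sum_eq_single i, Finset.sum_eq_single j]
    · rw [← mul_assoc, hsame μ i _ (hrow i j) _ subset_rfl, hsame ν j _ (hcol i j) _ subset_rfl]
    · intro j' _ hj'
      rw [hother ν j' j hj'.symm]; simp
    · simp
    · intro i' _ hi'
      exact Finset.sum_eq_zero fun j' _ => by rw [hother μ i' i hi'.symm]; simp
    · simp

end Cells

/-! ### From the transport between cells to the Wasserstein distance -/

section Estimate

variable [PseudoMetricSpace E] [OpensMeasurableSpace E] [SecondCountableTopology E] {M : ℕ}
  {cell : E → Fin M}

/-- Minkowski's inequality with a constant function, whose norm is `η` because `π` has mass 1. -/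
theorem lintegral_const_add_rpow_le {Ω : Type*} [MeasurableSpace Ω] {π : Measure Ω}
    [IsProbabilityMeasure π] {p : ℝ} (hp : 1 ≤ p) {f g : Ω → ℝ≥0∞} (hg : AEMeasurable g π)
    (η : ℝ≥0∞) (h : ∀ z, f z ≤ g z + η) :
    (∫⁻ z, f z ^ p ∂π) ^ (1 / p) ≤ (∫⁻ z, g z ^ p ∂π) ^ (1 / p) + η := by
  have hp0 : 0 < p := by linarith
  calc (∫⁻ z, f z ^ p ∂π) ^ (1 / p) ≤ (∫⁻ z, (g + fun _ => η : Ω → ℝ≥0∞) z ^ p ∂π) ^ (1 / p) := by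
        gcongr with z
        exact h z
    _ ≤ _ := ENNReal.lintegral_Lp_add_le hg aemeasurable_const hp
    _ = _ := by
        rw [lintegral_const, measure_univ, mul_one, ← ENNReal.rpow_mul, mul_one_div_cancel hp0.ne',
          ENNReal.rpow_one]

/-- The value `A` approximates the Wasserstein distance if it approximates the optimal cost of
the transport between the cells. -/
theorem abs_sub_wasserstein_le (hcell : Measurable cell) {p : ℝ} (hp : 1 ≤ p)
    {δ : Fin M → Fin M → ℝ} {η : ℝ} (hδ : ∀ i j, 0 ≤ δ i j) (hη : 0 ≤ η)
    (h₁ : ∀ x y, dist x y ≤ δ (cell x) (cell y) + η)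
    (h₂ : ∀ x y, δ (cell x) (cell y) ≤ dist x y + η) {μ ν : Measure E} [IsProbabilityMeasure μ]
    [IsProbabilityMeasure ν] {A e : ℝ} (hA : 0 ≤ A) (he : 0 ≤ e)
    (hup : ∃ P, IsPlan P (fun i => μ.real (cell ⁻¹' {i})) (fun j => ν.real (cell ⁻¹' {j})) ∧
      ∑ i, ∑ j, P i j * δ i j ^ p ≤ A + e)
    (hlow : ∀ P, IsPlan P (fun i => μ.real (cell ⁻¹' {i})) (fun j => ν.real (cell ⁻¹' {j})) →
      A ≤ ∑ i, ∑ j, P i j * δ i j ^ p + e) :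
    |A ^ (1 / p) - (wasserstein p μ ν).toReal| ≤ η + e ^ (1 / p) := by
  have hp0 : 0 < p := by linarith
  have hp1 : 0 ≤ 1 / p := by positivity
  have hp2 : 1 / p ≤ 1 := by rw [div_le_one hp0]; exact hp
  have hcost : ∀ (π : Measure (E × E)) (P : Fin M → Fin M → ℝ), (∀ i j, 0 ≤ P i j) →
      (∀ i j, π ((cell ⁻¹' {i}) ×ˢ (cell ⁻¹' {j})) = ENNReal.ofReal (P i j)) →
      ∫⁻ z, ENNReal.ofReal (δ (cell z.1) (cell z.2)) ^ p ∂π =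
        ENNReal.ofReal (∑ i, ∑ j, P i j * δ i j ^ p) := by
    intro π P hP h
    have hδp : ∀ i j, 0 ≤ δ i j ^ p := fun i j => Real.rpow_nonneg (hδ i j) p
    rw [lintegral_cells hcell π fun i j => ENNReal.ofReal (δ i j) ^ p,
      ENNReal.ofReal_sum_of_nonneg fun i _ => Finset.sum_nonneg fun j _ =>
        mul_nonneg (hP i j) (hδp i j)]
    refine Finset.sum_congr rfl fun i _ => ?_
    rw [ENNReal.ofReal_sum_of_nonneg fun j _ => mul_nonneg (hP i j) (hδp i j)]
    refine Finset.sum_congr rfl fun j _ => ?_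
    rw [h, ENNReal.ofReal_rpow_of_nonneg (hδ i j) hp0.le, mul_comm, ENNReal.ofReal_mul (hP i j)]
  have hmδ : Measurable fun z : E × E => ENNReal.ofReal (δ (cell z.1) (cell z.2)) := by
    have hm : Measurable fun z : E × E => (cell z.1, cell z.2) := by fun_prop
    exact (measurable_of_finite fun q : Fin M × Fin M => ENNReal.ofReal (δ q.1 q.2)).comp hm
  have hA' : ENNReal.ofReal A ^ (1 / p) = ENNReal.ofReal (A ^ (1 / p)) :=
    ENNReal.ofReal_rpow_of_nonneg hA hp1
  have he' : ENNReal.ofReal e ^ (1 / p) = ENNReal.ofReal (e ^ (1 / p)) :=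
    ENNReal.ofReal_rpow_of_nonneg he hp1
  have hAp : 0 ≤ A ^ (1 / p) := Real.rpow_nonneg hA _
  have hep : 0 ≤ e ^ (1 / p) := Real.rpow_nonneg he _
  -- The cheap plan is lifted to a coupling. The error `e` leaves the root because `x ↦ x ^ (1 / p)`
  -- is subadditive.
  have upper : wasserstein p μ ν ≤ ENNReal.ofReal (A ^ (1 / p) + (η + e ^ (1 / p))) := by
    obtain ⟨P, hP, hle⟩ := hup
    obtain ⟨π, hπ, hπP⟩ := exists_coupling_of_isPlan hcell hP
    have := isProbabilityMeasure_of_mem_couplings hπ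
    calc wasserstein p μ ν ≤ _ := wasserstein_le hp0 hπ
      _ ≤ (∫⁻ z, ENNReal.ofReal (δ (cell z.1) (cell z.2)) ^ p ∂π) ^ (1 / p) +
          ENNReal.ofReal η := by
        refine lintegral_const_add_rpow_le hp hmδ.aemeasurable _ fun z => ?_
        rw [edist_dist, ← ENNReal.ofReal_add (hδ _ _) hη]
        exact ENNReal.ofReal_le_ofReal (h₁ _ _)
      _ ≤ ENNReal.ofReal (A + e) ^ (1 / p) + ENNReal.ofReal η := by
        rw [hcost π P hP.nonneg hπP]
        gcongr
      _ ≤ (ENNReal.ofReal A ^ (1 / p) + ENNReal.ofReal e ^ (1 / p)) + ENNReal.ofReal η := by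
        rw [ENNReal.ofReal_add hA he]
        gcongr
        exact ENNReal.rpow_add_le_add_rpow _ _ hp1 hp2
      _ = _ := by
        rw [hA', he', ← ENNReal.ofReal_add hAp hep, ← ENNReal.ofReal_add (by positivity) hη]
        congr 1; ring
  -- Conversely, every coupling induces a plan, whose cost is at least `A - e`.
  have lower : ENNReal.ofReal (A ^ (1 / p)) ≤
      wasserstein p μ ν + ENNReal.ofReal (η + e ^ (1 / p)) := by
    rw [wasserstein_eq_iInf hp0]
    simp only [ENNReal.iInf_add]
    refine le_iInf₂ fun π hπ => ?_
    have := isProbabilityMeasure_of_mem_couplings hπ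
    have hP := isPlan_of_coupling hcell hπ
    have hle := hlow _ hP
    set S := ∑ i, ∑ j, π.real ((cell ⁻¹' {i}) ×ˢ (cell ⁻¹' {j})) * δ i j ^ p with hS
    calc ENNReal.ofReal (A ^ (1 / p)) = ENNReal.ofReal A ^ (1 / p) := hA'.symm
      _ ≤ ENNReal.ofReal (S + e) ^ (1 / p) := by gcongr
      _ ≤ ENNReal.ofReal S ^ (1 / p) + ENNReal.ofReal e ^ (1 / p) := by
        rw [ENNReal.ofReal_add (Finset.sum_nonneg fun i _ => Finset.sum_nonneg fun j _ =>
          mul_nonneg (hP.nonneg i j) (Real.rpow_nonneg (hδ i j) p)) he]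
        exact ENNReal.rpow_add_le_add_rpow _ _ hp1 hp2
      _ ≤ ((∫⁻ z, edist z.1 z.2 ^ p ∂π) ^ (1 / p) + ENNReal.ofReal η) +
          ENNReal.ofReal e ^ (1 / p) := by
        rw [hS, ← hcost π _ hP.nonneg fun i j => (ofReal_measureReal).symm]
        gcongr
        refine lintegral_const_add_rpow_le hp
          (measurable_fst.edist measurable_snd).aemeasurable _ fun z => ?_
        rw [edist_dist, ← ENNReal.ofReal_add dist_nonneg hη]
        exact ENNReal.ofReal_le_ofReal (h₂ _ _)
      _ = _ := by rw [he', add_assoc, ENNReal.ofReal_add hη hep]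
  have hfin : wasserstein p μ ν ≠ ∞ := ne_top_of_le_ne_top ENNReal.ofReal_ne_top upper
  have upper' := ENNReal.toReal_le_of_le_ofReal (by positivity) upper
  have lower' : A ^ (1 / p) ≤ (wasserstein p μ ν).toReal + (η + e ^ (1 / p)) := by
    have h := ENNReal.toReal_mono (ENNReal.add_ne_top.mpr ⟨hfin, ENNReal.ofReal_ne_top⟩) lower
    rwa [ENNReal.toReal_add hfin ENNReal.ofReal_ne_top, ENNReal.toReal_ofReal hAp,
      ENNReal.toReal_ofReal (by positivity)] at h
  rw [abs_le]
  constructor <;> linarith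

end Estimate

end Wasserstein

/-! ### The geometry of the cells -/

theorem standardBorelSpace_cube (d : ℕ) : StandardBorelSpace (Cube d) := by
  have h : IsClosed {x : EuclideanSpace ℝ (Fin d) | ∀ i, x i ∈ Set.Icc (0 : ℝ) 1} := by
    simp only [Set.ofPred_forall]
    exact isClosed_iInter fun i => isClosed_Icc.preimage (by fun_prop)
  exact h.measurableSet.standardBorel

theorem measurable_cellOf {d : ℕ} (m : ℕ) : Measurable (cellOf m : Cube d → ℕ) := by
  unfold cellOf cellNum
  refine Finset.measurable_sum _ fun l hl => ?_
  have hl' : l < d := Finset.mem_range.mp hl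
  simp only [hl', dif_pos]
  have : Measurable fun x : Cube d => x.1 ⟨l, hl'⟩ := by fun_prop
  exact (((this.mul_const _).nat_ceil).sub_const 1).mul_const _

/-- The cell of a point, as a bounded number. -/
def cellFin {d m : ℕ} (hm : 0 < m) (x : Cube d) : Fin (m ^ d) := ⟨cellOf m x, cellOf_lt hm x⟩

theorem measurable_cellFin {d m : ℕ} (hm : 0 < m) :
    Measurable (cellFin hm : Cube d → Fin (m ^ d)) := by
  refine measurable_to_countable' fun i => ?_
  have : cellFin hm ⁻¹' {i} = (cellOf m : Cube d → ℕ) ⁻¹' {(i : ℕ)} := by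
    ext x; simp [cellFin, Fin.ext_iff]
  rw [this]
  exact measurable_cellOf m (measurableSet_singleton _)

/-- The distance of two cells. -/
def cellDist (m d i j : ℕ) : ℝ := √(cellSqDist m d i j : ℝ) / m

theorem cellDist_nonneg (m d i j : ℕ) : 0 ≤ cellDist m d i j := by unfold cellDist; positivity

theorem cast_trunc_sub_sq (a b : ℕ) :
    (((a - b + (b - a)) ^ 2 : ℕ) : ℝ) = ((a : ℝ) - b) ^ 2 := by
  rcases le_total a b with h | h
  · rw [Nat.sub_eq_zero_of_le h, zero_add]; push_cast [h]; ring
  · rw [Nat.sub_eq_zero_of_le h, add_zero]; push_cast [h]; ring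

/-- The vertex of a cell with the largest coordinates. -/
def cellVertex (m d i : ℕ) : EuclideanSpace ℝ (Fin d) :=
  WithLp.toLp 2 fun l => ((cellDigit m i l : ℝ) + 1) / m

theorem dist_cellVertex (m d i j : ℕ) :
    dist (cellVertex m d i) (cellVertex m d j) = cellDist m d i j := by
  rw [EuclideanSpace.dist_eq, cellDist, cellSqDist]
  have h : ∀ s : ℝ, s / m = s / √((m : ℝ) ^ 2) := fun s => by
    rw [Real.sqrt_sq (Nat.cast_nonneg m)]
  rw [h, ← Real.sqrt_div (by positivity), Nat.cast_sum, Finset.sum_range, Finset.sum_div]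
  congr 1
  refine Finset.sum_congr rfl fun l _ => ?_
  rw [cast_trunc_sub_sq, Real.dist_eq, sq_abs, ← div_pow]
  congr 1
  simp only [cellVertex]
  ring

theorem dist_cellVertex_cellOf {d m : ℕ} (hm : 0 < m) (x : Cube d) :
    dist x.1 (cellVertex m d (cellOf m x)) ≤ √d / m := by
  have hm' : (0 : ℝ) < m := by exact_mod_cast hm
  rw [EuclideanSpace.dist_eq]
  have h : ∀ l : Fin d, dist (x.1 l) (cellVertex m d (cellOf m x) l) ^ 2 ≤ (1 / (m : ℝ)) ^ 2 := by
    intro l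
    have hx := x.2 l
    have hdig : cellDigit m (cellOf m x) l = ⌈x.1 l * m⌉₊ - 1 := by
      rw [cellOf, cellDigit_cellNum hm _ l.2]
      · simp
      · intro k hk; simpa [hk] using (x.2 ⟨k, hk⟩).2
    refine pow_le_pow_left₀ dist_nonneg ?_ 2
    simp only [cellVertex, hdig]
    rw [Real.dist_eq, ← mul_le_mul_iff_left₀ hm', ← abs_of_pos hm', ← abs_mul, abs_of_pos hm',
      sub_mul, div_mul_cancel₀ _ hm'.ne', div_mul_cancel₀ _ hm'.ne']
    have h0 : 0 ≤ x.1 l * m := mul_nonneg hx.1 hm'.le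
    have h1 := Nat.le_ceil (x.1 l * m)
    have h2 := Nat.ceil_lt_add_one h0
    -- For a coordinate 0 the truncated subtraction keeps the digit 0, and the distance to the
    -- vertex is exactly `1 / m`.
    rcases Nat.eq_zero_or_pos ⌈x.1 l * m⌉₊ with hc | hc
    · rw [hc] at h1 ⊢
      rw [abs_le]
      constructor <;> norm_num at h1 ⊢ <;> linarith
    · rw [Nat.cast_sub hc, Nat.cast_one, sub_add_cancel, abs_le]
      constructor <;> linarith
  refine (Real.sqrt_le_sqrt (Finset.sum_le_sum fun l _ => h l)).trans (le_of_eq ?_)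
  rw [Finset.sum_const, Finset.card_univ, Fintype.card_fin, nsmul_eq_mul,
    Real.sqrt_mul (by positivity), Real.sqrt_sq (by positivity)]
  ring

theorem dist_le_cellDist {d m : ℕ} (hm : 0 < m) (x y : Cube d) :
    dist x y ≤ cellDist m d (cellOf m x) (cellOf m y) + 2 * √d / m := by
  have hx := dist_cellVertex_cellOf hm x
  have hy := dist_cellVertex_cellOf hm y
  rw [dist_comm] at hy
  have := dist_triangle4 x.1 (cellVertex m d (cellOf m x)) (cellVertex m d (cellOf m y)) y.1
  rw [dist_cellVertex] at this
  rw [Subtype.dist_eq, mul_div_assoc]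
  linarith

theorem cellDist_le_dist {d m : ℕ} (hm : 0 < m) (x y : Cube d) :
    cellDist m d (cellOf m x) (cellOf m y) ≤ dist x y + 2 * √d / m := by
  have hx := dist_cellVertex_cellOf hm x
  have hy := dist_cellVertex_cellOf hm y
  rw [dist_comm] at hx
  have := dist_triangle4 (cellVertex m d (cellOf m x)) x.1 y.1 (cellVertex m d (cellOf m y))
  rw [dist_cellVertex] at this
  rw [Subtype.dist_eq, mul_div_assoc]
  linarith

theorem cellDist_le {m : ℕ} (hm : 0 < m) (d i j : ℕ) : cellDist m d i j ≤ √d := by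
  have hm' : (0 : ℝ) < m := by exact_mod_cast hm
  rw [cellDist, div_le_iff₀ hm']
  have : (m : ℝ) = √((m : ℝ) ^ 2) := (Real.sqrt_sq hm'.le).symm
  rw [this, ← Real.sqrt_mul (Nat.cast_nonneg d)]
  refine Real.sqrt_le_sqrt ?_
  have h : cellSqDist m d i j ≤ d * m ^ 2 := by
    refine (Finset.sum_le_card_nsmul _ _ (m ^ 2) fun l _ => ?_).trans (by simp)
    have h1 : cellDigit m i l < m := Nat.mod_lt _ hm
    have h2 : cellDigit m j l < m := Nat.mod_lt _ hm
    exact Nat.pow_le_pow_left (by omega) 2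
  exact_mod_cast h

/-- The machine computes the `p`-th power of the distance as the power `p / 2` of its square, which
avoids a root. -/
theorem cellCost_eq {m : ℕ} (hm : 0 < m) (L d : ℕ) {p : ℝ} (hp : 0 < p) (i j : ℕ) :
    cellCost m L d p i j = ⌈cellDist m d i j ^ p * L⌉₊ := by
  have hm' : (0 : ℝ) < m := by exact_mod_cast hm
  rw [cellCost, cellDist]
  split
  · rename_i h
    have h' : (0 : ℝ) < cellSqDist m d i j := by exact_mod_cast h
    have h2 : (0 : ℝ) < cellSqDist m d i j / ((m * m : ℕ) : ℝ) := by push_cast; positivity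
    rw [← Real.rpow_def_of_pos h2]
    congr 2
    have : √(cellSqDist m d i j : ℝ) / m = √(cellSqDist m d i j / ((m * m : ℕ) : ℝ)) := by
      rw [Nat.cast_mul, Real.sqrt_div h'.le, Real.sqrt_mul_self hm'.le]
    rw [this, Real.sqrt_eq_rpow, ← Real.rpow_mul h2.le]
    congr 1
    ring
  · rename_i h
    rw [Nat.eq_zero_of_not_pos h]
    simp [Real.zero_rpow hp.ne']

/-- A bound for the `p`-th power of the distance of two cells. -/
def costBound (d : ℕ) (p : ℝ) : ℕ := ⌈√(d : ℝ) ^ p⌉₊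

theorem cellDist_rpow_le {m : ℕ} (hm : 0 < m) (d : ℕ) {p : ℝ} (hp : 0 < p) (i j : ℕ) :
    cellDist m d i j ^ p ≤ costBound d p :=
  (Real.rpow_le_rpow (cellDist_nonneg _ _ _ _) (cellDist_le hm d i j) hp.le).trans (Nat.le_ceil _)

theorem cellCost_le {m : ℕ} (hm : 0 < m) (L d : ℕ) {p : ℝ} (hp : 0 < p) (i j : ℕ) :
    cellCost m L d p i j ≤ costBound d p * L := by
  rw [cellCost_eq hm L d hp]
  refine Nat.ceil_le.mpr ?_
  push_cast
  exact mul_le_mul_of_nonneg_right (cellDist_rpow_le hm d hp i j) (Nat.cast_nonneg L)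

/-! ### Empirical frequencies -/

section Frequencies

variable {E : Type*} [MeasurableSpace E]

theorem measurable_card_filter {s : Set E} (hs : MeasurableSet s) (q : E → Prop)
    [DecidablePred q] (hq : ∀ x, q x ↔ x ∈ s) (N : ℕ) : Measurable fun ω : ℕ → E =>
      (((Finset.range N).filter fun k => q (ω k)).card : ℝ) := by
  have h : (fun ω : ℕ → E => (((Finset.range N).filter fun k => q (ω k)).card : ℝ)) =
      fun ω => ∑ k ∈ Finset.range N, s.indicator (fun _ => (1 : ℝ)) (ω k) := by
    ext ω
    rw [Finset.card_filter]
    push_cast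
    exact Finset.sum_congr rfl fun k _ => by by_cases h : ω k ∈ s <;> simp [hq, h]
  rw [h]
  exact Finset.measurable_fun_sum _ fun k _ =>
    (measurable_const.indicator hs).comp (measurable_pi_apply k)

/-- The mean square error of the frequency of an event. -/
theorem lintegral_frequency_sub_sq_le (ρ : Measure E) [IsProbabilityMeasure ρ] {s : Set E}
    (hs : MeasurableSet s) (q : E → Prop) [DecidablePred q] (hq : ∀ x, q x ↔ x ∈ s) {N : ℕ}
    (hN : 0 < N) :
    ∫⁻ ω, ENNReal.ofReal
        (((((Finset.range N).filter fun k => q (ω k)).card : ℝ) / N - ρ.real s) ^ 2)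
      ∂(Measure.infinitePi fun _ : ℕ => ρ) ≤ ENNReal.ofReal (ρ.real s / N) := by
  set Q := Measure.infinitePi fun _ : ℕ => ρ with hQ
  have hN' : (0 : ℝ) < N := by exact_mod_cast hN
  set g : E → ℝ := s.indicator fun _ => 1 with hg
  have hgm : Measurable g := measurable_const.indicator hs
  have hgL : MemLp g 2 ρ := memLp_indicator_const 2 hs 1 (Or.inr (measure_ne_top _ _))
  have hmp : ∀ k, MeasurePreserving (fun ω : ℕ → E => ω k) Q ρ := fun k =>
    measurePreserving_eval_infinitePi (fun _ => ρ) k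
  have hgi : ∫ x, g x ∂ρ = ρ.real s := by simp [hg, integral_indicator_const (1 : ℝ) hs]
  set X : ℕ → (ℕ → E) → ℝ := fun k ω => g (ω k) with hX
  have hXL : ∀ k, MemLp (X k) 2 Q := fun k => hgL.comp_measurePreserving (hmp k)
  have hXi : ∀ k, ∫ ω, X k ω ∂Q = ρ.real s := fun k => by
    rw [← hgi, ← (hmp k).map_eq, integral_map (measurable_pi_apply k).aemeasurable
      hgm.aestronglyMeasurable]
  -- The variance of an indicator is at most its second moment, which is its mean.
  have hXv : ∀ k, Var[X k; Q] ≤ ρ.real s := fun k => by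
    refine (variance_le_expectation_sq (hXL k).aestronglyMeasurable).trans (le_of_eq ?_)
    rw [← hXi k]
    refine integral_congr_ae (Eventually.of_forall fun ω => ?_)
    by_cases h : ω k ∈ s <;> simp [hX, hg, h]
  have hind : iIndepFun X Q := iIndepFun_infinitePi (X := fun _ => g) fun _ => hgm
  set Y : (ℕ → E) → ℝ := ∑ k ∈ Finset.range N, X k with hY
  have hYL : MemLp Y 2 Q := memLp_finsetSum' _ fun k _ => hXL k
  have hYcard : ∀ ω, (((Finset.range N).filter fun k => q (ω k)).card : ℝ) = Y ω := fun ω => by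
    rw [hY, Finset.sum_apply, Finset.card_filter]
    push_cast
    exact Finset.sum_congr rfl fun k _ => by by_cases h : ω k ∈ s <;> simp [hX, hg, hq, h]
  have hYv : Var[Y; Q] ≤ N * ρ.real s := by
    rw [hY, IndepFun.variance_sum (fun k _ => hXL k) fun i _ j _ hij => hind.indepFun hij]
    exact (Finset.sum_le_card_nsmul _ _ _ fun k _ => hXv k).trans (by simp)
  have hYi : ∫ ω, Y ω ∂Q = N * ρ.real s := by
    simp only [hY, Finset.sum_apply]
    rw [integral_finsetSum _ fun k _ => (hXL k).integrable (by norm_num)]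
    simp [hXi]
  have hsq : ∀ ω, (Y ω / N - ρ.real s) ^ 2 = (Y ω - ∫ ω, Y ω ∂Q) ^ 2 / N ^ 2 := fun ω => by
    rw [hYi, ← div_pow, sub_div, mul_div_cancel_left₀ _ hN'.ne']
  simp only [hYcard, hsq]
  have hint : Integrable (fun ω => (Y ω - ∫ ω, Y ω ∂Q) ^ 2 / (N : ℝ) ^ 2) Q :=
    ((hYL.sub (memLp_const _)).integrable_sq).div_const _
  rw [← ofReal_integral_eq_lintegral_ofReal hint (Eventually.of_forall fun ω => by positivity)]
  refine ENNReal.ofReal_le_ofReal ?_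
  rw [integral_div, ← variance_eq_integral hYL.aemeasurable, div_le_div_iff₀ (by positivity) hN']
  calc Var[Y; Q] * N ≤ (N * ρ.real s) * N := by gcongr
    _ = ρ.real s * N ^ 2 := by ring

variable {M : ℕ} {cell : E → Fin M}

/-- The total deviation of the empirical frequencies of the cells. -/
def deviation (cell : E → Fin M) (ρ : Measure E) (N : ℕ) (ω : ℕ → E) : ℝ :=
  ∑ i, |(((Finset.range N).filter fun k => cell (ω k) = i).card : ℝ) / N -
    ρ.real (cell ⁻¹' {i})|

theorem deviation_nonneg (cell : E → Fin M) (ρ : Measure E) (N : ℕ) (ω : ℕ → E) :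
    0 ≤ deviation cell ρ N ω := Finset.sum_nonneg fun _ _ => abs_nonneg _

theorem measurable_deviation (hcell : Measurable cell) (ρ : Measure E) (N : ℕ) :
    Measurable (deviation cell ρ N) := by
  refine Finset.measurable_fun_sum _ fun i _ => ?_
  have h := measurable_card_filter (hcell (measurableSet_singleton i)) (fun x => cell x = i)
    (fun x => Iff.rfl) N
  exact ((h.div_const _).sub_const _).abs

/-- Bound `|X|` by `λ X² / 2 + 1 / (2 λ)` with `λ = M L`. As the mean squares sum to at most `1 /
N`, the two terms contribute `λ / (2 N) = 1 / (2 L)` and `M / (2 λ) = 1 / (2 L)`. -/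
theorem lintegral_deviation_le (hcell : Measurable cell) (ρ : Measure E) [IsProbabilityMeasure ρ]
    {L : ℕ} (hM : 0 < M) (hL : 0 < L) :
    ∫⁻ ω, ENNReal.ofReal (deviation cell ρ (M * L * L) ω)
      ∂(Measure.infinitePi fun _ : ℕ => ρ) ≤ ENNReal.ofReal (1 / L) := by
  have hM' : (0 : ℝ) < M := by exact_mod_cast hM
  have hL' : (0 : ℝ) < L := by exact_mod_cast hL
  set N := M * L * L with hN
  have hNpos : 0 < N := by positivity
  have hNr : (N : ℝ) = M * L * L := by rw [hN]; push_cast; ring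
  set lam : ℝ := M * L with hlam
  have hlam0 : 0 < lam := by positivity
  set X : Fin M → (ℕ → E) → ℝ := fun i ω =>
    (((Finset.range N).filter fun k => cell (ω k) = i).card : ℝ) / N -
      ρ.real (cell ⁻¹' {i}) with hX
  have hXm : ∀ i, Measurable (X i) := fun i =>
    ((measurable_card_filter (hcell (measurableSet_singleton i)) (fun x => cell x = i)
      (fun x => Iff.rfl) N).div_const _).sub_const _
  have hpt : ∀ ω, ENNReal.ofReal (deviation cell ρ N ω) ≤
      ∑ i, (ENNReal.ofReal (lam / 2) * ENNReal.ofReal (X i ω ^ 2) +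
        ENNReal.ofReal (1 / (2 * lam))) := fun ω => by
    rw [deviation, ENNReal.ofReal_sum_of_nonneg fun _ _ => abs_nonneg _]
    refine Finset.sum_le_sum fun i _ => ?_
    rw [← ENNReal.ofReal_mul (by positivity), ← ENNReal.ofReal_add (by positivity) (by positivity)]
    refine ENNReal.ofReal_le_ofReal ?_
    change |X i ω| ≤ _
    have h : 0 ≤ (lam * |X i ω| - 1) ^ 2 / (2 * lam) := by positivity
    have e : (lam * |X i ω| - 1) ^ 2 / (2 * lam) =
        lam / 2 * X i ω ^ 2 + 1 / (2 * lam) - |X i ω| := by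
      rw [← sq_abs (X i ω)]
      field_simp
      ring
    linarith
  refine (lintegral_mono hpt).trans ?_
  rw [lintegral_finsetSum _ fun i _ =>
    (((hXm i).pow_const 2).ennreal_ofReal.const_mul _).add_const _]
  have hterm : ∀ i, ∫⁻ ω, (ENNReal.ofReal (lam / 2) * ENNReal.ofReal (X i ω ^ 2) +
      ENNReal.ofReal (1 / (2 * lam))) ∂(Measure.infinitePi fun _ : ℕ => ρ) ≤
      ENNReal.ofReal (lam / 2 * (ρ.real (cell ⁻¹' {i}) / N) + 1 / (2 * lam)) := fun i => by
    rw [lintegral_add_right _ measurable_const,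
      lintegral_const_mul _ ((hXm i).pow_const 2).ennreal_ofReal, lintegral_const, measure_univ,
      mul_one, ENNReal.ofReal_add (by positivity) (by positivity),
      ENNReal.ofReal_mul (by positivity)]
    gcongr
    exact lintegral_frequency_sub_sq_le ρ (hcell (measurableSet_singleton i))
      (fun x => cell x = i) (fun x => Iff.rfl) hNpos
  refine (Finset.sum_le_sum fun i _ => hterm i).trans ?_
  rw [← ENNReal.ofReal_sum_of_nonneg fun i _ => by positivity]
  refine ENNReal.ofReal_le_ofReal (le_of_eq ?_)
  rw [Finset.sum_add_distrib, ← Finset.mul_sum, ← Finset.sum_div, sum_measureReal_cells hcell,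
    Finset.sum_const, Finset.card_univ, Fintype.card_fin, nsmul_eq_mul, hNr, hlam]
  field_simp
  norm_num

end Frequencies

/-! ### Accuracy -/

/-- `(s / t) ^ q` is at most 1 or at most `s / t`. This linearizes the `p`-th root around the
typical size `t` of the error, so that expectations can be taken term by term. -/
theorem rpow_le_rpow_mul_one_add_div {s t q : ℝ} (hs : 0 ≤ s) (ht : 0 < t) (hq : 0 ≤ q)
    (hq1 : q ≤ 1) : s ^ q ≤ t ^ q * (1 + s / t) := by
  have h : (s / t) ^ q ≤ 1 + s / t := by
    have h0 : 0 ≤ s / t := by positivity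
    rcases le_total (s / t) 1 with h1 | h1
    · exact (Real.rpow_le_one h0 h1 hq).trans (by linarith)
    · have := Real.rpow_le_rpow_of_exponent_le h1 hq1
      rw [Real.rpow_one] at this
      linarith
  calc s ^ q = t ^ q * (s / t) ^ q := by
        rw [← Real.mul_rpow ht.le (by positivity), mul_div_cancel₀ _ ht.ne']
    _ ≤ _ := by gcongr

theorem wasserstein_ne_top {d : ℕ} {p : ℝ} (hp : 0 < p) (μ ν : Measure (Cube d))
    [IsProbabilityMeasure μ] [IsProbabilityMeasure ν] : wasserstein p μ ν ≠ ∞ := by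
  have hπ : μ.prod ν ∈ couplings μ ν := ⟨by simp, by simp⟩
  refine ne_top_of_le_ne_top ?_ (wasserstein_le hp hπ)
  refine ENNReal.rpow_ne_top_of_nonneg (by positivity) ?_
  -- The estimate for a single cell (`m = 1`) serves as a bound for the diameter of the cube.
  have h : ∀ z : Cube d × Cube d, edist z.1 z.2 ^ p ≤ ENNReal.ofReal (√d + 2 * √d / (1 : ℕ)) ^ p :=
    fun z => by
      rw [edist_dist]
      gcongr
      exact (dist_le_cellDist one_pos z.1 z.2).trans (by gcongr; exact cellDist_le one_pos _ _ _)
  refine ne_top_of_le_ne_top ?_ (lintegral_mono h)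
  rw [lintegral_const, measure_univ, mul_one]
  exact ENNReal.rpow_ne_top_of_nonneg hp.le ENNReal.ofReal_ne_top

theorem ofReal_abs_sub_toReal_le {w : ℝ} {a b c : ℝ≥0∞} (ha : a ≠ ∞) (hb : b ≠ ∞)
    (h₁ : a ≤ b + c) (h₂ : b ≤ a + c) :
    ENNReal.ofReal |w - a.toReal| ≤ ENNReal.ofReal |w - b.toReal| + c := by
  by_cases hc : c = ∞
  · simp [hc]
  have h₁' := ENNReal.toReal_mono (ENNReal.add_ne_top.mpr ⟨hb, hc⟩) h₁
  have h₂' := ENNReal.toReal_mono (ENNReal.add_ne_top.mpr ⟨ha, hc⟩) h₂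
  rw [ENNReal.toReal_add hb hc] at h₁'
  rw [ENNReal.toReal_add ha hc] at h₂'
  rw [← ENNReal.ofReal_toReal hc, ← ENNReal.ofReal_add (abs_nonneg _) ENNReal.toReal_nonneg]
  refine ENNReal.ofReal_le_ofReal ?_
  have h : |b.toReal - a.toReal| ≤ c.toReal := by rw [abs_le]; constructor <;> linarith
  calc |w - a.toReal| ≤ |w - b.toReal| + |b.toReal - a.toReal| := abs_sub_le _ _ _
    _ ≤ _ := by gcongr

/-- The number that the program computes. -/
def estimate (d : ℕ) (p γ : ℝ) {n : ℕ} (e : Env d n) : ℝ :=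
  ((mainCode d p γ (costBound d p)).den e .zero).x

theorem sum_abs_cellCount_eq {d m : ℕ} (hm : 0 < m) (f : ℕ → Cube d) (ρ : Measure (Cube d))
    (N : ℕ) :
    ∑ i : Fin (m ^ d), |(cellCount m f N i : ℝ) / (N : ℝ) - ρ.real (cellFin hm ⁻¹' {i})| =
      deviation (cellFin hm) ρ N f := by
  refine Finset.sum_congr rfl fun i _ => ?_
  simp only [cellCount_eq, cellFin, Fin.ext_iff]

/-- A deterministic bound for every outcome of the draws; chance enters only through the two
deviations. -/
theorem abs_estimate_sub_wasserstein_le {d n : ℕ} (hn : 0 < n) {p γ : ℝ} (hp : 1 ≤ p) {m L : ℕ}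
    (hm : m = ⌈(n : ℝ) ^ (γ / d)⌉₊) (hL : L = ⌈(n : ℝ) ^ (γ * p / d)⌉₊) (hm0 : 0 < m)
    (hL0 : 0 < L) (ν ρ : Measure (Cube d)) [IsProbabilityMeasure ν] [IsProbabilityMeasure ρ]
    (e : Env d n) :
    |estimate d p γ e - (wasserstein p ν ρ).toReal| ≤
      2 * √d / m + ((8 * costBound d p + 6) *
        (deviation (cellFin hm0) ν (m ^ d * L * L) e.refDraw +
          deviation (cellFin hm0) ρ (m ^ d * L * L) e.estDraw + 1 / L)) ^ (1 / p) := by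
  have hp0 : 0 < p := by linarith
  have hR0 : (0 : ℝ) ≤ 8 * costBound d p + 6 := by positivity
  have hL1 : (0 : ℝ) ≤ 1 / L := by positivity
  have hη : 0 ≤ 2 * √(d : ℝ) / m := by positivity
  obtain ⟨⟨F, q, hF, hx⟩, -⟩ := Code.main_spec e 0 hn hp0 hm hL
    (fun i _ j _ => cellCost_le hm0 L d hp0 i j)
  have hcell := measurable_cellFin (d := d) hm0
  have hE := hF.estimate (pow_pos hm0 d) hL0 (sum_cellCount hm0 _ _) (sum_cellCount hm0 _ _)
    (K := fun i j => cellDist m d i j ^ p)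
    (fun i j => Real.rpow_nonneg (cellDist_nonneg _ _ _ _) _)
    (fun i j => cellDist_rpow_le hm0 d hp0 i j) (fun i j => cellCost_eq hm0 L d hp0 i j)
    (ρ := fun i => ν.real (cellFin hm0 ⁻¹' {i})) (ν := fun i => ρ.real (cellFin hm0 ⁻¹' {i}))
    (fun i => measureReal_nonneg) (fun i => measureReal_nonneg)
    (sum_measureReal_cells hcell ν) (sum_measureReal_cells hcell ρ) rfl rfl
  rw [sum_abs_cellCount_eq hm0, sum_abs_cellCount_eq hm0] at hE
  rw [estimate, hx]
  generalize hA : ((∑ i ∈ Finset.range (m ^ d), ∑ j ∈ Finset.range (m ^ d),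
    F i j * cellCost m L d p i j : ℕ) : ℝ) / ((m ^ d * L * L : ℕ) : ℝ) = A at hE ⊢
  have hA0 : 0 ≤ A := hA ▸ div_nonneg (Nat.cast_nonneg _) (Nat.cast_nonneg _)
  have h1 := deviation_nonneg (cellFin hm0) ν (m ^ d * L * L) e.refDraw
  have h2 := deviation_nonneg (cellFin hm0) ρ (m ^ d * L * L) e.estDraw
  have hB0 : 0 ≤ (8 * (costBound d p : ℝ) + 6) *
      (deviation (cellFin hm0) ν (m ^ d * L * L) e.refDraw +
        deviation (cellFin hm0) ρ (m ^ d * L * L) e.estDraw + 1 / L) :=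
    mul_nonneg hR0 (add_nonneg (add_nonneg h1 h2) hL1)
  have hup : ∀ x y : Cube d, dist x y ≤
      cellDist m d (cellFin hm0 x : ℕ) (cellFin hm0 y : ℕ) + 2 * √d / m :=
    fun x y => dist_le_cellDist hm0 x y
  have hlow : ∀ x y : Cube d, cellDist m d (cellFin hm0 x : ℕ) (cellFin hm0 y : ℕ) ≤
      dist x y + 2 * √d / m := fun x y => cellDist_le_dist hm0 x y
  exact abs_sub_wasserstein_le hcell hp (δ := fun i j : Fin (m ^ d) => cellDist m d i j)
    (fun i j => cellDist_nonneg _ _ _ _) hη hup hlow hA0 hB0 hE.1 hE.2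

theorem lintegral_estimate_le {d n : ℕ} (hn : 0 < n) {p γ : ℝ} (hp : 1 ≤ p)
    (x : Fin n → Cube d) (ν ρ : Measure (Cube d)) [IsProbabilityMeasure ν]
    [IsProbabilityMeasure ρ] :
    ∫⁻ z, ∫⁻ y, ENNReal.ofReal |estimate d p γ (⟨x, z, y⟩ : Env d n) - (wasserstein p ν ρ).toReal|
        ∂(Measure.infinitePi fun _ : ℕ => ν) ∂(Measure.infinitePi fun _ : ℕ => ρ) ≤
      ENNReal.ofReal ((2 * √d + 1 + 3 * (8 * costBound d p + 6)) * (n : ℝ) ^ (-(γ / d))) := by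
  have hp0 : 0 < p := by linarith
  have hn' : (0 : ℝ) < n := by exact_mod_cast hn
  obtain ⟨m, hm⟩ : ∃ m, m = ⌈(n : ℝ) ^ (γ / d)⌉₊ := ⟨_, rfl⟩
  obtain ⟨L, hL⟩ : ∃ L, L = ⌈(n : ℝ) ^ (γ * p / d)⌉₊ := ⟨_, rfl⟩
  have hm0 : 0 < m := by rw [hm]; exact Nat.ceil_pos.mpr (by positivity)
  have hL0 : 0 < L := by rw [hL]; exact Nat.ceil_pos.mpr (by positivity)
  have hm' : (0 : ℝ) < m := by exact_mod_cast hm0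
  have hL' : (0 : ℝ) < L := by exact_mod_cast hL0
  have hM0 : 0 < m ^ d := pow_pos hm0 d
  set B : ℝ := (n : ℝ) ^ (-(γ / d)) with hB
  have hB0 : 0 < B := by positivity
  set R : ℝ := 8 * costBound d p + 6 with hR
  have hR0 : 0 < R := by positivity
  have hmB : 1 / (m : ℝ) ≤ B := by
    rw [hB, Real.rpow_neg hn'.le, ← one_div]
    exact one_div_le_one_div_of_le (by positivity) (hm ▸ Nat.le_ceil _)
  have hLB : (1 / (L : ℝ)) ^ (1 / p) ≤ B := by
    have h1 : 1 / (L : ℝ) ≤ (n : ℝ) ^ (-(γ * p / d)) := by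
      rw [Real.rpow_neg hn'.le, ← one_div]
      exact one_div_le_one_div_of_le (by positivity) (hL ▸ Nat.le_ceil _)
    refine (Real.rpow_le_rpow (by positivity) h1 (by positivity)).trans (le_of_eq ?_)
    rw [← Real.rpow_mul hn'.le, hB]
    congr 1
    field_simp
  have hpt : ∀ z y : ℕ → Cube d, ENNReal.ofReal |estimate d p γ (⟨x, z, y⟩ : Env d n) -
      (wasserstein p ν ρ).toReal| ≤
      ENNReal.ofReal (B * R * L) * ENNReal.ofReal (deviation (cellFin hm0) ν (m ^ d * L * L) y) +
      (ENNReal.ofReal (B * R * L) * ENNReal.ofReal (deviation (cellFin hm0) ρ (m ^ d * L * L) z) +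
        ENNReal.ofReal (B * (2 * √d + 1 + R))) := by
    intro z y
    have h1 := deviation_nonneg (cellFin hm0) ν (m ^ d * L * L) y
    have h2 := deviation_nonneg (cellFin hm0) ρ (m ^ d * L * L) z
    have hest := abs_estimate_sub_wasserstein_le hn hp hm hL hm0 hL0 ν ρ (⟨x, z, y⟩ : Env d n)
    rw [← ENNReal.ofReal_mul (by positivity), ← ENNReal.ofReal_mul (by positivity),
      ← ENNReal.ofReal_add (by positivity) (by positivity),
      ← ENNReal.ofReal_add (by positivity) (by positivity)]
    refine ENNReal.ofReal_le_ofReal (hest.trans ?_)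
    have hpow := rpow_le_rpow_mul_one_add_div (s := R * (deviation (cellFin hm0) ν (m ^ d * L * L) y +
      deviation (cellFin hm0) ρ (m ^ d * L * L) z + 1 / L)) (t := 1 / L) (q := 1 / p)
      (by positivity) (by positivity) (by positivity) ((div_le_one hp0).mpr hp)
    have hfac : 0 ≤ 1 + R * (deviation (cellFin hm0) ν (m ^ d * L * L) y +
      deviation (cellFin hm0) ρ (m ^ d * L * L) z + 1 / L) / (1 / L) := by positivity
    have h3 := mul_le_mul_of_nonneg_right hLB hfac
    have h4 : 2 * √d / m ≤ 2 * √d * B := by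
      rw [div_eq_mul_one_div]; gcongr
    have h5 : B * (1 + R * (deviation (cellFin hm0) ν (m ^ d * L * L) y +
        deviation (cellFin hm0) ρ (m ^ d * L * L) z + 1 / L) / (1 / L)) =
        B * R * L * deviation (cellFin hm0) ν (m ^ d * L * L) y +
        B * R * L * deviation (cellFin hm0) ρ (m ^ d * L * L) z + B * (1 + R) := by
      field_simp
      ring
    linarith
  have hmeas : ∀ ρ : Measure (Cube d), Measurable fun y =>
      ENNReal.ofReal (B * R * L) *
        ENNReal.ofReal (deviation (cellFin hm0) ρ (m ^ d * L * L) y) := fun ρ =>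
    ((measurable_deviation (measurable_cellFin hm0) ρ _).ennreal_ofReal).const_mul _
  have hdev : ∀ (ρ : Measure (Cube d)) [IsProbabilityMeasure ρ],
      ∫⁻ y, ENNReal.ofReal (B * R * L) *
        ENNReal.ofReal (deviation (cellFin hm0) ρ (m ^ d * L * L) y)
        ∂(Measure.infinitePi fun _ : ℕ => ρ) ≤ ENNReal.ofReal (B * R) := fun ρ _ => by
    rw [lintegral_const_mul _ (measurable_deviation (measurable_cellFin hm0) ρ _).ennreal_ofReal]
    refine (mul_le_mul_right (lintegral_deviation_le (measurable_cellFin hm0) ρ hM0 hL0)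
      _).trans (le_of_eq ?_)
    rw [← ENNReal.ofReal_mul (by positivity)]
    congr 1
    field_simp
  refine (lintegral_mono fun z => lintegral_mono fun y => hpt z y).trans ?_
  simp only [lintegral_add_right _ measurable_const, lintegral_const, measure_univ, mul_one]
  rw [lintegral_add_left measurable_const, lintegral_add_right _ measurable_const]
  simp only [lintegral_const, measure_univ, mul_one]
  -- Each deviation contributes `B R`, and the constant part another `B R`; this is the factor 3.
  refine (add_le_add (hdev ν) (add_le_add (hdev ρ) le_rfl)).trans (le_of_eq ?_)
  rw [← ENNReal.ofReal_add (by positivity) (by positivity),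
    ← ENNReal.ofReal_add (by positivity) (by positivity)]
  congr 1
  ring

/-- Given the sample `x`, the program approximates the distance from `ν` to `est x`; the triangle
inequality, used in both directions, replaces `est x` by `μ`. -/
theorem expect_estimate_le {d n : ℕ} (hn : 0 < n) {p γ : ℝ} (hp : 1 ≤ p)
    (μ ν : Measure (Cube d)) [IsProbabilityMeasure μ] [IsProbabilityMeasure ν]
    (est : Kernel (Fin n → Cube d) (Cube d)) [IsMarkovKernel est] :
    expect μ ν est (fun e => ENNReal.ofReal |estimate d p γ e - (wasserstein p ν μ).toReal|) ≤
      ENNReal.ofReal ((2 * √d + 1 + 3 * (8 * costBound d p + 6)) * (n : ℝ) ^ (-(γ / d))) +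
        ∫⁻ x, wasserstein p (est x) μ ∂(Measure.pi fun _ : Fin n => μ) := by
  have hp0 : 0 < p := by linarith
  have := standardBorelSpace_cube d
  rw [expect, ← mul_one (ENNReal.ofReal _), ← measure_univ (μ := Measure.pi fun _ : Fin n => μ),
    ← lintegral_const, ← lintegral_add_left measurable_const]
  refine lintegral_mono fun x => ?_
  have hpt : ∀ z y : ℕ → Cube d, ENNReal.ofReal |estimate d p γ (⟨x, z, y⟩ : Env d n) -
      (wasserstein p ν μ).toReal| ≤ ENNReal.ofReal |estimate d p γ (⟨x, z, y⟩ : Env d n) -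
      (wasserstein p ν (est x)).toReal| + wasserstein p (est x) μ := fun z y =>
    ofReal_abs_sub_toReal_le (wasserstein_ne_top hp0 _ _) (wasserstein_ne_top hp0 _ _)
      (wasserstein_triangle hp ν (est x) μ)
      (by rw [wasserstein_comm hp0 (est x) μ]; exact wasserstein_triangle hp ν μ (est x))
  refine (lintegral_mono fun z => lintegral_mono fun y => hpt z y).trans ?_
  simp only [lintegral_add_right _ measurable_const, lintegral_const, measure_univ, mul_one]
  gcongr
  exact lintegral_estimate_le hn hp x ν (est x)

/-! ### Running time -/

/-- The auction dominates with `L · M L · M = (M L)²`; apart from the cost `κ` of the draws, all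
else is of no larger order, since `m ≤ M`. -/
theorem mainTime_le (d D : ℕ) : ∃ c : ℕ, ∀ m L κ : ℕ, 0 < d → 0 < m → 0 < L →
    mainTime d D m L κ ≤ c * (m ^ d * L * (m ^ d * L) + m ^ d * L * L * κ) := by
  -- The constants of the seven parts of the program, bounded in `e1` to `e7` below.
  refine ⟨(48 + 4 * d) + (51 + 38 * d) + 70 + (9 + 31 * d) + (35 + 24 * d + 4 * D) +
    (2 + 645 * (D + 2)) + 47, fun m L κ hd hm hL => ?_⟩
  have hmM : m ≤ m ^ d := Nat.le_self_pow hd.ne' m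
  rw [mainTime]
  generalize m ^ d = M at *
  have hM : 0 < M := hm.trans_le hmM
  set Z := M * L * (M * L) with hZ
  have hML : 0 < M * L := Nat.mul_pos hM hL
  have h1 : M * L ≤ Z := Nat.le_mul_of_pos_left _ hML
  have hMZ : M ≤ Z := (Nat.le_mul_of_pos_right _ hL).trans h1
  have hLZ : L ≤ Z := (Nat.le_mul_of_pos_left _ hM).trans h1
  have h1Z : 1 ≤ Z := Nat.succ_le_of_lt (hM.trans_le hMZ)
  have hmZ : m ≤ Z := hmM.trans hMZ
  have hMML : M * (M * L) ≤ Z := Nat.mul_le_mul_right _ (Nat.le_mul_of_pos_right _ hL)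
  have hMM : M * M ≤ Z := (Nat.mul_le_mul_left _ (Nat.le_mul_of_pos_right _ hL)).trans hMML
  have hMLLM : M * L * L * M ≤ Z := le_of_eq (by rw [hZ]; ring)
  have hMLL : M * L * L ≤ Z := (Nat.le_mul_of_pos_right _ hM).trans hMLLM
  have hMLLm : M * L * L * m ≤ Z := (Nat.mul_le_mul_left _ hmM).trans hMLLM
  have e1 : 40 + 4 * d + 4 * m + 4 * L ≤ (48 + 4 * d) * Z := by nlinarith
  have e2 : 2 + M * L * L * (2 * κ + 47 + 2 * (d * (15 + 4 * m))) ≤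
      (51 + 38 * d) * (Z + M * L * L * κ) := by
    have := Nat.mul_le_mul_left d hMLL
    have := Nat.mul_le_mul_left d hMLLm
    have : 0 ≤ d * (M * L * L * κ) := Nat.zero_le _
    calc 2 + M * L * L * (2 * κ + 47 + 2 * (d * (15 + 4 * m))) =
        2 + 2 * (M * L * L * κ) + 47 * (M * L * L) + 30 * (d * (M * L * L)) +
          8 * (d * (M * L * L * m)) := by ring
      _ ≤ 51 * Z + 38 * (d * Z) + 51 * (M * L * L * κ) + 38 * (d * (M * L * L * κ)) := by omega
      _ = _ := by ring
  have e3 : 2 + M * (60 + 8 * (M * L)) ≤ 70 * Z := by nlinarith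
  have e4 : 2 + M * (7 + d * (27 + 4 * M)) ≤ (9 + 31 * d) * Z := by
    have := Nat.mul_le_mul_left d hMZ
    have := Nat.mul_le_mul_left d hMM
    calc 2 + M * (7 + d * (27 + 4 * M)) = 2 + 7 * M + 27 * (d * M) + 4 * (d * (M * M)) := by ring
      _ ≤ 9 * Z + 31 * (d * Z) := by omega
      _ = _ := by ring
  have e5 : 2 + M * (5 + M * (28 + 24 * d + 4 * (D * L))) ≤ (35 + 24 * d + 4 * D) * Z := by
    have := Nat.mul_le_mul_left d hMM
    have := Nat.mul_le_mul_left D hMML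
    calc 2 + M * (5 + M * (28 + 24 * d + 4 * (D * L))) =
        2 + 5 * M + 28 * (M * M) + 24 * (d * (M * M)) + 4 * (D * (M * (M * L))) := by ring
      _ ≤ 35 * Z + 24 * (d * Z) + 4 * (D * Z) := by omega
      _ = _ := by ring
  have e6 : 2 + (D * L + 2) * (M + M + M * L) * (135 + M * 80) ≤ (2 + 645 * (D + 2)) * Z := by
    have a1 : D * L + 2 ≤ (D + 2) * L := by nlinarith
    have a2 : M + M + M * L ≤ 3 * (M * L) := by nlinarith
    have a3 : 135 + M * 80 ≤ 215 * M := by omega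
    calc 2 + (D * L + 2) * (M + M + M * L) * (135 + M * 80) ≤
        2 * Z + (D + 2) * L * (3 * (M * L)) * (215 * M) := by gcongr; omega
      _ = _ := by rw [hZ]; ring
  have e7 : 12 + M * (5 + M * 30) ≤ 47 * Z := by nlinarith
  have hz : Z ≤ Z + M * L * L * κ := Nat.le_add_right _ _
  generalize Z + M * L * L * κ = Y at *
  have f1 := e1.trans (Nat.mul_le_mul_left _ hz)
  have f3 := e3.trans (Nat.mul_le_mul_left _ hz)
  have f4 := e4.trans (Nat.mul_le_mul_left _ hz)
  have f5 := e5.trans (Nat.mul_le_mul_left _ hz)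
  have f6 := e6.trans (Nat.mul_le_mul_left _ hz)
  have f7 := e7.trans (Nat.mul_le_mul_left _ hz)
  simp only [add_mul] at f1 e2 f3 f4 f5 f6 f7 ⊢
  omega

theorem natCeil_le_two_mul {x : ℝ} (hx : 1 ≤ x) : (⌈x⌉₊ : ℝ) ≤ 2 * x := by
  have := Nat.ceil_lt_add_one (zero_le_one.trans hx)
  linarith

theorem isBigO_mainTime {d : ℕ} (hd : 0 < d) {p γ : ℝ} (hp : 1 ≤ p) (hγ : 1 ≤ γ) (D : ℕ)
    {κ : ℕ → ℕ} (hκ : (fun n => (κ n : ℝ)) =O[atTop] (fun n : ℕ => (n : ℝ))) :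
    (fun n : ℕ => (mainTime d D ⌈(n : ℝ) ^ (γ / d)⌉₊ ⌈(n : ℝ) ^ (γ * p / d)⌉₊ (κ n) : ℝ))
      =O[atTop] fun n : ℕ => (n : ℝ) ^ (γ * (2 + 2 * p / (d : ℝ))) * Real.log n := by
  obtain ⟨c, hc⟩ := mainTime_le d D
  obtain ⟨K, hK0, hK⟩ := hκ.exists_nonneg
  rw [Asymptotics.isBigOWith_iff] at hK
  have hd' : (0 : ℝ) < d := by exact_mod_cast hd
  refine Asymptotics.IsBigO.of_bound (c * (2 ^ d * 2 * (2 ^ d * 2) + 2 ^ d * 2 * 2 * K)) ?_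
  filter_upwards [hK, eventually_ge_atTop 3] with n hκn hn
  have hn1 : (1 : ℝ) ≤ n := by exact_mod_cast (by omega : 1 ≤ n)
  have hn0 : (0 : ℝ) < n := by linarith
  -- The logarithm is only used as a factor that is at least 1.
  have hlog : 1 ≤ Real.log n := by
    rw [Real.le_log_iff_exp_le hn0]
    have : (3 : ℝ) ≤ n := by exact_mod_cast hn
    linarith [Real.exp_one_lt_three]
  rw [Real.norm_natCast, Real.norm_natCast] at hκn
  rw [Real.norm_natCast, Real.norm_of_nonneg (by positivity)]
  set m := ⌈(n : ℝ) ^ (γ / d)⌉₊ with hm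
  set L := ⌈(n : ℝ) ^ (γ * p / d)⌉₊ with hL
  have hm0 : 0 < m := Nat.ceil_pos.mpr (by positivity)
  have hL0 : 0 < L := Nat.ceil_pos.mpr (by positivity)
  have hmle : (m : ℝ) ≤ 2 * (n : ℝ) ^ (γ / d) :=
    natCeil_le_two_mul (Real.one_le_rpow hn1 (by positivity))
  have hLle : (L : ℝ) ≤ 2 * (n : ℝ) ^ (γ * p / d) :=
    natCeil_le_two_mul (Real.one_le_rpow hn1 (by positivity))
  have hMle : (m : ℝ) ^ d ≤ 2 ^ d * (n : ℝ) ^ γ := by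
    refine (pow_le_pow_left₀ (Nat.cast_nonneg m) hmle d).trans (le_of_eq ?_)
    rw [mul_pow, ← Real.rpow_natCast ((n : ℝ) ^ (γ / d)), ← Real.rpow_mul hn0.le,
      div_mul_cancel₀ _ hd'.ne']
  set g := (n : ℝ) ^ γ with hg
  set l := (n : ℝ) ^ (γ * p / d) with hl
  have hg0 : 0 < g := by positivity
  have hl0 : 0 < l := by positivity
  -- Here `γ ≥ 1` is needed: the cost `O(n)` of a draw is at most of order `n ^ γ`, the number of
  -- cells.
  have hng : (n : ℝ) ≤ g := by
    have := Real.rpow_le_rpow_of_exponent_le hn1 hγ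
    rwa [Real.rpow_one] at this
  have hpow : (n : ℝ) ^ (γ * (2 + 2 * p / (d : ℝ))) = g * l * (g * l) := by
    rw [hg, hl, ← Real.rpow_add hn0, ← Real.rpow_add hn0]
    congr 1
    ring
  have hle : (mainTime d D m L (κ n) : ℝ) ≤
      c * ((m : ℝ) ^ d * L * ((m : ℝ) ^ d * L) + (m : ℝ) ^ d * L * L * κ n) := by
    exact_mod_cast hc m L (κ n) hd hm0 hL0
  have hκg : (κ n : ℝ) ≤ K * g := hκn.trans (by gcongr)
  rw [hpow]
  calc (mainTime d D m L (κ n) : ℝ) ≤ _ := hle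
    _ ≤ c * ((2 ^ d * g) * (2 * l) * ((2 ^ d * g) * (2 * l)) +
        (2 ^ d * g) * (2 * l) * (2 * l) * (K * g)) := by gcongr
    _ = c * (2 ^ d * 2 * (2 ^ d * 2) + 2 ^ d * 2 * 2 * K) * (g * l * (g * l) * 1) := by ring
    _ ≤ _ := by gcongr

theorem measurable_estimate (d : ℕ) (p γ : ℝ) (n : ℕ) : Measurable
    (fun q : (Fin n → Cube d) × (ℕ → Cube d) × (ℕ → Cube d) =>
      estimate d p γ (⟨q.1, q.2.1, q.2.2⟩ : Env d n)) :=
  (Code.measurable_den (e := fun q : (Fin n → Cube d) × (ℕ → Cube d) × (ℕ → Cube d) =>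
      (⟨q.1, q.2.1, q.2.2⟩ : Env d n)) (fun k => by fun_prop) (fun k => by fun_prop)
    (mainCode d p γ (costBound d p)) (f := fun _ => Mem.zero)
    ⟨fun _ => measurable_const, fun _ _ _ => measurable_const, measurable_const, measurable_const,
      fun _ => measurable_const, measurable_const, measurable_const⟩).x

theorem computes_estimate {d n : ℕ} (hn : 0 < n) {p γ : ℝ} (hp : 1 ≤ p) (e : Env d n) (κ : ℕ) :
    Computes (mainCode d p γ (costBound d p)).compile e κ (estimate d p γ e)
      (mainTime d (costBound d p) ⌈(n : ℝ) ^ (γ / d)⌉₊ ⌈(n : ℝ) ^ (γ * p / d)⌉₊ κ) := by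
  have hp0 : 0 < p := by linarith
  have hn' : (0 : ℝ) < n := by exact_mod_cast hn
  have hm0 : 0 < ⌈(n : ℝ) ^ (γ / d)⌉₊ := Nat.ceil_pos.mpr (by positivity)
  obtain ⟨s, hs, hrep⟩ := Code.exec_compile (e := e) κ (mainCode d p γ (costBound d p))
    (mainCode_wf _ _ _ _) _ _ Rep.zero
  exact ⟨s, _, hs, hrep.x, (Code.main_spec e κ hn hp0 rfl rfl
    fun i _ j _ => cellCost_le hm0 _ d hp0 i j).2⟩

end WassersteinTradeoff

end

/-! ### The theorem -/

theorem theorem8 (d : ℕ) (hd : 0 < d) (p : ℝ) (hp : 1 ≤ p) (γ : ℝ) (hγ : 1 ≤ γ) :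
    ∃ (P : WassersteinTradeoff.Prog)
      (W : (n : ℕ) → WassersteinTradeoff.Env d n → ℝ),
      -- the estimate is a random variable
      (∀ n : ℕ, Measurable
        (fun q : (Fin n → WassersteinTradeoff.Cube d) ×
            (ℕ → WassersteinTradeoff.Cube d) × (ℕ → WassersteinTradeoff.Cube d) =>
          W n ⟨q.1, q.2.1, q.2.2⟩)) ∧
      -- it is computed in the claimed time, if a point can be drawn in time `O(n)`
      (∀ κ : ℕ → ℕ, (fun n => (κ n : ℝ)) =O[atTop] (fun n : ℕ => (n : ℝ)) →
        ∃ T : ℕ → ℕ,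
          ((fun n => (T n : ℝ)) =O[atTop]
            (fun n : ℕ => (n : ℝ) ^ (γ * (2 + 2 * p / (d : ℝ))) * Real.log n)) ∧
          ∀ n : ℕ, 1 ≤ n → ∀ e : WassersteinTradeoff.Env d n,
            WassersteinTradeoff.Computes P e (κ n) (W n e) (T n)) ∧
      -- it has the claimed accuracy
      (∀ γs : ℝ, γ ≤ γs → ∀ C₀ : ℝ, ∃ C : ℝ,
        ∀ (S : Set (ProbabilityMeasure (WassersteinTradeoff.Cube d)))
          (est : (n : ℕ) →
            Kernel (Fin n → WassersteinTradeoff.Cube d) (WassersteinTradeoff.Cube d))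
          [∀ n, IsMarkovKernel (est n)],
          (∀ μ ∈ S, ∀ n : ℕ, 1 ≤ n →
            ∫⁻ x, WassersteinTradeoff.wasserstein p (est n x)
                (μ : Measure (WassersteinTradeoff.Cube d))
              ∂(Measure.pi fun _ : Fin n => (μ : Measure (WassersteinTradeoff.Cube d)))
            ≤ ENNReal.ofReal (C₀ * (n : ℝ) ^ (-(γs / (d : ℝ))))) →
          ∀ ν : ProbabilityMeasure (WassersteinTradeoff.Cube d), ∀ μ ∈ S, ∀ n : ℕ, 1 ≤ n →
            WassersteinTradeoff.expect (μ : Measure (WassersteinTradeoff.Cube d))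
              (ν : Measure (WassersteinTradeoff.Cube d)) (est n)
              (fun e => ENNReal.ofReal
                |W n e - (WassersteinTradeoff.wasserstein p
                  (ν : Measure (WassersteinTradeoff.Cube d))
                  (μ : Measure (WassersteinTradeoff.Cube d))).toReal|)
            ≤ ENNReal.ofReal (C * (n : ℝ) ^ (-(γ / (d : ℝ))))) := by

  refine ⟨(WassersteinTradeoff.mainCode d p γ (WassersteinTradeoff.costBound d p)).compile,
    fun _ => WassersteinTradeoff.estimate d p γ, WassersteinTradeoff.measurable_estimate d p γ,
    fun κ hκ => ⟨_, WassersteinTradeoff.isBigO_mainTime hd hp hγ _ hκ, fun n hn e =>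
      WassersteinTradeoff.computes_estimate hn hp e (κ n)⟩, fun γs hγs C₀ =>
    ⟨2 * √d + 1 + 3 * (8 * WassersteinTradeoff.costBound d p + 6) + |C₀|, ?_⟩⟩
  intro S est _ hS ν μ hμ n hn
  refine (WassersteinTradeoff.expect_estimate_le hn hp _ _ (est n)).trans ?_
  refine (add_le_add le_rfl (hS μ hμ n hn)).trans ?_
  have hn1 : (1 : ℝ) ≤ n := by exact_mod_cast hn
  -- The error of the estimator decays at least as fast as the target rate, as `n ≥ 1` and `γ ≤ γs`.
  -- The absolute value allows for a negative `C₀`.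
  have hle : C₀ * (n : ℝ) ^ (-(γs / (d : ℝ))) ≤ |C₀| * (n : ℝ) ^ (-(γ / (d : ℝ))) := by
    refine (mul_le_mul_of_nonneg_right (le_abs_self C₀) (by positivity)).trans ?_
    gcongr
  refine (add_le_add le_rfl (ENNReal.ofReal_le_ofReal hle)).trans (le_of_eq ?_)
  rw [← ENNReal.ofReal_add (by positivity) (by positivity), ← add_mul]
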